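/- Let $d\in\{2,3\}$, let $\Omega\subset\mathbb R^d$ be a bounded polygonal/polyhedral domain (open, connected, equal to the interior of its closure), and let $k\ge 3$. Let $\mathbb S$ denote the symmetric $d\times d$ matrices. Let $\mathcal T_h$ range over the conforming triangulations of $\overline\Omega$ by triangles ($d=2$) or tetrahedra ($d=3$) that are shape regular and quasi-uniform with fixed constants $\gamma,\theta$: each $K\in\mathcal T_h$ satisfies $\operatorname{diam}K\le\gamma\,\rho_K$, where $\rho_K$ is the diameter of the largest ball contained in $K$, and $\max_{K'\in\mathcal T_h}\operatorname{diam}K'\le\theta\operatorname{diam}K$. Let $\mathcal F_h$ be the set of $(d-1)$-dimensional faces of $\mathcal T_h$ (edges if $d=2$), and $\mathcal F_h^i$ the set of those not contained in $\partial\Omega$. For $F\in\mathcal F_h$ let $h_F$ be its diameter, $\boldsymbol n_F$ a fixed unit normal (outward if $F\subset\partial\Omega$), and $[w]_F=(w|_{K_+}-w|_{K_-})|_F$ the jump across $F=K_+\cap K_-$, which is the trace $w|_F$ if $F\subset\partial\Omega$. The operator $\operatorname{Div}$ acts row-wise on matrix functions. Define $$\mathcal U_{k,h}=\{\boldsymbol\tau\in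 H(\operatorname{div},\Omega;\mathbb S):\ \boldsymbol\tau=\boldsymbol\tau_c+\boldsymbol\tau_b,\ \boldsymbol\tau_c\in H^1(\Omega;\mathbb S),\ \boldsymbol\tau_c|_K,\boldsymbol\tau_b|_K\in P_k(K;\mathbb S),\ \boldsymbol\tau_b|_K\boldsymbol n=0\text{ on }\partial K\ \ \forall K\in\mathcal T_h\},$$ $$\Sigma_h=\{\boldsymbol\tau\in\mathcal U_{k,h}:\ (\mathbf I-\boldsymbol n_F\boldsymbol n_F^{\mathrm T})\boldsymbol\tau\boldsymbol n_F=0\text{ on }F\ \ \forall F\in\mathcal F_h\setminus\mathcal F_h^i,\quad [\operatorname{Div}\boldsymbol\tau\cdot\boldsymbol n_F]_F=0\ \ \forall F\in\mathcal F_h\},$$ $$V_h=\{v\in L^2(\Omega):\ v|_K\in P_{k-2}(K)\ \ \forall K\in\mathcal T_h\},$$ and, for $v_h\in V_h$, $$|v_h|_{2,h}^2=\sum_{K\in\mathcal T_h}|v_h|_{H^2(K)}^2+\sum_{F\in\mathcal F_h^i}h_F^{-3}\|[v_h]_F\|_{L^2(F)}^2+\sum_{F\in\mathcal F_h}h_F^{-1}\|[\partial_n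 v_h]_F\|_{L^2(F)}^2 .$$ Then there is a constant $\beta>0$, depending only on $d,\Omega,k,\gamma,\theta$ and in particular not on the triangulation or its mesh size, such that for every such $\mathcal T_h$ each $\boldsymbol\tau_h\in\Sigma_h$ has a weak $\operatorname{divDiv}\boldsymbol\tau_h\in L^2(\Omega)$, and $$\sup_{0\ne\boldsymbol\tau_h\in\Sigma_h}\frac{(\operatorname{divDiv}\boldsymbol\tau_h,v_h)_{L^2(\Omega)}}{\|\boldsymbol\tau_h\|_{L^2}}\ \ge\ \beta\,|v_h|_{2,h}\qquad\forall v_h\in V_h .$$ -/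

import Mathlib

open MeasureTheory Set
open scoped ContDiff MeasureTheory

namespace DivDivFEM

/-- The Euclidean space `ℝᵈ`. -/
abbrev E (d : ℕ) : Type := EuclideanSpace ℝ (Fin d)

/-! ## Weak derivatives and Sobolev spaces on an open set -/

/-- The classical partial derivative of `φ` in the direction of the `i`-th coordinate. -/
noncomputable def partialDeriv {d : ℕ} (i : Fin d) (φ : E d → ℝ) (x : E d) : ℝ :=
  fderiv ℝ φ x (EuclideanSpace.single i 1)

/-- Test functions: the space `C₀^∞(Ω)`. -/
def IsTestFunction {d : ℕ} (Ω : Set (E d)) (φ : E d → ℝ) : Prop :=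
  ContDiff ℝ ∞ φ ∧ HasCompactSupport φ ∧ tsupport φ ⊆ Ω

/-- `f ∈ L²(Ω)`. -/
def InL2 {d : ℕ} (Ω : Set (E d)) (f : E d → ℝ) : Prop :=
  MemLp f 2 (volume.restrict Ω)

/-- `τ ∈ L²(Ω; 𝕊)`: square integrable with values in the symmetric matrices. -/
def InL2Sym {d : ℕ} (Ω : Set (E d)) (τ : E d → Matrix (Fin d) (Fin d) ℝ) : Prop :=
  (∀ i j, InL2 Ω (fun x => τ x i j)) ∧ ∀ᵐ x ∂(volume.restrict Ω), (τ x).IsSymm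

/-- `g` is the weak `i`-th partial derivative of `f` on `Ω`, and `g ∈ L²(Ω)`. -/
def HasWeakPartial {d : ℕ} (Ω : Set (E d)) (i : Fin d) (f g : E d → ℝ) : Prop :=
  InL2 Ω g ∧ ∀ φ : E d → ℝ, IsTestFunction Ω φ →
    ∫ x in Ω, f x * partialDeriv i φ x = -∫ x in Ω, g x * φ x

/-- `τ ∈ H¹(Ω; 𝕊)`. -/
def InH1Sym {d : ℕ} (Ω : Set (E d)) (τ : E d → Matrix (Fin d) (Fin d) ℝ) : Prop :=
  InL2Sym Ω τ ∧ ∀ i j l, ∃ g : E d → ℝ, HasWeakPartial Ω l (fun x => τ x i j) g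

/-- `g` is the weak row-wise divergence `Div τ` on `Ω`, and `g ∈ L²(Ω; ℝᵈ)`. -/
def HasWeakDiv {d : ℕ} (Ω : Set (E d)) (τ : E d → Matrix (Fin d) (Fin d) ℝ)
    (g : Fin d → E d → ℝ) : Prop :=
  ∀ i, InL2 Ω (g i) ∧ ∀ φ : E d → ℝ, IsTestFunction Ω φ →
    ∫ x in Ω, ∑ j, τ x i j * partialDeriv j φ x = -∫ x in Ω, g i x * φ x

/-- `τ ∈ H(div, Ω; 𝕊)`. -/
def InHdivSym {d : ℕ} (Ω : Set (E d)) (τ : E d → Matrix (Fin d) (Fin d) ℝ) : Prop :=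
  InL2Sym Ω τ ∧ ∃ g : Fin d → E d → ℝ, HasWeakDiv Ω τ g

/-- `g` is the weak `divDiv τ` on `Ω`, and `g ∈ L²(Ω)`. -/
def HasWeakDivDiv {d : ℕ} (Ω : Set (E d)) (τ : E d → Matrix (Fin d) (Fin d) ℝ)
    (g : E d → ℝ) : Prop :=
  InL2 Ω g ∧ ∀ φ : E d → ℝ, IsTestFunction Ω φ →
    ∫ x in Ω, ∑ i, ∑ j, τ x i j * partialDeriv i (partialDeriv j φ) x = ∫ x in Ω, g x * φ x

/-- `‖τ‖_{L²(Ω)}` for matrix functions (Frobenius norm pointwise). -/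
noncomputable def l2Norm {d : ℕ} (Ω : Set (E d)) (τ : E d → Matrix (Fin d) (Fin d) ℝ) : ℝ :=
  Real.sqrt (∫ x in Ω, ∑ i, ∑ j, τ x i j ^ 2)

/-! ## Polynomials on simplices -/

/-- The value of the polynomial `p` at the point `x`. -/
noncomputable def polyEval {d : ℕ} (p : MvPolynomial (Fin d) ℝ) (x : E d) : ℝ :=
  MvPolynomial.eval (fun i => x i) p

/-- The closed simplex with vertex set `K`. -/
def hull {d : ℕ} (K : Finset (E d)) : Set (E d) := convexHull ℝ (K : Set (E d))

/-- `f` restricted to `K` is (almost everywhere) the polynomial `p`. -/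
def AgreesOn {d : ℕ} (K : Finset (E d)) (f : E d → ℝ) (p : MvPolynomial (Fin d) ℝ) : Prop :=
  ∀ᵐ x ∂(volume.restrict (hull K)), f x = polyEval p x

/-- `f|_K ∈ P_m(K)`. -/
def IsPolyOn {d : ℕ} (K : Finset (E d)) (m : ℕ) (f : E d → ℝ) : Prop :=
  ∃ p : MvPolynomial (Fin d) ℝ, p.totalDegree ≤ m ∧ AgreesOn K f p

/-- The polynomial with which `f` agrees on `K`; on a nondegenerate simplex it is unique,
see `localPoly_eq`.  It provides the traces of `f|_K` and of its derivatives on `∂K`. -/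
noncomputable def localPoly {d : ℕ} (K : Finset (E d)) (f : E d → ℝ) : MvPolynomial (Fin d) ℝ :=
  Classical.epsilon (fun p => AgreesOn K f p)

theorem localPoly_eq {d : ℕ} {K : Finset (E d)} (hK : (interior (hull K)).Nonempty)
    {f : E d → ℝ} {p : MvPolynomial (Fin d) ℝ} (hp : AgreesOn K f p) : localPoly K f = p := by
  have hq : AgreesOn K f (localPoly K f) := Classical.epsilon_spec ⟨p, hp⟩
  set q := localPoly K f
  have hcont : ∀ r : MvPolynomial (Fin d) ℝ, Continuous (fun x : E d => polyEval r x) := by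
    intro r
    exact (MvPolynomial.continuous_eval r).comp (by fun_prop)
  have hae : (fun x => polyEval q x) =ᵐ[volume.restrict (interior (hull K))]
      (fun x => polyEval p x) := by
    have h1 : ∀ᵐ x ∂(volume.restrict (hull K)), polyEval q x = polyEval p x := by
      filter_upwards [hp, hq] with x h h'
      rw [← h, ← h']
    exact ae_mono (Measure.restrict_mono interior_subset le_rfl) h1
  have heq : EqOn (fun x => polyEval q x) (fun x => polyEval p x) (interior (hull K)) :=
    Measure.eqOn_open_of_ae_eq hae isOpen_interior (hcont q).continuousOn (hcont p).continuousOn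
  obtain ⟨x₀, hx₀⟩ := hK
  have hopen : IsOpen ((WithLp.toLp 2 : (Fin d → ℝ) → E d) ⁻¹' interior (hull K)) :=
    isOpen_interior.preimage (PiLp.continuous_toLp 2 _)
  obtain ⟨ε, hε, hball⟩ := Metric.isOpen_iff.1 hopen (WithLp.ofLp x₀) (by simpa using hx₀)
  refine MvPolynomial.funext_set (s := fun i => Metric.ball (x₀ i) ε) (fun i => ?_) ?_
  · exact (infinite_of_mem_nhds (x₀ i) (Metric.ball_mem_nhds _ hε))
  · intro y hy
    have hy' : y ∈ Metric.ball (WithLp.ofLp x₀) ε := by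
      rw [ball_pi _ hε]; exact hy
    exact heq (hball hy')

/-! ## Triangulations -/

/-- A conforming triangulation of `closure Ω ⊆ ℝᵈ` by nondegenerate `d`-simplices: a finite
geometric simplicial complex with underlying space `closure Ω`, all of whose simplices are faces
of `d`-dimensional ones.  Simplices are given by their vertex sets. -/
structure Triangulation {d : ℕ} (Ω : Set (E d)) extends Geometry.SimplicialComplex ℝ (E d) where
  finite_faces : faces.Finite
  pure_faces : ∀ s ∈ faces, ∃ t ∈ faces, s ⊆ t ∧ t.card = d + 1
  cover : (⋃ s ∈ faces, convexHull ℝ (s : Set (E d))) = closure Ω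

namespace Triangulation

variable {d : ℕ} {Ω : Set (E d)} (T : Triangulation Ω)

/-- The elements (triangles for `d = 2`, tetrahedra for `d = 3`). -/
noncomputable def elements : Finset (Finset (E d)) :=
  T.finite_faces.toFinset.filter (fun s => s.card = d + 1)

/-- The `(d-1)`-dimensional faces (edges for `d = 2`, faces for `d = 3`). -/
noncomputable def sides : Finset (Finset (E d)) :=
  T.finite_faces.toFinset.filter (fun s => s.card = d)

/-- Sides on the boundary of `Ω`. -/
def IsBoundary (_T : Triangulation Ω) (F : Finset (E d)) : Prop := hull F ⊆ frontier Ω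

open scoped Classical in
/-- Interior sides. -/
noncomputable def interiorSides : Finset (Finset (E d)) :=
  T.sides.filter (fun F => ¬ T.IsBoundary F)

/-- Shape regularity with constant `γ`: the diameter of each element is at most `γ` times the
diameter of a ball contained in it. -/
def ShapeRegular (γ : ℝ) : Prop :=
  ∀ K ∈ T.elements, ∃ (x : E d) (r : ℝ), 0 < r ∧ Metric.closedBall x r ⊆ hull K ∧
    Metric.diam (hull K) ≤ γ * (2 * r)

/-- Quasi-uniformity with constant `θ`: the mesh size is at most `θ` times the diameter of any
element. -/
def QuasiUniform (θ : ℝ) : Prop :=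
  ∀ K ∈ T.elements, ∀ K' ∈ T.elements, Metric.diam (hull K') ≤ θ * Metric.diam (hull K)

/-- The element `K₊` attached to a side (the only one, if the side lies on the boundary). -/
noncomputable def plus (F : Finset (E d)) : Finset (E d) :=
  Classical.epsilon (fun K => K ∈ T.elements ∧ F ⊆ K)

/-- The unit normal `n_F` of the side `F`, pointing out of `K₊`. -/
noncomputable def normal (F : Finset (E d)) : E d :=
  Classical.epsilon (fun n : E d => ‖n‖ = 1 ∧ (∀ x ∈ F, ∀ y ∈ F, inner ℝ n (x - y) = 0) ∧
    ∀ x ∈ F, ∀ a ∈ T.plus F, inner ℝ n (a - x) ≤ 0)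

open scoped Classical in
/-- The jump `[u]_F = u|_{K₊} - u|_{K₋}` across a side `F`, for a family of functions `u K`
indexed by the elements.  For a boundary side there is no `K₋` and it is the trace of
`u|_{K₊}`. -/
noncomputable def jump (u : Finset (E d) → E d → ℝ) (F : Finset (E d)) (x : E d) : ℝ :=
  u (T.plus F) x - ∑ K ∈ T.elements.filter (fun K => F ⊆ K ∧ K ≠ T.plus F), u K x

/-! ## The discrete spaces -/

/-- The vector `M n`, where `M` is the value at `x` of a matrix of polynomials. -/
noncomputable def normalTrace (P : Matrix (Fin d) (Fin d) (MvPolynomial (Fin d) ℝ)) (n x : E d) :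
    E d :=
  WithLp.toLp 2 (fun i => ∑ j, polyEval (P i j) x * n j)

/-- The projection `(I - n nᵀ) w`; for `d = 2` this is `(tᵀ w) t` with a unit vector `t`
orthogonal to `n`. -/
noncomputable def tangentialPart (n w : E d) : E d := w - inner ℝ n w • n

/-- `τ|_K` as a matrix of polynomials. -/
noncomputable def localMat (τ : E d → Matrix (Fin d) (Fin d) ℝ) (K : Finset (E d)) :
    Matrix (Fin d) (Fin d) (MvPolynomial (Fin d) ℝ) :=
  fun i j => localPoly K (fun x => τ x i j)

/-- `(Div τ|_K) · n` at the point `x`. -/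
noncomputable def divNormal (τ : E d → Matrix (Fin d) (Fin d) ℝ) (n : E d) (K : Finset (E d))
    (x : E d) : ℝ :=
  ∑ i, (∑ j, polyEval (MvPolynomial.pderiv j (localMat τ K i j)) x) * n i

/-- `(∇ v|_K) · n` at the point `x`. -/
noncomputable def gradNormal (v : E d → ℝ) (n : E d) (K : Finset (E d)) (x : E d) : ℝ :=
  ∑ i, polyEval (MvPolynomial.pderiv i (localPoly K v)) x * n i

/-- `τ|_K ∈ P_k(K; 𝕊)` for every element `K`. -/
def PiecewisePolySym (k : ℕ) (τ : E d → Matrix (Fin d) (Fin d) ℝ) : Prop :=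
  InL2Sym Ω τ ∧ ∀ K ∈ T.elements, ∀ i j, IsPolyOn K k (fun x => τ x i j)

/-- `τ|_K ∈ {σ ∈ P_k(K; 𝕊) : σ n = 0 on ∂K}` for every element `K`. -/
def IsBubble (k : ℕ) (τ : E d → Matrix (Fin d) (Fin d) ℝ) : Prop :=
  T.PiecewisePolySym k τ ∧ ∀ K ∈ T.elements, ∀ F ∈ T.sides, F ⊆ K → ∀ x ∈ hull F,
    normalTrace (localMat τ K) (T.normal F) x = 0

/-- The `H(div, Ω; 𝕊)`-conforming space `𝒰_{k,h}`. -/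
def USpace (k : ℕ) : Set (E d → Matrix (Fin d) (Fin d) ℝ) :=
  {τ | InHdivSym Ω τ ∧ ∃ τc τb : E d → Matrix (Fin d) (Fin d) ℝ,
    (∀ᵐ x ∂(volume.restrict Ω), τ x = τc x + τb x) ∧
    InH1Sym Ω τc ∧ T.PiecewisePolySym k τc ∧ T.IsBubble k τb}

/-- The space `Σ_h`: those `τ ∈ 𝒰_{k,h}` with vanishing tangential part of `τ n` on the boundary
sides and vanishing jump of `Div τ · n` on all sides, the boundary sides included. -/
def SigmaH (k : ℕ) : Set (E d → Matrix (Fin d) (Fin d) ℝ) :=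
  {τ | τ ∈ T.USpace k ∧
    (∀ F ∈ T.sides, T.IsBoundary F → ∀ x ∈ hull F,
      tangentialPart (T.normal F)
        (normalTrace (localMat τ (T.plus F)) (T.normal F) x) = 0) ∧
    (∀ F ∈ T.sides, ∀ x ∈ hull F, T.jump (divNormal τ (T.normal F)) F x = 0)}

/-- The space `V_h` of piecewise polynomials of degree at most `k - 2` (used for `k ≥ 3`). -/
def VH (k : ℕ) : Set (E d → ℝ) :=
  {v | InL2 Ω v ∧ ∀ K ∈ T.elements, IsPolyOn K (k - 2) v}

/-! ## The mesh-dependent seminorm and the inf-sup quotients -/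

/-- `|v|²_{H²(K)}` for `v` polynomial on `K`. -/
noncomputable def h2SeminormSq (v : E d → ℝ) (K : Finset (E d)) : ℝ :=
  ∫ x in hull K, ∑ i, ∑ j,
    polyEval (MvPolynomial.pderiv i (MvPolynomial.pderiv j (localPoly K v))) x ^ 2

/-- `h_F`. -/
noncomputable def sideDiam (F : Finset (E d)) : ℝ := Metric.diam (hull F)

/-- `‖w‖²_{L²(F)}` with respect to the `(d-1)`-dimensional surface measure. -/
noncomputable def sideNormSq (F : Finset (E d)) (w : E d → ℝ) : ℝ :=
  ∫ x in hull F, w x ^ 2 ∂(Measure.euclideanHausdorffMeasure (d - 1))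

/-- The mesh-dependent seminorm `|v|_{2,h}`. -/
noncomputable def seminorm2h (v : E d → ℝ) : ℝ :=
  Real.sqrt (∑ K ∈ T.elements, h2SeminormSq v K
    + ∑ F ∈ T.interiorSides, (sideDiam F ^ 3)⁻¹ *
        sideNormSq F (T.jump (fun K => polyEval (localPoly K v)) F)
    + ∑ F ∈ T.sides, (sideDiam F)⁻¹ * sideNormSq F (T.jump (gradNormal v (T.normal F)) F))

/-- The quotients `(divDiv τ_h, v) / ‖τ_h‖_{L²}` for `0 ≠ τ_h ∈ Σ_h`. -/
def infSupQuotients (k : ℕ) (v : E d → ℝ) : Set ℝ :=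
  {r | ∃ τ ∈ T.SigmaH k, l2Norm Ω τ ≠ 0 ∧ ∃ g : E d → ℝ, HasWeakDivDiv Ω τ g ∧
    r = (∫ x in Ω, g x * v x) / l2Norm Ω τ}

end Triangulation

end DivDivFEM

/-!
The inf-sup bound is proved by constructing, for each `v ∈ V_h`, one field `τ ∈ Σ_h` with
`(divDiv τ, v) ≥ c |v|²` and `‖τ‖² ≤ C |v|²`, where `|·|` is the mesh-dependent seminorm and the
constants depend only on the polynomial degree, the dimension and the shape regularity constant
(`exists_test_field`).  Quasi-uniformity is not needed.  Throughout, the dimension is `n + 1` and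
the degree is `k = m + 3`.

Integrating by parts twice on each element (`IsFieldData.integral_divDiv`) gives, for `τ` with
normal trace `z_F n_F` and normal component of the divergence `D_F` on each side `F`,
`(divDiv τ, v) = ∑_K (τ, ∇²v)_K + ∑_F (D_F, [v]_F)_F - ∑_F (z_F, [∂ₙv]_F)_F`.
This suggests `z_F = -h_F⁻¹ b_F [∂ₙv]_F` with the bubble function `b_F` of the side, and
`D_F = h_F⁻³ [v]_F`, except that `D_F = 0` on the boundary (`exists_sideData`); the degree of
`z_F` is at most `k` since `n + 1 ≤ 3`.  Such a `τ` is built element by element from two kinds of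
fields.

* `sideField`: the sum over the sides of `z_F n_F n_Fᵀ`, where `z_F` is a polynomial in the
  barycentric coordinates of the vertices of `F` which vanishes on all other sides.  It is
  continuous across the sides, hence in `H¹`, and it carries the normal traces.
* `edgeField`: the sum of `q_{ab} λ_a λ_b (b - a)(b - a)ᵀ` over the edges of an element.  Its normal
  trace vanishes, since on the side opposite to `c` the edges not containing `c` are tangential
  and the others have the factor `λ_c = 0`.  On this side the normal component of its divergence
  is a multiple of `∑_b λ_b q_{cb}`, and these combinations can be prescribed, for all sides at the
  same time, as arbitrary polynomials of degree `k - 1` (`exists_edge_system`).  In this way the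
  divergence of the side fields is corrected to `D_F` (`exists_correction`).

The Hessians are tested with the edge field whose `q_{ab}` is
`h⁻⁴ λ_a λ_b ∂²v/∂(b - a)²`, which is multiplied by a large constant (`exists_hess_bounds`).  Here
the normal component of the divergence vanishes too, so the side terms are unaffected, and the
squares of the directions of the edges span the symmetric matrices, so the Hessian is controlled
(`hess_eq_sum_edgeHess`).

The scaling uses that a polynomial on a simplex is a homogeneous polynomial in the barycentric
coordinates; all norms on these are equivalent by compactness (`exists_coeffNorm_sq_le`), and the
integrals over simplices and their faces differ from those over the reference simplex by a factor
only (`integral_convexHull`, `IsSimplex.integral_erase`).  The last of these and the divergence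
theorem on a simplex (`IsSimplex.integral_hull_fderiv`) are derived here for the
`n`-dimensional Hausdorff measure on the faces.

If `|v| = 0`, the bound only asserts that the supremum is nonnegative; the test field of some
function of positive seminorm, with a suitable sign, shows this (`inf_sup`).
-/

namespace DivDivFEM

/-! ### Integration over the reference simplex -/

/-- The reference simplex `{y ≥ 0, ∑ yᵢ ≤ 1}` in `ℝⁿ`. -/
def refSimplex (n : ℕ) : Set (Fin n → ℝ) := {y | (∀ i, 0 ≤ y i) ∧ ∑ i, y i ≤ 1}

/-- The barycentric coordinates of a point of `ℝⁿ` with respect to the reference simplex; the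
coordinate of the origin comes first. -/
def refBary {n : ℕ} (y : Fin n → ℝ) : Fin (n + 1) → ℝ := Fin.cons (1 - ∑ i, y i) y

/-- The integral over the reference simplex of a function of the barycentric coordinates. -/
noncomputable def refInt (n : ℕ) (G : (Fin (n + 1) → ℝ) → ℝ) : ℝ :=
  ∫ y in refSimplex n, G (refBary y)

theorem isClosed_refSimplex (n : ℕ) : IsClosed (refSimplex n) := by
  have : refSimplex n = (⋂ i, {y | 0 ≤ y i}) ∩ {y : Fin n → ℝ | ∑ i, y i ≤ 1} := by
    ext y; simp [refSimplex]
  rw [this]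
  exact (isClosed_iInter fun i => isClosed_le continuous_const (continuous_apply i)).inter
    (isClosed_le (by fun_prop) continuous_const)

theorem refSimplex_subset_Icc (n : ℕ) : refSimplex n ⊆ Icc 0 1 := by
  intro y hy
  refine ⟨hy.1, fun i => ?_⟩
  exact (Finset.single_le_sum (fun j _ => hy.1 j) (Finset.mem_univ i)).trans hy.2

theorem isCompact_refSimplex (n : ℕ) : IsCompact (refSimplex n) :=
  isCompact_Icc.of_isClosed_subset (isClosed_refSimplex n) (refSimplex_subset_Icc n)

theorem measurableSet_refSimplex (n : ℕ) : MeasurableSet (refSimplex n) :=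
  (isClosed_refSimplex n).measurableSet

theorem continuous_refBary {n : ℕ} : Continuous (refBary (n := n)) := by
  refine continuous_pi fun i => ?_
  refine Fin.cases ?_ (fun j => ?_) i
  · simp only [refBary, Fin.cons_zero]; fun_prop
  · simp only [refBary, Fin.cons_succ]; fun_prop

theorem sum_refBary {n : ℕ} (y : Fin n → ℝ) : ∑ i, refBary y i = 1 := by
  rw [Fin.sum_univ_succ]; simp [refBary]

theorem refBary_nonneg {n : ℕ} {y : Fin n → ℝ} (hy : y ∈ refSimplex n) (i : Fin (n + 1)) :
    0 ≤ refBary y i := by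
  refine Fin.cases ?_ (fun j => ?_) i
  · simpa [refBary] using hy.2
  · simpa [refBary] using hy.1 j

theorem refBary_le_one {n : ℕ} {y : Fin n → ℝ} (hy : y ∈ refSimplex n) (i : Fin (n + 1)) :
    refBary y i ≤ 1 := by
  rw [← sum_refBary y]
  exact Finset.single_le_sum (fun j _ => refBary_nonneg hy j) (Finset.mem_univ i)

theorem integrableOn_refSimplex {n : ℕ} {G : (Fin (n + 1) → ℝ) → ℝ} (hG : Continuous G) :
    IntegrableOn (fun y => G (refBary y)) (refSimplex n) :=
  (hG.comp continuous_refBary).continuousOn.integrableOn_compact (isCompact_refSimplex n)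

theorem refInt_mono {n : ℕ} {G G' : (Fin (n + 1) → ℝ) → ℝ} (hG : Continuous G)
    (hG' : Continuous G')
    (h : ∀ l : Fin (n + 1) → ℝ, (∀ i, 0 ≤ l i) → (∀ i, l i ≤ 1) → ∑ i, l i = 1 → G l ≤ G' l) :
    refInt n G ≤ refInt n G' :=
  setIntegral_mono_on (integrableOn_refSimplex hG) (integrableOn_refSimplex hG')
    (measurableSet_refSimplex n)
    (fun y hy => h _ (refBary_nonneg hy) (refBary_le_one hy) (sum_refBary y))

theorem isOpen_refInterior (n : ℕ) : IsOpen {y : Fin n → ℝ | (∀ i, 0 < y i) ∧ ∑ i, y i < 1} := by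
  have : {y : Fin n → ℝ | (∀ i, 0 < y i) ∧ ∑ i, y i < 1}
      = (⋂ i, {y | 0 < y i}) ∩ {y : Fin n → ℝ | ∑ i, y i < 1} := by
    ext y; simp
  rw [this]
  exact (isOpen_iInter_of_finite fun i => isOpen_lt continuous_const (continuous_apply i)).inter
    (isOpen_lt (by fun_prop) continuous_const)

/-- A nonnegative continuous function with zero integral over the reference simplex vanishes at
all points with positive barycentric coordinates. -/
theorem eq_zero_of_refInt_eq_zero {n : ℕ} {G : (Fin (n + 1) → ℝ) → ℝ} (hG : Continuous G)
    (h0 : ∀ l : Fin (n + 1) → ℝ, 0 ≤ G l) (h : refInt n G = 0)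
    {l : Fin (n + 1) → ℝ} (hl : ∀ i, 0 < l i) (hs : ∑ i, l i = 1) : G l = 0 := by
  have hU := isOpen_refInterior n
  set U := {y : Fin n → ℝ | (∀ i, 0 < y i) ∧ ∑ i, y i < 1}
  have hsub : U ⊆ refSimplex n := fun y hy => ⟨fun i => (hy.1 i).le, hy.2.le⟩
  have h1 : (fun y => G (refBary y)) =ᵐ[volume.restrict (refSimplex n)] 0 :=
    (setIntegral_eq_zero_iff_of_nonneg_ae (Filter.Eventually.of_forall fun y => h0 _)
      (integrableOn_refSimplex hG)).1 h
  have h2 : (fun y => G (refBary y)) =ᵐ[volume.restrict U] 0 :=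
    ae_mono (Measure.restrict_mono hsub le_rfl) h1
  have h3 := Measure.eqOn_open_of_ae_eq h2 hU (hG.comp continuous_refBary).continuousOn
    continuousOn_const
  rw [Fin.sum_univ_succ] at hs
  have hy : (fun i : Fin n => l i.succ) ∈ U := ⟨fun i => hl _, by linarith [hl 0]⟩
  have h4 := h3 hy
  have h5 : refBary (fun i : Fin n => l i.succ) = l := by
    funext i
    refine Fin.cases ?_ (fun j => ?_) i
    · simp only [refBary, Fin.cons_zero]; linarith
    · simp [refBary]
  simpa [h5] using h4

theorem refInt_one_pos (n : ℕ) : 0 < refInt n (fun _ => 1) := by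
  have h0 : 0 ≤ refInt n (fun _ => 1) :=
    setIntegral_nonneg (measurableSet_refSimplex n) (fun _ _ => zero_le_one)
  refine lt_of_le_of_ne h0 (fun h => ?_)
  have := eq_zero_of_refInt_eq_zero (l := fun _ => ((n : ℝ) + 1)⁻¹) continuous_const
    (fun _ => zero_le_one) h.symm (fun _ => by positivity)
    (by simp; field_simp)
  exact one_ne_zero this

/-- Fubini's theorem on the reference simplex, with the first coordinate integrated first. -/
theorem integral_refSimplex_succ {n : ℕ} {H : (Fin (n + 1) → ℝ) → ℝ} (hH : Continuous H) :
    ∫ y in refSimplex (n + 1), H y =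
      ∫ z in refSimplex n, ∫ t in (0 : ℝ)..(1 - ∑ i, z i), H (Fin.cons t z) := by
  have hmp := (volume_preserving_piFinSuccAbove (fun _ : Fin (n + 1) => ℝ) 0).symm
  rw [← integral_indicator (measurableSet_refSimplex _),
    ← hmp.integral_comp (MeasurableEquiv.measurableEmbedding _)]
  have hsymm : ∀ q : ℝ × (Fin n → ℝ),
      (MeasurableEquiv.piFinSuccAbove (fun _ : Fin (n + 1) => ℝ) 0).symm q = Fin.cons q.1 q.2 := by
    intro q
    ext i
    refine Fin.cases ?_ (fun j => ?_) i
    · simp [MeasurableEquiv.piFinSuccAbove]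
    · simp [MeasurableEquiv.piFinSuccAbove]
  have hint : Integrable (fun q : ℝ × (Fin n → ℝ) => (refSimplex (n + 1)).indicator H
      ((MeasurableEquiv.piFinSuccAbove (fun _ : Fin (n + 1) => ℝ) 0).symm q)) volume := by
    refine (hmp.integrable_comp_emb (MeasurableEquiv.measurableEmbedding _)
      (g := (refSimplex (n + 1)).indicator H)).2 ?_
    rw [integrable_indicator_iff (measurableSet_refSimplex _)]
    exact hH.continuousOn.integrableOn_compact (isCompact_refSimplex _)
  rw [Measure.volume_eq_prod, integral_prod_symm _ (by rwa [← Measure.volume_eq_prod]),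
    ← integral_indicator (measurableSet_refSimplex n)]
  congr 1
  funext z
  simp only [hsymm]
  by_cases hz : z ∈ refSimplex n
  · have hz1 : 0 ≤ 1 - ∑ i, z i := by linarith [hz.2]
    rw [indicator_of_mem hz, intervalIntegral.integral_of_le hz1, ← integral_Icc_eq_integral_Ioc,
      ← integral_indicator measurableSet_Icc]
    congr 1
    funext t
    by_cases ht : t ∈ Icc 0 (1 - ∑ i, z i)
    · have hm : (Fin.cons t z : Fin (n + 1) → ℝ) ∈ refSimplex (n + 1) := by
        refine ⟨fun i => ?_, ?_⟩
        · refine Fin.cases ?_ (fun j => ?_) i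
          · simpa using ht.1
          · simpa using hz.1 j
        · rw [Fin.sum_univ_succ]
          simp only [Fin.cons_zero, Fin.cons_succ]
          linarith [ht.2]
      rw [indicator_of_mem ht, indicator_of_mem hm]
    · have hm : (Fin.cons t z : Fin (n + 1) → ℝ) ∉ refSimplex (n + 1) := by
        rintro ⟨h1, h2⟩
        rw [Fin.sum_univ_succ] at h2
        simp only [Fin.cons_zero, Fin.cons_succ] at h2
        exact ht ⟨by simpa using h1 0, by linarith⟩
      rw [indicator_of_notMem ht, indicator_of_notMem hm]
  · rw [indicator_of_notMem hz]
    have : ∀ t : ℝ, (refSimplex (n + 1)).indicator H (Fin.cons t z) = 0 := by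
      intro t
      refine indicator_of_notMem (fun hm => hz ⟨fun i => by simpa using hm.1 i.succ, ?_⟩) _
      have h2 := hm.2
      rw [Fin.sum_univ_succ] at h2
      simp only [Fin.cons_zero, Fin.cons_succ] at h2
      have := hm.1 0
      simp only [Fin.cons_zero] at this
      linarith
    simp [this]

/-- The divergence theorem on the reference simplex, for a derivative along the edge joining the
first two vertices: the fundamental theorem of calculus on each line parallel to this edge. -/
theorem refInt_fderiv_edge {V : Type*} [NormedAddCommGroup V] [NormedSpace ℝ V] {n : ℕ}
    (p : Fin (n + 2) → V) {f : V → ℝ} (hf : ContDiff ℝ 1 f) :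
    refInt (n + 1) (fun l => fderiv ℝ f (∑ i, l i • p i) (p 1 - p 0)) =
      refInt n (fun l => f (∑ i, l i • p (Fin.succAbove 0 i))) -
      refInt n (fun l => f (∑ i, l i • p (Fin.succAbove 1 i))) := by
  have hc : Continuous (fun x => fderiv ℝ f x (p 1 - p 0)) :=
    (hf.continuous_fderiv one_ne_zero).clm_apply continuous_const
  have hc2 : Continuous (fun y : Fin (n + 1) → ℝ => ∑ i, refBary y i • p i) := by
    refine continuous_finsetSum _ fun i _ => ?_
    exact ((continuous_apply i).comp continuous_refBary).smul continuous_const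
  have hcf : ∀ j : Fin (n + 2), Continuous
      (fun l : Fin (n + 1) → ℝ => f (∑ i, l i • p (Fin.succAbove j i))) := fun j =>
    hf.continuous.comp (by fun_prop)
  unfold refInt
  rw [integral_refSimplex_succ (H := fun y => fderiv ℝ f (∑ i, refBary y i • p i) (p 1 - p 0))
    (hc.comp hc2), ← integral_sub (integrableOn_refSimplex (hcf 0)) (integrableOn_refSimplex (hcf 1))]
  refine setIntegral_congr_fun (measurableSet_refSimplex n) fun z _ => ?_
  set s := 1 - ∑ i, z i with hs
  -- the line through the two faces, parametrized by the second barycentric coordinate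
  let c : ℝ → V := fun t => (s - t) • p 0 + t • p 1 + ∑ i : Fin n, z i • p i.succ.succ
  have hline : ∀ t : ℝ, ∑ i, refBary (Fin.cons t z : Fin (n + 1) → ℝ) i • p i = c t := by
    intro t
    rw [Fin.sum_univ_succ, Fin.sum_univ_succ]
    simp only [refBary, Fin.cons_zero, Fin.cons_succ, Fin.sum_univ_succ, c, hs]
    rw [show (Fin.succ 0 : Fin (n + 2)) = 1 from rfl, ← add_assoc,
      show 1 - (t + ∑ i, z i) = 1 - ∑ i, z i - t by ring]
  have hder : ∀ t : ℝ, HasDerivAt (fun t => f (c t)) (fderiv ℝ f (c t) (p 1 - p 0)) t := by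
    intro t
    have h1 : HasDerivAt c (p 1 - p 0) t := by
      have ha : HasDerivAt (fun t : ℝ => (s - t) • p 0) ((-1 : ℝ) • p 0) t :=
        ((hasDerivAt_id t).const_sub s).smul_const _
      have hb : HasDerivAt (fun t : ℝ => t • p 1) ((1 : ℝ) • p 1) t :=
        (hasDerivAt_id t).smul_const _
      have := (ha.add hb).add_const (∑ i : Fin n, z i • p i.succ.succ)
      rw [show p 1 - p 0 = (-1 : ℝ) • p 0 + (1 : ℝ) • p 1 by
        rw [neg_one_smul, one_smul, sub_eq_neg_add]]
      exact this
    exact ((hf.differentiable one_ne_zero) (c t)).hasFDerivAt.comp_hasDerivAt t h1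
  have hcc : Continuous c := by fun_prop
  simp only [hline]
  rw [intervalIntegral.integral_eq_sub_of_hasDerivAt (fun t _ => hder t)
    ((hc.comp hcc).intervalIntegrable _ _)]
  congr 2
  · simp [c, Fin.sum_univ_succ, refBary, hs]
  · simp only [c, Fin.sum_univ_succ, refBary, Fin.cons_zero, Fin.cons_succ, sub_zero, zero_smul,
      add_zero]
    congr 1

/-! ### Integration over simplices and their faces -/

/-- The convex hull of a finite family is the image of the reference simplex. -/
theorem convexHull_range_eq_image {V : Type*} [AddCommGroup V] [Module ℝ V] {n : ℕ}
    (p : Fin (n + 1) → V) :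
    convexHull ℝ (range p) = (fun y => ∑ i, refBary y i • p i) '' refSimplex n := by
  have h1 : convexHull ℝ (range p) =
      (Fintype.linearCombination ℝ p) '' stdSimplex ℝ (Fin (n + 1)) := by
    rw [← convexHull_rangle_single_eq_stdSimplex, LinearMap.image_convexHull, ← range_comp]
    congr 2
    funext i
    simp [Fintype.linearCombination_apply_single]
  rw [h1]
  ext x
  constructor
  · rintro ⟨l, hl, rfl⟩
    have hb : refBary (fun i : Fin n => l i.succ) = l := by
      funext i
      have := hl.2
      rw [Fin.sum_univ_succ] at this
      refine Fin.cases ?_ (fun j => ?_) i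
      · simp only [refBary, Fin.cons_zero]; linarith
      · simp [refBary]
    refine ⟨fun i => l i.succ, ⟨fun i => hl.1 _, ?_⟩, ?_⟩
    · have := hl.2
      rw [Fin.sum_univ_succ] at this
      linarith [hl.1 0]
    · simp only [hb, Fintype.linearCombination_apply]
  · rintro ⟨y, hy, rfl⟩
    exact ⟨refBary y, ⟨refBary_nonneg hy, sum_refBary y⟩, by
      simp only [Fintype.linearCombination_apply]⟩

/-- The Jacobian matrix of the affine parametrization of a simplex in `ℝⁿ`. -/
def simplexMatrix {n : ℕ} (p : Fin (n + 1) → E n) : Matrix (Fin n) (Fin n) ℝ :=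
  fun i j => p j.succ i - p 0 i

theorem simplexMatrix_det_ne_zero {n : ℕ} {p : Fin (n + 1) → E n}
    (hp : LinearIndependent ℝ (fun i : Fin n => p i.succ - p 0)) : (simplexMatrix p).det ≠ 0 := by
  have h : LinearIndependent ℝ (simplexMatrix p).col := by
    exact hp.map' (WithLp.linearEquiv 2 ℝ (Fin n → ℝ)).toLinearMap (LinearEquiv.ker _)
  rw [Matrix.linearIndependent_cols_iff_isUnit, Matrix.isUnit_iff_isUnit_det] at h
  exact h.ne_zero

theorem integral_convexHull_eq_det {n : ℕ} {p : Fin (n + 1) → E n}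
    (hp : (simplexMatrix p).det ≠ 0) (f : E n → ℝ) :
    ∫ x in convexHull ℝ (range p), f x =
      |(simplexMatrix p).det| * refInt n (fun l => f (∑ i, l i • p i)) := by
  set L : (Fin n → ℝ) →L[ℝ] (Fin n → ℝ) :=
    LinearMap.toContinuousLinearMap (Matrix.toLin' (simplexMatrix p)) with hL
  have hdet : L.det = (simplexMatrix p).det := by
    rw [hL]; simp [ContinuousLinearMap.det]
  set Φ : (Fin n → ℝ) → (Fin n → ℝ) := fun y => L y + WithLp.ofLp (p 0) with hΦ
  have hinj : Function.Injective Φ := by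
    intro y y' h
    have h1 : L y = L y' := by simpa [hΦ] using h
    have : Function.Injective (simplexMatrix p).mulVec :=
      Matrix.mulVec_injective_iff_isUnit.2 ((Matrix.isUnit_iff_isUnit_det _).2 hp.isUnit)
    exact this (by simpa [hL] using h1)
  have hpt : ∀ y, WithLp.toLp 2 (Φ y) = ∑ i, refBary y i • p i := by
    intro y
    ext j
    simp only [hΦ, hL, refBary, Fin.sum_univ_succ, Fin.cons_zero, Fin.cons_succ, Pi.add_apply,
      LinearMap.coe_toContinuousLinearMap', Matrix.toLin'_apply, Matrix.mulVec, dotProduct,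
      simplexMatrix, PiLp.add_apply, PiLp.smul_apply, WithLp.ofLp_sum, WithLp.ofLp_smul,
      Finset.sum_apply, Pi.smul_apply, smul_eq_mul, sub_mul, Finset.sum_sub_distrib, one_mul,
      ← Finset.mul_sum]
    have : ∑ x, (p (Fin.succ x)).ofLp j * y x = ∑ x, y x * (p (Fin.succ x)).ofLp j :=
      Finset.sum_congr rfl fun x _ => mul_comm _ _
    rw [this]
    ring
  have hmp := PiLp.volume_preserving_toLp (Fin n)
  have hemb : MeasurableEmbedding (WithLp.toLp 2 : (Fin n → ℝ) → E n) :=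
    (MeasurableEquiv.toLp 2 (Fin n → ℝ)).measurableEmbedding
  rw [← hmp.setIntegral_preimage_emb hemb, convexHull_range_eq_image]
  have himg : (WithLp.toLp 2 : (Fin n → ℝ) → E n) ⁻¹'
      ((fun y => ∑ i, refBary y i • p i) '' refSimplex n) = Φ '' refSimplex n := by
    ext x
    constructor
    · rintro ⟨y, hy, h⟩
      refine ⟨y, hy, ?_⟩
      exact (WithLp.toLp_injective 2) ((hpt y).trans h)
    · rintro ⟨y, hy, rfl⟩
      exact ⟨y, hy, (hpt y).symm⟩
  rw [himg, integral_image_eq_integral_abs_det_fderiv_smul volume (measurableSet_refSimplex n)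
    (f' := fun _ => L) (fun y _ => (L.hasFDerivAt.add_const _).hasFDerivWithinAt) hinj.injOn]
  have hpt' : ∀ y, f (WithLp.toLp 2 (Φ y)) = f (∑ i, refBary y i • p i) := fun y => by rw [hpt]
  simp only [hdet, smul_eq_mul, integral_const_mul, refInt]
  congr 1
  exact setIntegral_congr_fun (measurableSet_refSimplex n) fun y _ => hpt' y

/-- The ratio of the volume of a simplex to that of the reference simplex. -/
noncomputable def simplexDensity {n : ℕ} (A : Set (E n)) : ℝ :=
  volume.real A / refInt n (fun _ => 1)

theorem simplexDensity_eq_det {n : ℕ} {p : Fin (n + 1) → E n}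
    (hp : (simplexMatrix p).det ≠ 0) :
    simplexDensity (convexHull ℝ (range p)) = |(simplexMatrix p).det| := by
  have h := integral_convexHull_eq_det hp (fun _ => 1)
  rw [setIntegral_const, smul_eq_mul, mul_one] at h
  rw [simplexDensity, h, mul_div_assoc, div_self (refInt_one_pos n).ne', mul_one]

theorem integral_convexHull {n : ℕ} {p : Fin (n + 1) → E n}
    (hp : LinearIndependent ℝ (fun i : Fin n => p i.succ - p 0)) (f : E n → ℝ) :
    ∫ x in convexHull ℝ (range p), f x =
      simplexDensity (convexHull ℝ (range p)) * refInt n (fun l => f (∑ i, l i • p i)) := by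
  rw [simplexDensity_eq_det (simplexMatrix_det_ne_zero hp),
    integral_convexHull_eq_det (simplexMatrix_det_ne_zero hp)]

theorem simplexDensity_pos {n : ℕ} {p : Fin (n + 1) → E n}
    (hp : LinearIndependent ℝ (fun i : Fin n => p i.succ - p 0)) :
    0 < simplexDensity (convexHull ℝ (range p)) := by
  rw [simplexDensity_eq_det (simplexMatrix_det_ne_zero hp)]
  exact abs_pos.2 (simplexMatrix_det_ne_zero hp)

/-- The inclusion of `ℝⁿ` into `ℝⁿ⁺¹` as the hyperplane where the first coordinate vanishes. -/
noncomputable def consZero (n : ℕ) : E n →ₗᵢ[ℝ] E (n + 1) where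
  toFun y := WithLp.toLp 2 (Fin.cons 0 (WithLp.ofLp y))
  map_add' x y := by
    ext i
    refine Fin.cases ?_ (fun j => ?_) i <;> simp
  map_smul' c x := by
    ext i
    refine Fin.cases ?_ (fun j => ?_) i <;> simp
  norm_map' y := by
    simp [EuclideanSpace.norm_eq, Fin.sum_univ_succ]

/-- Coordinates in which a given unit vector is the first basis vector. -/
theorem exists_isometry_first_eq {n : ℕ} (v : E (n + 1)) (hv : ‖v‖ = 1) :
    ∃ U : E (n + 1) ≃ₗᵢ[ℝ] E (n + 1), ∀ x, (U.symm x) 0 = inner ℝ v x := by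
  have h : ‖(EuclideanSpace.single 0 1 : E (n + 1))‖ = ‖v‖ := by simp [hv]
  set U := (Submodule.span ℝ {(EuclideanSpace.single 0 1 : E (n + 1)) - v})ᗮ.reflection
  have hU : U (EuclideanSpace.single 0 1) = v := Submodule.reflection_sub h
  refine ⟨U, fun x => ?_⟩
  have h1 : inner ℝ v x = inner ℝ (EuclideanSpace.single 0 1 : E (n + 1)) (U.symm x) := by
    rw [← U.inner_map_map (EuclideanSpace.single 0 1) (U.symm x), hU, U.apply_symm_apply]
  rw [h1, EuclideanSpace.inner_single_left]
  simp

/-- The surface measure on a face of a simplex.  With `g` the gradient of the barycentric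
coordinate of the opposite vertex `a`, the distance of `a` to the face is `1 / ‖g‖`. -/
theorem integral_face {n : ℕ} {p : Fin (n + 1) → E (n + 1)} {a g : E (n + 1)}
    (hp : LinearIndependent ℝ (fun i : Fin n => p i.succ - p 0))
    (hg : ∀ i, inner ℝ g (a - p i) = 1) (f : E (n + 1) → ℝ) :
    ∫ x in convexHull ℝ (range p), f x ∂(Measure.euclideanHausdorffMeasure n) =
      simplexDensity (convexHull ℝ (insert a (range p))) * ‖g‖ *
        refInt n (fun l => f (∑ i, l i • p i)) := by
  have hg0 : g ≠ 0 := by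
    rintro rfl
    simpa using hg 0
  have hgn : ‖g‖ ≠ 0 := norm_ne_zero_iff.2 hg0
  obtain ⟨U, hU⟩ := exists_isometry_first_eq (‖g‖⁻¹ • g) (by
    rw [norm_smul, norm_inv, norm_norm, inv_mul_cancel₀ hgn])
  have hp0 : ∀ i, (U.symm (p i - p 0)) 0 = 0 := by
    intro i
    rw [hU, real_inner_smul_left, show p i - p 0 = (a - p 0) - (a - p i) by abel, inner_sub_right,
      hg, hg, sub_self, mul_zero]
  have ha0 : (U.symm (a - p 0)) 0 = ‖g‖⁻¹ := by
    rw [hU, real_inner_smul_left, hg, mul_one]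
  -- coordinates in the hyperplane of the face
  let q : Fin (n + 1) → E n := fun i => WithLp.toLp 2 (fun j => (U.symm (p i - p 0)) j.succ)
  have hq : ∀ i, U (consZero n (q i)) + p 0 = p i := by
    intro i
    have : consZero n (q i) = U.symm (p i - p 0) := by
      ext j
      refine Fin.cases ?_ (fun j => ?_) j
      · rw [hp0]; rfl
      · rfl
    rw [this, U.apply_symm_apply, sub_add_cancel]
  have hqdet : (simplexMatrix q).det ≠ 0 := by
    refine simplexMatrix_det_ne_zero ?_
    refine LinearIndependent.of_comp (U.toLinearEquiv.toLinearMap ∘ₗ (consZero n).toLinearMap) ?_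
    convert hp using 1
    funext i
    simp only [Function.comp, LinearMap.comp_apply]
    have h1 : p i.succ - p 0 = U (consZero n (q i.succ)) - U (consZero n (q 0)) := by
      have h2 : U (consZero n (q 0)) = 0 := by simpa using hq 0
      rw [h2, ← hq i.succ, sub_zero, add_sub_cancel_right]
    rw [h1, map_sub, map_sub]
    rfl
  set ι : E n → E (n + 1) := fun y => U (consZero n y) + p 0 with hι
  have hiso : Isometry ι := by
    intro x y
    simp [hι]
  have hsum : ∀ l : Fin (n + 1) → ℝ, ∑ i, l i = 1 →
      ∑ i, l i • p i = ι (∑ i, l i • q i) := by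
    intro l hl
    have h1 : ∑ i, l i • p i = ∑ i, l i • (U (consZero n (q i)) + p 0) :=
      Finset.sum_congr rfl fun i _ => by rw [hq]
    rw [h1]
    simp only [smul_add, Finset.sum_add_distrib, ← Finset.sum_smul, hl, one_smul, hι, map_sum,
      map_smul]
  have hemb : MeasurableEmbedding ι := hiso.isClosedEmbedding.measurableEmbedding
  have himg : convexHull ℝ (range p) = ι '' convexHull ℝ (range q) := by
    rw [convexHull_range_eq_image, convexHull_range_eq_image, ← image_comp]
    refine image_congr fun y _ => ?_
    exact hsum _ (sum_refBary y)
  have hface : ∫ x in convexHull ℝ (range p), f x ∂(Measure.euclideanHausdorffMeasure n) =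
      |(simplexMatrix q).det| * refInt n (fun l => f (∑ i, l i • p i)) := by
    have h1 : (Measure.euclideanHausdorffMeasure n : Measure (E (n + 1))).restrict
        (convexHull ℝ (range p)) =
        ((volume : Measure (E n)).map ι).restrict (convexHull ℝ (range p)) := by
      rw [← EuclideanSpace.euclideanHausdorffMeasure_eq_volume, hiso.map_euclideanHausdorffMeasure,
        Measure.restrict_restrict_of_subset]
      rw [himg]
      exact image_subset_range _ _
    rw [h1, hemb.setIntegral_map, himg, preimage_image_eq _ hiso.injective,
      integral_convexHull_eq_det hqdet]
    congr 1
    refine setIntegral_congr_fun (measurableSet_refSimplex n) fun y _ => ?_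
    simp only [hsum _ (sum_refBary y)]
  -- the volume of the simplex is computed in the coordinates given by `U`
  let P : Fin (n + 2) → E (n + 1) := Fin.cons (p 0) (Fin.cons a (fun i : Fin n => p i.succ))
  let P' : Fin (n + 2) → E (n + 1) := fun i => U.symm (P i - p 0)
  have hPr : range P = insert a (range p) := by
    have h2 : range p = insert (p 0) (range fun i : Fin n => p i.succ) := by
      conv_lhs => rw [← Fin.cons_self_tail p]
      rw [Fin.range_cons]
      rfl
    simp only [P, Fin.range_cons, h2]
    exact insert_comm _ _ _
  have hdet' : (simplexMatrix P').det = ‖g‖⁻¹ * (simplexMatrix q).det := by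
    rw [Matrix.det_succ_row_zero, Fin.sum_univ_succ]
    have h3 : ∀ j : Fin n, simplexMatrix P' 0 j.succ = 0 := by
      intro j
      have : simplexMatrix P' 0 j.succ =
        (U.symm (p j.succ - p 0)) 0 - (U.symm (p 0 - p 0)) 0 := rfl
      rw [this, hp0, hp0, sub_self]
    have h4 : simplexMatrix P' 0 0 = ‖g‖⁻¹ := by
      have : simplexMatrix P' 0 0 = (U.symm (a - p 0)) 0 - (U.symm (p 0 - p 0)) 0 := rfl
      rw [this, ha0, hp0, sub_zero]
    have h5 : (simplexMatrix P').submatrix Fin.succ Fin.succ = simplexMatrix q := by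
      ext i j
      rfl
    simp [h3, h4, h5]
  have hdens : simplexDensity (convexHull ℝ (insert a (range p))) =
      ‖g‖⁻¹ * |(simplexMatrix q).det| := by
    have h6 := simplexDensity_eq_det (p := P') (by
      rw [hdet']; exact mul_ne_zero (inv_ne_zero hgn) hqdet)
    rw [hdet', abs_mul, abs_of_nonneg (inv_nonneg.2 (norm_nonneg g))] at h6
    rw [← h6, ← hPr, simplexDensity, simplexDensity]
    congr 1
    have h7 : convexHull ℝ (range P') = (fun x => U.symm (x - p 0)) '' convexHull ℝ (range P) := by
      rw [convexHull_range_eq_image, convexHull_range_eq_image, ← image_comp]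
      refine image_congr fun y _ => ?_
      simp only [P', Function.comp, smul_sub, map_sub, Finset.sum_sub_distrib, map_sum, map_smul,
        ← Finset.sum_smul, sum_refBary, one_smul]
    have h8 : MeasurePreserving (fun x => U.symm (x - p 0)) volume volume :=
      U.symm.measurePreserving.comp (measurePreserving_sub_right volume (p 0))
    have h9 : Isometry (fun x => U.symm (x - p 0)) := by
      intro x y
      simp
    rw [h7, Measure.real, Measure.real,
      ← h8.measure_preimage_emb h9.isClosedEmbedding.measurableEmbedding
        ((fun x => U.symm (x - p 0)) '' convexHull ℝ (range P)),
      preimage_image_eq _ h9.injective]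
  rw [hface, hdens]
  field_simp

/-! ### Barycentric coordinates -/

/-- `K` is the vertex set of a nondegenerate `d`-simplex. -/
def IsSimplex {d : ℕ} (K : Finset (E d)) : Prop :=
  AffineIndependent ℝ ((↑) : K → E d) ∧ K.card = d + 1

/-- Existence of barycentric coordinates as affine functions `x ↦ c a + ⟪g a, x⟫`; those of points
that are not vertices are zero. -/
theorem exists_bary {d : ℕ} {K : Finset (E d)} (hK : IsSimplex K) :
    ∃ (g : E d → E d) (c : E d → ℝ), (∀ a, a ∉ K → g a = 0 ∧ c a = 0) ∧
      (∀ a ∈ K, ∀ b ∈ K, c a + inner ℝ (g a) b = if a = b then 1 else 0) ∧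
      (∀ x, ∑ a ∈ K, (c a + inner ℝ (g a) x) = 1) ∧
      (∀ x, ∑ a ∈ K, (c a + inner ℝ (g a) x) • a = x) := by
  classical
  have htop : affineSpan ℝ (range ((↑) : K → E d)) = ⊤ := by
    rw [hK.1.affineSpan_eq_top_iff_card_eq_finrank_add_one]
    simp [hK.2]
  let B : AffineBasis K ℝ (E d) := ⟨_, hK.1, htop⟩
  let g : E d → E d := fun a => if h : a ∈ K then
    (InnerProductSpace.toDual ℝ (E d)).symm (LinearMap.toContinuousLinearMap
      (B.coord ⟨a, h⟩).linear) else 0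
  let c : E d → ℝ := fun a => if h : a ∈ K then B.coord ⟨a, h⟩ 0 else 0
  have hval : ∀ (a : K) x, c a + inner ℝ (g a) x = B.coord a x := by
    intro a x
    simp only [c, g, a.2, dif_pos, InnerProductSpace.toDual_symm_apply]
    have := congrFun (AffineMap.decomp (B.coord a)) x
    simp only [Pi.add_apply] at this
    rw [this, add_comm]
    rfl
  refine ⟨g, c, fun a ha => by simp [g, c, ha], ?_, ?_, ?_⟩
  · intro a ha b hb
    have h1 : B.coord ⟨a, ha⟩ (B ⟨b, hb⟩) = if (⟨a, ha⟩ : K) = ⟨b, hb⟩ then 1 else 0 :=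
      B.coord_apply _ _
    rw [hval ⟨a, ha⟩ b]
    rw [show B.coord ⟨a, ha⟩ b = B.coord ⟨a, ha⟩ (B ⟨b, hb⟩) from rfl, h1]
    simp [Subtype.ext_iff]
  · intro x
    rw [← Finset.sum_coe_sort]
    simp only [hval]
    exact B.sum_coord_apply_eq_one x
  · intro x
    rw [← Finset.sum_coe_sort]
    simp only [hval]
    exact B.linear_combination_coord_eq_self x

open Classical in
/-- The gradient of the barycentric coordinate of the vertex `a` of `K` (zero if `a ∉ K`). -/
noncomputable def baryGrad {d : ℕ} (K : Finset (E d)) (a : E d) : E d :=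
  if h : IsSimplex K then (exists_bary h).choose a else 0

open Classical in
/-- The value at the origin of the barycentric coordinate of the vertex `a` of `K`. -/
noncomputable def baryConst {d : ℕ} (K : Finset (E d)) (a : E d) : ℝ :=
  if h : IsSimplex K then (exists_bary h).choose_spec.choose a else 0

/-- The barycentric coordinate of the vertex `a` of `K`, an affine function on `ℝᵈ`. -/
noncomputable def bary {d : ℕ} (K : Finset (E d)) (a x : E d) : ℝ :=
  baryConst K a + inner ℝ (baryGrad K a) x

namespace IsSimplex

variable {d : ℕ} {K : Finset (E d)} (hK : IsSimplex K)
include hK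

theorem bary_spec : (∀ a, a ∉ K → baryGrad K a = 0 ∧ baryConst K a = 0) ∧
      (∀ a ∈ K, ∀ b ∈ K, bary K a b = if a = b then 1 else 0) ∧
      (∀ x, ∑ a ∈ K, bary K a x = 1) ∧ (∀ x, ∑ a ∈ K, bary K a x • a = x) := by
  have h := (exists_bary hK).choose_spec.choose_spec
  simp only [bary, baryGrad, baryConst, dif_pos hK]
  exact h

theorem baryGrad_of_notMem {a : E d} (ha : a ∉ K) : baryGrad K a = 0 := (hK.bary_spec.1 a ha).1

theorem bary_of_notMem {a : E d} (ha : a ∉ K) (x : E d) : bary K a x = 0 := by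
  simp [bary, hK.bary_spec.1 a ha]

theorem bary_vertex {a b : E d} (ha : a ∈ K) (hb : b ∈ K) :
    bary K a b = if a = b then 1 else 0 := hK.bary_spec.2.1 a ha b hb

theorem sum_bary (x : E d) : ∑ a ∈ K, bary K a x = 1 := hK.bary_spec.2.2.1 x

theorem sum_bary_smul (x : E d) : ∑ a ∈ K, bary K a x • a = x := hK.bary_spec.2.2.2 x

theorem inner_baryGrad_sub {a b c : E d} (ha : a ∈ K) (hb : b ∈ K) (hc : c ∈ K) :
    inner ℝ (baryGrad K a) (b - c) = (if a = b then 1 else 0) - (if a = c then 1 else 0) := by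
  rw [← hK.bary_vertex ha hb, ← hK.bary_vertex ha hc, bary, bary, inner_sub_right]
  ring

theorem sum_inner_baryGrad (e : E d) : ∑ a ∈ K, inner ℝ (baryGrad K a) e = 0 := by
  have h1 := hK.sum_bary e
  have h2 := hK.sum_bary 0
  simp only [bary, Finset.sum_add_distrib, inner_zero_right, Finset.sum_const_zero] at h1 h2
  linarith

theorem sum_inner_baryGrad_smul (e : E d) : ∑ a ∈ K, inner ℝ (baryGrad K a) e • a = e := by
  have h1 := hK.sum_bary_smul e
  have h2 := hK.sum_bary_smul 0
  simp only [bary, inner_zero_right, add_zero] at h2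
  simp only [bary, add_smul, Finset.sum_add_distrib, h2, zero_add] at h1
  exact h1

theorem nonempty : K.Nonempty := by
  rw [← Finset.card_pos, hK.2]; omega

theorem exists_ne (hd : 1 ≤ d) (a : E d) : ∃ b ∈ K, b ≠ a :=
  Finset.exists_mem_ne (by rw [hK.2]; omega) a

theorem baryGrad_ne_zero (hd : 1 ≤ d) {a : E d} (ha : a ∈ K) : baryGrad K a ≠ 0 := by
  intro h
  obtain ⟨b, hb, hba⟩ := hK.exists_ne hd a
  have := hK.inner_baryGrad_sub ha ha hb
  simp [h, hba.symm] at this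

omit hK in
theorem bary_combination (a : E d) {s : Finset (E d)} {w : E d → ℝ} (hw : ∑ b ∈ s, w b = 1) :
    bary K a (∑ b ∈ s, w b • b) = ∑ b ∈ s, w b * bary K a b := by
  simp only [bary, inner_sum, inner_smul_right, mul_add, Finset.sum_add_distrib, ← Finset.sum_mul,
    hw, one_mul]

theorem bary_combination_mem {a : E d} (ha : a ∈ K) {F : Finset (E d)} (hF : F ⊆ K) {w : E d → ℝ}
    (hw : ∑ b ∈ F, w b = 1) :
    bary K a (∑ b ∈ F, w b • b) = if a ∈ F then w a else 0 := by
  classical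
  rw [bary_combination a hw, ← Finset.sum_ite_eq F a w]
  refine Finset.sum_congr rfl fun b hb => ?_
  rw [hK.bary_vertex ha (hF hb)]
  simp

theorem mem_hull_iff_of_subset {F : Finset (E d)} (hF : F ⊆ K) {x : E d} :
    x ∈ hull F ↔ (∀ a ∈ K, 0 ≤ bary K a x) ∧ ∀ a ∈ K, a ∉ F → bary K a x = 0 := by
  classical
  rw [hull, Finset.mem_convexHull']
  constructor
  · rintro ⟨w, hw0, hw1, rfl⟩
    constructor
    · intro a ha
      rw [hK.bary_combination_mem ha hF hw1]
      split_ifs with h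
      · exact hw0 a h
      · exact le_rfl
    · intro a ha haF
      rw [hK.bary_combination_mem ha hF hw1, if_neg haF]
  · rintro ⟨h0, h1⟩
    refine ⟨fun a => bary K a x, fun a ha => h0 a (hF ha), ?_, ?_⟩
    · rw [Finset.sum_subset hF fun a ha haF => h1 a ha haF]
      exact hK.sum_bary x
    · rw [Finset.sum_subset hF fun a ha haF => by simp only [h1 a ha haF, zero_smul]]
      exact hK.sum_bary_smul x

theorem mem_hull_iff {x : E d} : x ∈ hull K ↔ ∀ a ∈ K, 0 ≤ bary K a x := by
  rw [hK.mem_hull_iff_of_subset (Finset.Subset.refl K)]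
  exact ⟨fun h => h.1, fun h => ⟨h, fun a ha hn => absurd ha hn⟩⟩

theorem bary_nonneg {x : E d} (hx : x ∈ hull K) (a : E d) : 0 ≤ bary K a x := by
  by_cases ha : a ∈ K
  · exact hK.mem_hull_iff.1 hx a ha
  · rw [hK.bary_of_notMem ha]

theorem bary_le_one {x : E d} (hx : x ∈ hull K) (a : E d) : bary K a x ≤ 1 := by
  by_cases ha : a ∈ K
  · rw [← hK.sum_bary x]
    exact Finset.single_le_sum (fun b _ => hK.bary_nonneg hx b) ha
  · rw [hK.bary_of_notMem ha]; exact zero_le_one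

/-- Shape regularity bounds the gradients of the barycentric coordinates. -/
theorem norm_baryGrad_le {x : E d} {r : ℝ} (hr : 0 < r)
    (hball : Metric.closedBall x r ⊆ hull K) (a : E d) : 2 * r * ‖baryGrad K a‖ ≤ 1 := by
  by_cases hg : baryGrad K a = 0
  · simp [hg]
  have hgn : ‖baryGrad K a‖ ≠ 0 := norm_ne_zero_iff.2 hg
  set v := (r * ‖baryGrad K a‖⁻¹) • baryGrad K a with hv
  have hvn : ‖v‖ = r := by
    rw [hv, norm_smul, Real.norm_of_nonneg (by positivity), mul_assoc, inv_mul_cancel₀ hgn, mul_one]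
  have h1 := hK.bary_le_one (hball (show x + v ∈ Metric.closedBall x r by simp [hvn])) a
  have h2 := hK.bary_nonneg (hball (show x - v ∈ Metric.closedBall x r by simp [hvn])) a
  have h3 : inner ℝ (baryGrad K a) v = r * ‖baryGrad K a‖ := by
    rw [hv, inner_smul_right, real_inner_self_eq_norm_sq]
    field_simp
  simp only [bary, inner_add_right, inner_sub_right, h3] at h1 h2
  linarith

end IsSimplex

theorem continuous_bary {d : ℕ} (K : Finset (E d)) (a : E d) : Continuous (bary K a) := by
  unfold bary
  fun_prop

/-- The points of the simplex `K` not on its boundary. -/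
def openHull {d : ℕ} (K : Finset (E d)) : Set (E d) := {x | ∀ a ∈ K, 0 < bary K a x}

theorem isOpen_openHull {d : ℕ} (K : Finset (E d)) : IsOpen (openHull K) := by
  have : openHull K = ⋂ a ∈ K, {x | 0 < bary K a x} := by
    ext x; simp [openHull]
  rw [this]
  exact isOpen_biInter_finset fun a _ => isOpen_lt continuous_const (continuous_bary K a)

theorem isCompact_hull {d : ℕ} (K : Finset (E d)) : IsCompact (hull K) :=
  K.finite_toSet.isCompact_convexHull (𝕜 := ℝ)

theorem measurableSet_hull {d : ℕ} (K : Finset (E d)) : MeasurableSet (hull K) :=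
  (isCompact_hull K).measurableSet

theorem dist_le_diam_hull {d : ℕ} {K : Finset (E d)} {a b : E d} (ha : a ∈ K) (hb : b ∈ K) :
    ‖a - b‖ ≤ Metric.diam (hull K) := by
  rw [← dist_eq_norm]
  exact Metric.dist_le_diam_of_mem (isCompact_hull K).isBounded
    (subset_convexHull ℝ _ ha) (subset_convexHull ℝ _ hb)

theorem volume_affine_eq_zero {d : ℕ} {g : E d} (hg : g ≠ 0) (c : ℝ) :
    volume {x : E d | c + inner ℝ g x = 0} = 0 := by
  by_cases hne : ∃ x₀ : E d, c + inner ℝ g x₀ = 0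
  · obtain ⟨x₀, hx₀⟩ := hne
    let S : AffineSubspace ℝ (E d) := AffineSubspace.mk' x₀ (ℝ ∙ g)ᗮ
    have hS : {x : E d | c + inner ℝ g x = 0} = (S : Set (E d)) := by
      ext x
      simp only [mem_ofPred_eq, S, SetLike.mem_coe, AffineSubspace.mem_mk', vsub_eq_sub,
        Submodule.mem_orthogonal_singleton_iff_inner_right, inner_sub_right]
      constructor <;> intro h <;> linarith
    rw [hS]
    refine Measure.addHaar_affineSubspace volume S (fun htop => ?_)
    have : g + x₀ ∈ S := by rw [htop]; trivial
    rw [AffineSubspace.mem_mk', vsub_eq_sub, add_sub_cancel_right,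
      Submodule.mem_orthogonal_singleton_iff_inner_right] at this
    exact hg (inner_self_eq_zero.1 this)
  · push Not at hne
    simp [hne]

namespace IsSimplex

variable {d : ℕ} {K : Finset (E d)}

theorem openHull_subset (hK : IsSimplex K) : openHull K ⊆ hull K :=
  fun _ hx => hK.mem_hull_iff.2 fun a ha => (hx a ha).le

theorem openHull_nonempty (hK : IsSimplex K) : (openHull K).Nonempty := by
  have hc : (0 : ℝ) < K.card := by exact_mod_cast hK.nonempty.card_pos
  refine ⟨∑ b ∈ K, (fun _ => (K.card : ℝ)⁻¹) b • b, fun a ha => ?_⟩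
  rw [hK.bary_combination_mem ha (Finset.Subset.refl K) (by
    simp only [Finset.sum_const, nsmul_eq_mul]; field_simp), if_pos ha]
  positivity

theorem interior_nonempty (hK : IsSimplex K) : (interior (hull K)).Nonempty :=
  hK.openHull_nonempty.mono (interior_maximal hK.openHull_subset (isOpen_openHull K))

theorem volume_bary_eq_zero (hK : IsSimplex K) (hd : 1 ≤ d) {a : E d} (ha : a ∈ K) :
    volume {x | bary K a x = 0} = 0 :=
  volume_affine_eq_zero (hK.baryGrad_ne_zero hd ha) _

theorem openHull_ae_eq (hK : IsSimplex K) (hd : 1 ≤ d) : openHull K =ᵐ[volume] hull K := by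
  refine (hK.openHull_subset.eventuallyLE).antisymm ?_
  rw [ae_le_set]
  refine measure_mono_null (t := ⋃ a ∈ K, {x | bary K a x = 0}) ?_ ?_
  · rintro x ⟨hx, hn⟩
    simp only [openHull, mem_ofPred_eq, not_forall, not_lt] at hn
    obtain ⟨a, ha, hax⟩ := hn
    simp only [mem_iUnion, mem_ofPred_eq]
    exact ⟨a, ha, le_antisymm hax (hK.bary_nonneg hx a)⟩
  · refine (measure_biUnion_null_iff K.countable_toSet).2 ?_
    exact fun a ha => hK.volume_bary_eq_zero hd ha

/-- An enumeration of vertices of a simplex is affinely independent. -/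
theorem linearIndependent_of_injective (hK : IsSimplex K) {m : ℕ} {p : Fin (m + 1) → E d}
    (hp : Function.Injective p) (hpK : ∀ i, p i ∈ K) :
    LinearIndependent ℝ (fun i : Fin m => p i.succ - p 0) := by
  have h1 : AffineIndependent ℝ p :=
    hK.1.comp_embedding ⟨fun i => (⟨p i, hpK i⟩ : K), fun i j h => hp (by simpa using h)⟩
  have h2 := (affineIndependent_iff_linearIndependent_vsub ℝ p 0).1 h1
  exact h2.comp (fun i : Fin m => (⟨i.succ, i.succ_ne_zero⟩ : {x : Fin (m + 1) // x ≠ 0}))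
    (fun i j h => by simpa using h)

theorem simplexDensity_pos (hK : IsSimplex K) : 0 < simplexDensity (hull K) := by
  obtain ⟨p, hp, hr⟩ : ∃ p : Fin (d + 1) → E d, Function.Injective p ∧ range p = K := by
    refine ⟨fun i => (K.equivFinOfCardEq hK.2).symm i, ?_, ?_⟩
    · intro i j h; simpa using h
    · ext x
      constructor
      · rintro ⟨i, rfl⟩; simp
      · intro hx; exact ⟨K.equivFinOfCardEq hK.2 ⟨x, hx⟩, by simp⟩
  have := DivDivFEM.simplexDensity_pos
    (hK.linearIndependent_of_injective hp fun i => by rw [← Finset.mem_coe, ← hr]; simp)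
  rwa [hr] at this

end IsSimplex

namespace IsSimplex

variable {n : ℕ} {K : Finset (E (n + 1))} (hK : IsSimplex K)
include hK

/-- Surface integrals over a face of a simplex in terms of the reference simplex. -/
theorem integral_erase {a : E (n + 1)} (ha : a ∈ K)
    {p : Fin (n + 1) → E (n + 1)}
    (hp : Function.Injective p) (hr : range p = (K.erase a : Finset (E (n + 1))))
    (f : E (n + 1) → ℝ) :
    ∫ x in hull (K.erase a), f x ∂(Measure.euclideanHausdorffMeasure n) =
      simplexDensity (hull K) * ‖baryGrad K a‖ * refInt n (fun l => f (∑ i, l i • p i)) := by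
  have hpm : ∀ i, p i ∈ K.erase a := fun i => by rw [← Finset.mem_coe, ← hr]; simp
  have h := integral_face (p := p) (a := a) (g := baryGrad K a)
    (hK.linearIndependent_of_injective hp fun i => Finset.mem_of_mem_erase (hpm i))
    (fun i => by
      rw [hK.inner_baryGrad_sub ha ha (Finset.mem_of_mem_erase (hpm i)), if_pos rfl,
        if_neg (Finset.ne_of_mem_erase (hpm i)).symm, sub_zero]) f
  rw [hr] at h
  rw [hull, hull, h]
  congr 4
  rw [← Finset.coe_insert, Finset.insert_erase ha]

/-- The divergence theorem for a derivative along an edge: only the faces opposite to its two ends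
contribute. -/
theorem integral_hull_fderiv_edge {a b : E (n + 1)} (ha : a ∈ K)
    (hb : b ∈ K) (hab : a ≠ b) {f : E (n + 1) → ℝ} (hf : ContDiff ℝ 1 f) :
    ∫ x in hull K, fderiv ℝ f x (b - a) =
      ‖baryGrad K a‖⁻¹ * ∫ x in hull (K.erase a), f x ∂(Measure.euclideanHausdorffMeasure n) -
      ‖baryGrad K b‖⁻¹ * ∫ x in hull (K.erase b), f x ∂(Measure.euclideanHausdorffMeasure n) := by
  have hcard : ((K.erase a).erase b).card = n := by
    rw [Finset.card_erase_of_mem (Finset.mem_erase.2 ⟨hab.symm, hb⟩), Finset.card_erase_of_mem ha,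
      hK.2]
    omega
  let q : Fin n → E (n + 1) := fun i => (Finset.equivFinOfCardEq hcard).symm i
  have hq : Function.Injective q := fun i j h => by simpa [q] using h
  have hqm : ∀ i, q i ∈ (K.erase a).erase b := fun i => by simp only [q]; exact Subtype.property _
  have hqr : range q = ((K.erase a).erase b : Finset (E (n + 1))) := by
    ext x
    constructor
    · rintro ⟨i, rfl⟩; exact hqm i
    · intro hx; exact ⟨Finset.equivFinOfCardEq hcard ⟨x, hx⟩, by simp [q]⟩
  have hqa : ∀ i, q i ≠ a := fun i =>
    Finset.ne_of_mem_erase (Finset.mem_of_mem_erase (hqm i))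
  have hqb : ∀ i, q i ≠ b := fun i => Finset.ne_of_mem_erase (hqm i)
  let p : Fin (n + 2) → E (n + 1) := Fin.cons a (Fin.cons b q)
  have hb' : Function.Injective (Fin.cons b q : Fin (n + 1) → E (n + 1)) :=
    Fin.cons_injective_iff.2 ⟨by rintro ⟨i, hi⟩; exact hqb i hi, hq⟩
  have ha' : Function.Injective (Fin.cons a q : Fin (n + 1) → E (n + 1)) :=
    Fin.cons_injective_iff.2 ⟨by rintro ⟨i, hi⟩; exact hqa i hi, hq⟩
  have hp : Function.Injective p := by
    refine Fin.cons_injective_iff.2 ⟨?_, hb'⟩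
    rw [Fin.range_cons]
    rintro (h | ⟨i, hi⟩)
    · exact hab h
    · exact hqa i hi
  have hrb : range (Fin.cons b q : Fin (n + 1) → E (n + 1)) =
      (K.erase a : Finset (E (n + 1))) := by
    rw [Fin.range_cons, hqr, ← Finset.coe_insert,
      Finset.insert_erase (Finset.mem_erase.2 ⟨hab.symm, hb⟩)]
  have hra : range (Fin.cons a q : Fin (n + 1) → E (n + 1)) =
      (K.erase b : Finset (E (n + 1))) := by
    rw [Fin.range_cons, hqr, ← Finset.coe_insert, Finset.erase_right_comm,
      Finset.insert_erase (Finset.mem_erase.2 ⟨hab, ha⟩)]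
  have hrp : range p = K := by
    rw [Fin.range_cons, hrb, ← Finset.coe_insert, Finset.insert_erase ha]
  have hpm : ∀ i, p i ∈ K := fun i => by rw [← Finset.mem_coe, ← hrp]; simp
  have h1 := integral_convexHull (hK.linearIndependent_of_injective hp hpm)
    (fun x => fderiv ℝ f x (b - a))
  have h2 := refInt_fderiv_edge p hf
  have h0a : (fun i => p (Fin.succAbove 0 i)) = (Fin.cons b q : Fin (n + 1) → E (n + 1)) := by
    funext i; simp [p]
  have h0b : (fun i => p (Fin.succAbove 1 i)) = (Fin.cons a q : Fin (n + 1) → E (n + 1)) := by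
    funext i
    refine Fin.cases ?_ (fun j => ?_) i
    · simp [p]
    · rw [Fin.succAbove_of_lt_succ _ _ (by simp [Fin.lt_def])]
      simp [p]
  have h3 : ∀ i, p (Fin.succAbove 0 i) = (Fin.cons b q : Fin (n + 1) → E (n + 1)) i :=
    fun i => congrFun h0a i
  have h4 : ∀ i, p (Fin.succAbove 1 i) = (Fin.cons a q : Fin (n + 1) → E (n + 1)) i :=
    fun i => congrFun h0b i
  simp only [h3, h4, show p 1 = b from rfl, show p 0 = a from rfl] at h2
  rw [hrp, h2] at h1
  have hga : ‖baryGrad K a‖ ≠ 0 := norm_ne_zero_iff.2 (hK.baryGrad_ne_zero (by omega) ha)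
  have hgb : ‖baryGrad K b‖ ≠ 0 := norm_ne_zero_iff.2 (hK.baryGrad_ne_zero (by omega) hb)
  rw [hK.integral_erase ha hb' hrb, hK.integral_erase hb ha' hra, hull, h1]
  field_simp

/-- The divergence theorem on a simplex: the outward unit normal on the face opposite to the
vertex `a` is `-∇λ_a / ‖∇λ_a‖`. -/
theorem integral_hull_fderiv {f : E (n + 1) → ℝ} (hf : ContDiff ℝ 1 f)
    (e : E (n + 1)) :
    ∫ x in hull K, fderiv ℝ f x e =
      -∑ a ∈ K, inner ℝ (baryGrad K a) e * ‖baryGrad K a‖⁻¹ *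
        ∫ x in hull (K.erase a), f x ∂(Measure.euclideanHausdorffMeasure n) := by
  obtain ⟨a₀, ha₀⟩ := hK.nonempty
  have he : e = ∑ b ∈ K, inner ℝ (baryGrad K b) e • (b - a₀) := by
    simp only [smul_sub, Finset.sum_sub_distrib, hK.sum_inner_baryGrad_smul, ← Finset.sum_smul,
      hK.sum_inner_baryGrad, zero_smul, sub_zero]
  have hint : ∀ v : E (n + 1), IntegrableOn (fun x => fderiv ℝ f x v) (hull K) := fun v =>
    ((hf.continuous_fderiv one_ne_zero).clm_apply continuous_const).continuousOn.integrableOn_compact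
      (isCompact_hull K)
  have h1 : ∀ x, fderiv ℝ f x e =
      ∑ b ∈ K, inner ℝ (baryGrad K b) e * fderiv ℝ f x (b - a₀) := by
    intro x
    conv_lhs => rw [he]
    simp only [map_sum, map_smul, smul_eq_mul]
  simp only [h1]
  rw [integral_finsetSum _ fun b _ => (hint (b - a₀)).const_mul _]
  simp only [integral_const_mul]
  set S : E (n + 1) → ℝ := fun a => ‖baryGrad K a‖⁻¹ *
    ∫ x in hull (K.erase a), f x ∂(Measure.euclideanHausdorffMeasure n) with hS
  have h2 : ∀ b ∈ K, ∫ x in hull K, fderiv ℝ f x (b - a₀) = S a₀ - S b := by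
    intro b hb
    by_cases h : a₀ = b
    · subst h; simp
    · exact hK.integral_hull_fderiv_edge ha₀ hb h hf
  rw [Finset.sum_congr rfl fun b hb => by rw [h2 b hb, mul_sub], Finset.sum_sub_distrib,
    ← Finset.sum_mul, hK.sum_inner_baryGrad, zero_mul, zero_sub]
  congr 1
  exact Finset.sum_congr rfl fun b _ => by rw [hS]; ring

end IsSimplex

/-! ### Elements and sides of a triangulation -/

namespace IsSimplex

variable {d : ℕ} {K : Finset (E d)}

/-- A vector normal to a face is a multiple of the gradient of the opposite barycentric
coordinate. -/
theorem eq_smul_baryGrad (hK : IsSimplex K) {a : E d} (ha : a ∈ K) {v y : E d}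
    (hv : ∀ x ∈ K.erase a, inner ℝ v (x - y) = 0) :
    v = inner ℝ v (a - y) • baryGrad K a := by
  refine ext_inner_right ℝ fun e => ?_
  have he : e = ∑ b ∈ K, inner ℝ (baryGrad K b) e • (b - y) := by
    simp only [smul_sub, Finset.sum_sub_distrib, hK.sum_inner_baryGrad_smul, ← Finset.sum_smul,
      hK.sum_inner_baryGrad, zero_smul, sub_zero]
  rw [inner_smul_left]
  conv_lhs => rw [he]
  rw [inner_sum, Finset.sum_eq_single a]
  · simp [inner_smul_right, mul_comm]
  · intro b hb hba
    rw [inner_smul_right, hv b (Finset.mem_erase.2 ⟨hba, hb⟩), mul_zero]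
  · exact fun h => absurd ha h

end IsSimplex

namespace Triangulation

variable {d : ℕ} {Ω : Set (E d)} (T : Triangulation Ω)

theorem mem_elements {K : Finset (E d)} : K ∈ T.elements ↔ K ∈ T.faces ∧ K.card = d + 1 := by
  simp [elements]

theorem mem_sides {F : Finset (E d)} : F ∈ T.sides ↔ F ∈ T.faces ∧ F.card = d := by
  simp [sides]

variable {T} in
theorem isSimplex {K : Finset (E d)} (hK : K ∈ T.elements) : IsSimplex K :=
  ⟨T.indep (T.mem_elements.1 hK).1, (T.mem_elements.1 hK).2⟩

theorem erase_mem_sides (hd : 1 ≤ d) {K : Finset (E d)} (hK : K ∈ T.elements)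
    {a : E d} (ha : a ∈ K) : K.erase a ∈ T.sides := by
  have hc : (K.erase a).card = d := by
    rw [Finset.card_erase_of_mem ha, (isSimplex hK).2]; omega
  refine T.mem_sides.2 ⟨T.down_closed (T.mem_elements.1 hK).1 (Finset.erase_subset a K) ?_, hc⟩
  rw [← Finset.card_pos, hc]; omega

theorem exists_erase_eq {F K : Finset (E d)} (hF : F ∈ T.sides)
    (hK : K ∈ T.elements) (h : F ⊆ K) : ∃ a ∈ K, F = K.erase a := by
  have hc : (K \ F).card = 1 := by
    rw [Finset.card_sdiff_of_subset h, (isSimplex hK).2, (T.mem_sides.1 hF).2]; omega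
  obtain ⟨a, ha⟩ := Finset.card_eq_one.1 hc
  have haK : a ∈ K \ F := by rw [ha]; simp
  refine ⟨a, (Finset.mem_sdiff.1 haK).1, ?_⟩
  rw [← Finset.sdiff_singleton_eq_erase, ← ha, Finset.sdiff_sdiff_eq_self h]

theorem plus_spec {F : Finset (E d)} (hF : F ∈ T.sides) : T.plus F ∈ T.elements ∧ F ⊆ T.plus F := by
  obtain ⟨K, hK, hFK, hc⟩ := T.pure_faces F (T.mem_sides.1 hF).1
  exact Classical.epsilon_spec (p := fun K => K ∈ T.elements ∧ F ⊆ K)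
    ⟨K, T.mem_elements.2 ⟨hK, hc⟩, hFK⟩

theorem side_nonempty {F : Finset (E d)} (hF : F ∈ T.sides) : F.Nonempty :=
  T.nonempty_of_mem_faces (T.mem_sides.1 hF).1

theorem normal_spec (hd : 1 ≤ d) {F : Finset (E d)} (hF : F ∈ T.sides) :
    ‖T.normal F‖ = 1 ∧ (∀ x ∈ F, ∀ y ∈ F, inner ℝ (T.normal F) (x - y) = 0) ∧
      ∀ x ∈ F, ∀ a ∈ T.plus F, inner ℝ (T.normal F) (a - x) ≤ 0 := by
  classical
  obtain ⟨hK, hFK⟩ := T.plus_spec hF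
  obtain ⟨a, ha, hFa⟩ := T.exists_erase_eq hF hK hFK
  have hS := isSimplex hK
  have hg : ‖baryGrad (T.plus F) a‖ ≠ 0 := norm_ne_zero_iff.2 (hS.baryGrad_ne_zero hd ha)
  have haF : ∀ x ∈ F, a ≠ x := by
    rintro x hx rfl
    rw [hFa] at hx
    simp at hx
  refine Classical.epsilon_spec (p := fun n : E d => ‖n‖ = 1 ∧
    (∀ x ∈ F, ∀ y ∈ F, inner ℝ n (x - y) = 0) ∧ ∀ x ∈ F, ∀ a ∈ T.plus F, inner ℝ n (a - x) ≤ 0)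
    ⟨-(‖baryGrad (T.plus F) a‖⁻¹ • baryGrad (T.plus F) a), ?_, ?_, ?_⟩
  · rw [norm_neg, norm_smul, norm_inv, norm_norm, inv_mul_cancel₀ hg]
  · intro x hx y hy
    rw [inner_neg_left, real_inner_smul_left, hS.inner_baryGrad_sub ha (hFK hx) (hFK hy),
      if_neg (haF x hx), if_neg (haF y hy)]
    simp
  · intro x hx b hb
    rw [inner_neg_left, real_inner_smul_left, hS.inner_baryGrad_sub ha hb (hFK hx),
      if_neg (haF x hx), sub_zero]
    have : (0 : ℝ) ≤ if a = b then 1 else 0 := by split_ifs <;> norm_num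
    have := mul_nonneg (inv_nonneg.2 (norm_nonneg (baryGrad (T.plus F) a))) this
    linarith

/-- Two elements with a common side lie on different sides of it. -/
theorem bary_opposite_nonpos (hd : 1 ≤ d) {K K' : Finset (E d)}
    (hK : K ∈ T.elements) (hK' : K' ∈ T.elements) (hne : K ≠ K') {a a' : E d} (ha : a ∈ K)
    (h : K.erase a = K'.erase a') : bary K' a' a ≤ 0 := by
  by_contra hpos
  push Not at hpos
  have hS := isSimplex hK
  have hS' := isSimplex hK'
  set F := K.erase a with hF
  have hFne : F.Nonempty := T.side_nonempty (T.erase_mem_sides hd hK ha)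
  have hFc : (0 : ℝ) < F.card := by exact_mod_cast hFne.card_pos
  have hFK : F ⊆ K := Finset.erase_subset _ _
  have hFK' : F ⊆ K' := h ▸ Finset.erase_subset _ _
  have hw : ∑ b ∈ F, (fun _ => (F.card : ℝ)⁻¹) b = 1 := by
    rw [Finset.sum_const, nsmul_eq_mul, mul_inv_cancel₀ hFc.ne']
  -- the midpoint of the side, moved slightly towards `a`
  set y : E d := ∑ b ∈ F, (fun _ => (F.card : ℝ)⁻¹) b • b with hy
  have hyK : ∀ b ∈ K, bary K b y = if b ∈ F then (F.card : ℝ)⁻¹ else 0 :=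
    fun b hb => hS.bary_combination_mem hb hFK hw
  have hyK' : ∀ b ∈ K', bary K' b y = if b ∈ F then (F.card : ℝ)⁻¹ else 0 :=
    fun b hb => hS'.bary_combination_mem hb hFK' hw
  have hline : ∀ (L : Finset (E d)) (b : E d) (t : ℝ),
      bary L b (y + t • (a - y)) = (1 - t) * bary L b y + t * bary L b a := by
    intro L b t
    simp only [bary, inner_add_right, inner_smul_right, inner_sub_right]
    ring
  have hev : ∀ᶠ t : ℝ in nhdsWithin 0 (Ioi 0), ∀ b ∈ K', 0 < bary K' b (y + t • (a - y)) := by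
    rw [Finset.eventually_all]
    intro b hb
    by_cases hbF : b ∈ F
    · have hc : Continuous (fun t : ℝ => bary K' b (y + t • (a - y))) :=
        (continuous_bary K' b).comp (by fun_prop)
      have : 0 < bary K' b (y + (0 : ℝ) • (a - y)) := by
        rw [zero_smul, add_zero, hyK' b hb, if_pos hbF]; positivity
      exact nhdsWithin_le_nhds ((hc.tendsto 0).eventually (lt_mem_nhds this))
    · have hb' : b = a' := by
        by_contra hba
        exact hbF (h ▸ Finset.mem_erase.2 ⟨hba, hb⟩)
      filter_upwards [self_mem_nhdsWithin] with t ht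
      rw [hline, hyK' b hb, if_neg hbF, mul_zero, zero_add, hb']
      exact mul_pos ht hpos
  obtain ⟨t, ht, ht0, ht1⟩ := (hev.and (Ioo_mem_nhdsGT (zero_lt_one' ℝ))).exists
  have hzK : y + t • (a - y) ∈ hull K := by
    rw [hS.mem_hull_iff]
    intro b hb
    rw [hline, hyK b hb, hS.bary_vertex hb ha]
    have h1 : (0 : ℝ) ≤ if b ∈ F then (F.card : ℝ)⁻¹ else 0 := by split_ifs <;> positivity
    have h2 : (0 : ℝ) ≤ if b = a then 1 else 0 := by split_ifs <;> norm_num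
    have := mul_nonneg (sub_nonneg.2 ht1.le) h1
    have := mul_nonneg ht0.le h2
    linarith
  have hzK' : y + t • (a - y) ∈ hull K' := hS'.openHull_subset ht
  have hz := T.inter_subset_convexHull (T.mem_elements.1 hK).1 (T.mem_elements.1 hK').1
    ⟨hzK, hzK'⟩
  rw [← Finset.coe_inter] at hz
  have haK' : a ∉ K' := by
    intro haK'
    have hsub : K ⊆ K' := by
      rw [← Finset.insert_erase ha]
      exact Finset.insert_subset haK' hFK'
    exact hne (Finset.eq_of_subset_of_card_le hsub (by rw [hS.2, hS'.2]))
  have h0 := ((hS.mem_hull_iff_of_subset Finset.inter_subset_left).1 hz).2 a ha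
    (fun hm => haK' (Finset.mem_inter.1 hm).2)
  rw [hline, hyK a ha, if_neg (by simp [hF]), hS.bary_vertex ha ha, if_pos rfl] at h0
  linarith

/-- The sign of the fixed normal of a side relative to the outward normal of an element. -/
noncomputable def sideSign (K F : Finset (E d)) : ℝ :=
  open Classical in if K = T.plus F then 1 else -1

theorem normal_eq_aux (hd : 1 ≤ d) {K : Finset (E d)} (hK : K ∈ T.elements)
    {a : E d} (ha : a ∈ K) {y : E d} (hy : y ∈ K.erase a) :
    T.normal (K.erase a) = inner ℝ (T.normal (K.erase a)) (a - y) • baryGrad K a ∧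
      |inner ℝ (T.normal (K.erase a)) (a - y)| * ‖baryGrad K a‖ = 1 := by
  obtain ⟨h1, h2, -⟩ := T.normal_spec hd (T.erase_mem_sides hd hK ha)
  have h3 := (isSimplex hK).eq_smul_baryGrad ha fun x hx => h2 x hx y hy
  refine ⟨h3, ?_⟩
  rw [h3, norm_smul, Real.norm_eq_abs] at h1
  exact h1

/-- The outward unit normal of an element on one of its sides. -/
theorem sideSign_smul_normal (hd : 1 ≤ d) {K : Finset (E d)}
    (hK : K ∈ T.elements) {a : E d} (ha : a ∈ K) :
    T.sideSign K (K.erase a) • T.normal (K.erase a) = -(‖baryGrad K a‖⁻¹ • baryGrad K a) := by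
  set F := K.erase a with hF
  have hFs : F ∈ T.sides := T.erase_mem_sides hd hK ha
  obtain ⟨y, hy⟩ := T.side_nonempty hFs
  obtain ⟨h1, h2⟩ := T.normal_eq_aux hd hK ha hy
  have hg : ‖baryGrad K a‖ ≠ 0 := norm_ne_zero_iff.2 ((isSimplex hK).baryGrad_ne_zero hd ha)
  have hplus := (T.normal_spec hd hFs).2.2 y hy
  rw [← hF] at h1 h2
  set m := inner ℝ (T.normal F) (a - y) with hm
  by_cases hKp : K = T.plus F
  · have hm0 : m ≤ 0 := hplus a (hKp ▸ ha)
    rw [abs_of_nonpos hm0] at h2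
    have hm1 : m = -‖baryGrad K a‖⁻¹ := by field_simp; linarith
    rw [sideSign, if_pos hKp, one_smul, h1, hm1, neg_smul]
  · obtain ⟨hP, hFP⟩ := T.plus_spec hFs
    obtain ⟨b, hb, hFb⟩ := T.exists_erase_eq hFs hP hFP
    have hop := T.bary_opposite_nonpos hd hP hK (fun h => hKp h.symm) hb (by rw [← hFb])
    have hb0 : inner ℝ (T.normal F) (b - y) ≤ 0 := hplus b hb
    have hb1 : inner ℝ (T.normal F) (b - y) = m * bary K a b := by
      have h3 : bary K a b = bary K a b - bary K a y := by
        rw [(isSimplex hK).bary_vertex ha (Finset.mem_of_mem_erase hy),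
          if_neg (Finset.ne_of_mem_erase hy).symm, sub_zero]
      rw [h3]
      conv_lhs => rw [h1]
      simp only [real_inner_smul_left, bary, inner_sub_right]
      ring
    have hb2 : inner ℝ (T.normal F) (b - y) ≠ 0 := by
      have h4 := (T.normal_eq_aux hd hP hb (y := y) (by rw [← hFb]; exact hy)).2
      rw [← hFb] at h4
      intro h5
      rw [h5] at h4
      simp at h4
    have hm0 : 0 ≤ m := by
      by_contra hneg
      push Not at hneg
      have := mul_nonneg_of_nonpos_of_nonpos hneg.le hop
      rw [← hb1] at this
      exact hb2 (le_antisymm hb0 this)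
    rw [abs_of_nonneg hm0] at h2
    have hm1 : m = ‖baryGrad K a‖⁻¹ := by field_simp; linarith
    rw [sideSign, if_neg hKp, neg_one_smul, h1, hm1]

theorem eq_of_ne_plus (hd : 1 ≤ d) {F K K' : Finset (E d)} (hF : F ∈ T.sides)
    (hK : K ∈ T.elements) (hFK : F ⊆ K) (hKp : K ≠ T.plus F) (hK' : K' ∈ T.elements)
    (hFK' : F ⊆ K') (hKp' : K' ≠ T.plus F) : K = K' := by
  classical
  by_contra hne
  obtain ⟨a, ha, hFa⟩ := T.exists_erase_eq hF hK hFK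
  obtain ⟨b, hb, hFb⟩ := T.exists_erase_eq hF hK' hFK'
  have hop := T.bary_opposite_nonpos hd hK' hK (Ne.symm hne) hb (by rw [← hFa, ← hFb])
  obtain ⟨y, hy⟩ := T.side_nonempty hF
  have h1 := T.sideSign_smul_normal hd hK ha
  have h2 := T.sideSign_smul_normal hd hK' hb
  rw [← hFa, sideSign, if_neg hKp, neg_one_smul, neg_inj] at h1
  rw [← hFb, sideSign, if_neg hKp', neg_one_smul, neg_inj] at h2
  have hga : 0 < ‖baryGrad K a‖ := norm_pos_iff.2 ((isSimplex hK).baryGrad_ne_zero hd ha)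
  have hgb : 0 < ‖baryGrad K' b‖ := norm_pos_iff.2 ((isSimplex hK').baryGrad_ne_zero hd hb)
  have hyK' : y ∈ K'.erase b := hFb ▸ hy
  have hyK : y ∈ K.erase a := hFa ▸ hy
  have h3 : inner ℝ (T.normal F) (b - y) = ‖baryGrad K' b‖⁻¹ := by
    rw [h2, real_inner_smul_left, (isSimplex hK').inner_baryGrad_sub hb hb
      (Finset.mem_of_mem_erase hyK'), if_pos rfl, if_neg (Finset.ne_of_mem_erase hyK').symm]
    ring
  have h4 : inner ℝ (T.normal F) (b - y) = ‖baryGrad K a‖⁻¹ * bary K a b := by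
    have h5 : bary K a b = bary K a b - bary K a y := by
      rw [(isSimplex hK).bary_vertex ha (Finset.mem_of_mem_erase hyK),
        if_neg (Finset.ne_of_mem_erase hyK).symm, sub_zero]
    rw [h5, h1, real_inner_smul_left]
    simp only [bary, inner_sub_right]
    ring
  have h6 : ‖baryGrad K a‖⁻¹ * bary K a b ≤ 0 :=
    mul_nonpos_of_nonneg_of_nonpos (inv_nonneg.2 hga.le) hop
  have h7 : 0 < ‖baryGrad K' b‖⁻¹ := inv_pos.2 hgb
  linarith

theorem openHull_disjoint {K K' : Finset (E d)} (hK : K ∈ T.elements) (hK' : K' ∈ T.elements)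
    (hne : K ≠ K') : Disjoint (openHull K) (openHull K') := by
  classical
  rw [Set.disjoint_left]
  intro x hx hx'
  have hz := T.inter_subset_convexHull (T.mem_elements.1 hK).1 (T.mem_elements.1 hK').1
    ⟨(isSimplex hK).openHull_subset hx, (isSimplex hK').openHull_subset hx'⟩
  rw [← Finset.coe_inter] at hz
  obtain ⟨a, ha, haK'⟩ : ∃ a ∈ K, a ∉ K' := by
    by_contra! hsub
    exact hne (Finset.eq_of_subset_of_card_le hsub
      (by rw [(isSimplex hK).2, (isSimplex hK').2]))
  have h0 := (((isSimplex hK).mem_hull_iff_of_subset Finset.inter_subset_left).1 hz).2 a ha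
    (fun hm => haK' (Finset.mem_inter.1 hm).2)
  exact (hx a ha).ne' h0

theorem iUnion_hull : (⋃ K ∈ T.elements, hull K) = closure Ω := by
  rw [← T.cover]
  apply subset_antisymm
  · exact iUnion₂_subset fun K hK => subset_iUnion₂_of_subset K (T.mem_elements.1 hK).1 (Subset.refl _)
  · refine iUnion₂_subset fun s hs => ?_
    obtain ⟨K, hK, hsK, hc⟩ := T.pure_faces s hs
    exact subset_iUnion₂_of_subset K (T.mem_elements.2 ⟨hK, hc⟩)
      (convexHull_mono (Finset.coe_subset.2 hsK))

theorem hull_subset_closure {K : Finset (E d)} (hK : K ∈ T.elements) : hull K ⊆ closure Ω := by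
  rw [← T.iUnion_hull]
  exact subset_iUnion₂_of_subset K hK (Subset.refl _)

/-- A side that is contained in one element only lies on the boundary. -/
theorem exists_ne_plus_of_not_isBoundary (hd : 1 ≤ d) (hopen : IsOpen Ω) {F : Finset (E d)}
    (hF : F ∈ T.sides) (hb : ¬ T.IsBoundary F) : ∃ K ∈ T.elements, F ⊆ K ∧ K ≠ T.plus F := by
  classical
  obtain ⟨hP, hFP⟩ := T.plus_spec hF
  obtain ⟨a, ha, hFa⟩ := T.exists_erase_eq hF hP hFP
  set P := T.plus F with hPdef
  have hS := isSimplex hP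
  obtain ⟨x, hxF, hx⟩ := not_subset.1 hb
  have hxΩ : x ∈ Ω := by
    by_contra hn
    refine hx ⟨T.hull_subset_closure hP (convexHull_mono (Finset.coe_subset.2 hFP) hxF), ?_⟩
    rwa [hopen.interior_eq]
  have hFne := T.side_nonempty hF
  have hFc : (0 : ℝ) < F.card := by exact_mod_cast hFne.card_pos
  have hw : ∑ b ∈ F, (fun _ => (F.card : ℝ)⁻¹) b = 1 := by
    rw [Finset.sum_const, nsmul_eq_mul, mul_inv_cancel₀ hFc.ne']
  set c : E d := ∑ b ∈ F, (fun _ => (F.card : ℝ)⁻¹) b • b with hc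
  have hcP : ∀ b ∈ P, bary P b c = if b ∈ F then (F.card : ℝ)⁻¹ else 0 :=
    fun b hb => hS.bary_combination_mem hb hFP hw
  have hxP := (hS.mem_hull_iff_of_subset hFP).1 hxF
  -- a point of the relative interior of the side that belongs to `Ω`
  have hcont : Continuous (fun t : ℝ => x + t • (c - x)) := by fun_prop
  have hev : ∀ᶠ t : ℝ in nhdsWithin 0 (Ioi 0), x + t • (c - x) ∈ Ω :=
    nhdsWithin_le_nhds ((hcont.tendsto 0).eventually (hopen.mem_nhds (by rw [zero_smul, add_zero]; exact hxΩ)))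
  obtain ⟨t, htΩ, ht0, ht1⟩ := (hev.and (Ioo_mem_nhdsGT (zero_lt_one' ℝ))).exists
  set y := x + t • (c - x) with hy
  have hline : ∀ b, bary P b y = (1 - t) * bary P b x + t * bary P b c := by
    intro b
    simp only [hy, bary, inner_add_right, inner_smul_right, inner_sub_right]
    ring
  have hyF : ∀ b ∈ F, 0 < bary P b y := by
    intro b hb
    rw [hline, hcP b (hFP hb), if_pos hb]
    have h1 := mul_nonneg (sub_nonneg.2 ht1.le) (hxP.1 b (hFP hb))
    have h2 := mul_pos ht0 (inv_pos.2 hFc)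
    linarith
  have hya : bary P a y = 0 := by
    have haF : a ∉ F := by rw [hFa]; simp
    rw [hline, hcP a ha, if_neg haF, hxP.2 a ha haF]
    ring
  have hyP : y ∈ hull P := by
    rw [hS.mem_hull_iff]
    intro b hb
    by_cases hbF : b ∈ F
    · exact (hyF b hbF).le
    · have : b = a := by
        by_contra hba
        exact hbF (hFa ▸ Finset.mem_erase.2 ⟨hba, hb⟩)
      rw [this, hya]
  by_contra! honly
  -- points beyond the side are covered by elements, hence by some element containing `y`
  have hcont2 : Continuous (fun s : ℝ => y - s • baryGrad P a) := by fun_prop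
  have hev2 : ∀ᶠ s : ℝ in nhdsWithin 0 (Ioi 0), ∃ K ∈ T.elements, y - s • baryGrad P a ∈ hull K := by
    have h1 : ∀ᶠ s : ℝ in nhdsWithin 0 (Ioi 0), y - s • baryGrad P a ∈ Ω :=
      nhdsWithin_le_nhds ((hcont2.tendsto 0).eventually (hopen.mem_nhds (by rw [zero_smul, sub_zero]; exact htΩ)))
    filter_upwards [h1] with s hs
    have := subset_closure hs
    rw [← T.iUnion_hull] at this
    simpa only [mem_iUnion, exists_prop] using this
  obtain ⟨K, hK, hfreq⟩ : ∃ K ∈ T.elements, ∃ᶠ s : ℝ in nhdsWithin 0 (Ioi 0),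
      y - s • baryGrad P a ∈ hull K := by
    by_contra! hno
    have h2 : ∀ᶠ s : ℝ in nhdsWithin 0 (Ioi 0), ∀ K ∈ T.elements, y - s • baryGrad P a ∉ hull K := by
      rw [Finset.eventually_all]
      intro K hK
      exact hno K hK
    obtain ⟨s, ⟨K, hK, hs⟩, hs'⟩ := (hev2.and h2).exists
    exact hs' K hK hs
  have hyK : y ∈ hull K := by
    have htend : Filter.Tendsto (fun s : ℝ => y - s • baryGrad P a) (nhdsWithin 0 (Ioi 0))
        (nhds y) := by
      have := (hcont2.tendsto 0).mono_left (nhdsWithin_le_nhds (s := Ioi (0 : ℝ)))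
      rwa [zero_smul, sub_zero] at this
    exact (isCompact_hull K).isClosed.mem_of_frequently_of_tendsto hfreq htend
  have hyi := T.inter_subset_convexHull (T.mem_elements.1 hP).1 (T.mem_elements.1 hK).1 ⟨hyP, hyK⟩
  rw [← Finset.coe_inter] at hyi
  have hFK : F ⊆ K := by
    intro b hb
    by_contra hbK
    have := ((hS.mem_hull_iff_of_subset Finset.inter_subset_left).1 hyi).2 b (hFP hb)
      (fun hm => hbK (Finset.mem_inter.1 hm).2)
    exact (hyF b hb).ne' this
  have hKP := honly K hK hFK
  obtain ⟨s, hs, hs0⟩ := (hfreq.and_eventually self_mem_nhdsWithin).exists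
  rw [hKP] at hs
  have h3 := hS.bary_nonneg hs a
  have h4 : bary P a (y - s • baryGrad P a) = -(s * ‖baryGrad P a‖ ^ 2) := by
    have : bary P a (y - s • baryGrad P a) = bary P a y - s * ‖baryGrad P a‖ ^ 2 := by
      simp only [bary, inner_sub_right, inner_smul_right, real_inner_self_eq_norm_sq]
      ring
    rw [this, hya, zero_sub]
  have h5 : 0 < s * ‖baryGrad P a‖ ^ 2 :=
    mul_pos hs0 (pow_pos (norm_pos_iff.2 (hS.baryGrad_ne_zero hd ha)) 2)
  linarith

end Triangulation

/-! ### Integration by parts on a triangulation -/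

theorem contDiff_polyEval {d : ℕ} (p : MvPolynomial (Fin d) ℝ) {m : WithTop ℕ∞} :
    ContDiff ℝ m (fun x : E d => polyEval p x) := by
  induction p using MvPolynomial.induction_on with
  | C a => simpa [polyEval] using contDiff_const
  | add p q hp hq =>
    simp only [polyEval, map_add] at *
    exact hp.add hq
  | mul_X p i hp =>
    simp only [polyEval, map_mul, MvPolynomial.eval_X] at *
    exact hp.mul (by fun_prop)

theorem continuous_polyEval {d : ℕ} (p : MvPolynomial (Fin d) ℝ) :
    Continuous (fun x : E d => polyEval p x) := (contDiff_polyEval p (m := 0)).continuous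

theorem fderiv_polyEval {d : ℕ} (p : MvPolynomial (Fin d) ℝ) (x e : E d) :
    fderiv ℝ (fun x : E d => polyEval p x) x e =
      ∑ j, e j * polyEval (MvPolynomial.pderiv j p) x := by
  have hdiff : ∀ q : MvPolynomial (Fin d) ℝ, DifferentiableAt ℝ (fun x : E d => polyEval q x) x :=
    fun q => (contDiff_polyEval q (m := 1)).differentiable one_ne_zero x
  induction p using MvPolynomial.induction_on with
  | C a => simp [polyEval]
  | add p q hp hq =>
    have : (fun x : E d => polyEval (p + q) x) =
        (fun x : E d => polyEval p x) + (fun x : E d => polyEval q x) := by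
      funext x; simp [polyEval]
    rw [this, fderiv_add (hdiff p) (hdiff q), add_apply, hp, hq,
      ← Finset.sum_add_distrib]
    exact Finset.sum_congr rfl fun j _ => by simp [polyEval]; ring
  | mul_X p i hp =>
    have h1 : (fun x : E d => polyEval (p * MvPolynomial.X i) x) =
        (fun x : E d => polyEval p x) * (fun x : E d => x i) := by
      funext x; simp [polyEval]
    have h2 : HasFDerivAt (fun x : E d => x i) (EuclideanSpace.proj i : E d →L[ℝ] ℝ) x :=
      (EuclideanSpace.proj i : E d →L[ℝ] ℝ).hasFDerivAt
    rw [h1, ((hdiff p).hasFDerivAt.mul h2).fderiv]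
    have h3 : ∀ j, e j * polyEval (MvPolynomial.pderiv j (p * MvPolynomial.X i)) x =
        (e j * polyEval (MvPolynomial.pderiv j p) x) * x i + (if j = i then e j * polyEval p x else 0) := by
      intro j
      simp only [polyEval, Derivation.leibniz, MvPolynomial.pderiv_X, smul_eq_mul, map_add,
        map_mul, MvPolynomial.eval_X, Pi.single_apply]
      by_cases h : j = i
      · subst h; simp; ring
      · rw [if_neg (fun h' => h h'.symm), if_neg h]; simp; ring
    rw [Finset.sum_congr rfl fun j _ => h3 j, Finset.sum_add_distrib, ← Finset.sum_mul, ← hp]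
    simp
    ring

theorem partialDeriv_polyEval {d : ℕ} (i : Fin d) (p : MvPolynomial (Fin d) ℝ) (x : E d) :
    partialDeriv i (fun x => polyEval p x) x = polyEval (MvPolynomial.pderiv i p) x := by
  rw [partialDeriv, fderiv_polyEval, Finset.sum_eq_single i]
  · simp
  · intro j _ hj; simp [hj]
  · simp

theorem partialDeriv_mul {d : ℕ} (i : Fin d) {φ ψ : E d → ℝ} {x : E d}
    (hφ : DifferentiableAt ℝ φ x) (hψ : DifferentiableAt ℝ ψ x) :
    partialDeriv i (fun x => φ x * ψ x) x = φ x * partialDeriv i ψ x + partialDeriv i φ x * ψ x := by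
  simp only [partialDeriv]
  rw [fderiv_fun_mul hφ hψ]
  simp
  ring

theorem continuous_partialDeriv {d : ℕ} (i : Fin d) {φ : E d → ℝ} (hφ : ContDiff ℝ 1 φ) :
    Continuous (partialDeriv i φ) :=
  (hφ.continuous_fderiv one_ne_zero).clm_apply continuous_const

theorem contDiff_partialDeriv {d : ℕ} (i : Fin d) {φ : E d → ℝ} (hφ : ContDiff ℝ ∞ φ) :
    ContDiff ℝ ∞ (partialDeriv i φ) :=
  (hφ.fderiv_right (m := ∞) (by simp)).clm_apply contDiff_const

theorem IsTestFunction.partialDeriv {d : ℕ} {Ω : Set (E d)} {φ : E d → ℝ}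
    (hφ : IsTestFunction Ω φ) (i : Fin d) : IsTestFunction Ω (DivDivFEM.partialDeriv i φ) := by
  have hsub : tsupport (DivDivFEM.partialDeriv i φ) ⊆ tsupport φ := by
    refine closure_minimal (fun x hx => ?_) (isClosed_tsupport φ)
    refine support_fderiv_subset ℝ ?_
    intro h
    exact hx (by simp [DivDivFEM.partialDeriv, h])
  exact ⟨contDiff_partialDeriv i hφ.1, hφ.2.1.of_isClosed_subset (isClosed_tsupport _) hsub,
    hsub.trans hφ.2.2⟩

namespace Triangulation

variable {d : ℕ} {Ω : Set (E d)} (T : Triangulation Ω)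

/-- The elements of a triangulation cover `Ω` up to a null set. -/
theorem ae_eq_iUnion_openHull (hd : 1 ≤ d) (hreg : interior (closure Ω) = Ω) :
    (⋃ K ∈ T.elements, openHull K) =ᵐ[volume] Ω := by
  have hsub : (⋃ K ∈ T.elements, openHull K) ⊆ Ω := by
    refine Subset.trans ?_ hreg.subset
    exact interior_maximal (iUnion₂_subset fun K hK =>
      (isSimplex hK).openHull_subset.trans (T.hull_subset_closure hK))
      (isOpen_biUnion fun K _ => isOpen_openHull K)
  refine hsub.eventuallyLE.antisymm ?_
  rw [ae_le_set]
  refine measure_mono_null (t := ⋃ K ∈ T.elements, hull K \ openHull K) ?_ ?_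
  · rintro x ⟨hx, hn⟩
    have := subset_closure hx
    rw [← T.iUnion_hull] at this
    simp only [mem_iUnion, not_exists, exists_prop] at this hn ⊢
    obtain ⟨K, hK, hxK⟩ := this
    exact ⟨K, hK, hxK, fun h => hn K ⟨hK, h⟩⟩
  · refine (measure_biUnion_null_iff T.elements.countable_toSet).2 fun K hK => ?_
    exact ae_le_set.1 ((isSimplex hK).openHull_ae_eq hd).symm.le

theorem integral_eq_sum (hd : 1 ≤ d) (hreg : interior (closure Ω) = Ω) {f : E d → ℝ}
    (hf : ∀ K ∈ T.elements, IntegrableOn f (hull K)) :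
    ∫ x in Ω, f x = ∑ K ∈ T.elements, ∫ x in hull K, f x := by
  rw [← setIntegral_congr_set (T.ae_eq_iUnion_openHull hd hreg),
    integral_biUnion_finset _ (fun K _ => (isOpen_openHull K).measurableSet)
      (fun K hK K' hK' hne => T.openHull_disjoint hK hK' hne)
      (fun K hK => (hf K hK).mono_set (isSimplex hK).openHull_subset)]
  exact Finset.sum_congr rfl fun K hK => setIntegral_congr_set ((isSimplex hK).openHull_ae_eq hd)

/-- The function that equals `u K` inside each element `K`. -/
noncomputable def glue (u : Finset (E d) → E d → ℝ) (x : E d) : ℝ :=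
  ∑ K ∈ T.elements, (openHull K).indicator (u K) x

/-- `f` agrees almost everywhere on each element `K` with `u K`. -/
def Agrees (f : E d → ℝ) (u : Finset (E d) → E d → ℝ) : Prop :=
  ∀ K ∈ T.elements, ∀ᵐ x ∂(volume.restrict (hull K)), f x = u K x

theorem agrees_glue (hd : 1 ≤ d) (u : Finset (E d) → E d → ℝ) : T.Agrees (T.glue u) u := by
  intro K hK
  rw [← Measure.restrict_congr_set ((isSimplex hK).openHull_ae_eq hd)]
  filter_upwards [ae_restrict_mem (isOpen_openHull K).measurableSet] with x hx
  rw [glue, Finset.sum_eq_single K, indicator_of_mem hx]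
  · intro K' hK' hne
    exact indicator_of_notMem (fun hx' => Set.disjoint_left.1 (T.openHull_disjoint hK' hK hne) hx' hx) _
  · exact fun h => absurd hK h

theorem inL2_glue {u : Finset (E d) → E d → ℝ} (hu : ∀ K ∈ T.elements, Continuous (u K)) :
    InL2 Ω (T.glue u) := by
  unfold InL2 glue
  refine memLp_finsetSum _ fun K hK => ?_
  refine MemLp.restrict _ ?_
  rw [memLp_indicator_iff_restrict (isOpen_openHull K).measurableSet]
  refine MemLp.mono_measure (Measure.restrict_mono (isSimplex hK).openHull_subset le_rfl) ?_
  obtain ⟨C, hC⟩ := (isCompact_hull K).exists_bound_of_continuousOn (hu K hK).continuousOn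
  have : IsFiniteMeasure (volume.restrict (hull K)) :=
    ⟨by rw [Measure.restrict_apply_univ]; exact (isCompact_hull K).measure_lt_top⟩
  refine MemLp.of_bound (hu K hK).aestronglyMeasurable C ?_
  filter_upwards [ae_restrict_mem (measurableSet_hull K)] with x hx using hC x hx

variable {T} in
theorem Agrees.integral_mul {f : E d → ℝ} {u : Finset (E d) → E d → ℝ} (h : T.Agrees f u)
    (hu : ∀ K ∈ T.elements, Continuous (u K)) {w : E d → ℝ} {z : Finset (E d) → E d → ℝ}
    (hw : T.Agrees w z) (hz : ∀ K ∈ T.elements, Continuous (z K))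
    (hd : 1 ≤ d) (hreg : interior (closure Ω) = Ω) :
    ∫ x in Ω, f x * w x = ∑ K ∈ T.elements, ∫ x in hull K, u K x * z K x := by
  have hae : ∀ K ∈ T.elements, (fun x => f x * w x) =ᵐ[volume.restrict (hull K)]
      fun x => u K x * z K x := by
    intro K hK
    filter_upwards [h K hK, hw K hK] with x h1 h2
    rw [h1, h2]
  rw [T.integral_eq_sum hd hreg fun K hK => ?_]
  · exact Finset.sum_congr rfl fun K hK => integral_congr_ae (hae K hK)
  · have : IntegrableOn (fun x => u K x * z K x) (hull K) :=
      ((hu K hK).mul (hz K hK)).continuousOn.integrableOn_compact (isCompact_hull K)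
    exact this.congr (hae K hK).symm

theorem agrees_self (φ : E d → ℝ) : T.Agrees φ (fun _ => φ) :=
  fun _ _ => Filter.Eventually.of_forall fun _ => rfl

/-- Summation over the faces of all elements, arranged by sides. -/
theorem sum_elements_erase (hd : 1 ≤ d) (Φ : Finset (E d) → Finset (E d) → ℝ) :
    ∑ K ∈ T.elements, ∑ a ∈ K, Φ K (K.erase a) =
      ∑ F ∈ T.sides, ∑ K ∈ T.elements.filter (fun K => F ⊆ K), Φ K F := by
  have h1 : ∀ K ∈ T.elements, ∑ a ∈ K, Φ K (K.erase a) =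
      ∑ F ∈ T.sides.filter (fun F => F ⊆ K), Φ K F := by
    intro K hK
    refine Finset.sum_bij (fun a _ => K.erase a) ?_ ?_ ?_ ?_
    · intro a ha
      exact Finset.mem_filter.2 ⟨T.erase_mem_sides hd hK ha, Finset.erase_subset _ _⟩
    · intro a ha b hb h
      exact (Finset.erase_inj K ha).1 h
    · intro F hF
      obtain ⟨a, ha, h⟩ := T.exists_erase_eq (Finset.mem_filter.1 hF).1 hK (Finset.mem_filter.1 hF).2
      exact ⟨a, ha, h.symm⟩
    · intro a _; rfl
  rw [Finset.sum_congr rfl h1]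
  refine Finset.sum_comm' fun K F => ?_
  simp only [Finset.mem_filter]
  tauto

theorem sum_sideSign {F : Finset (E d)} (hF : F ∈ T.sides) (u : Finset (E d) → E d → ℝ) (x : E d) :
    ∑ K ∈ T.elements.filter (fun K => F ⊆ K), T.sideSign K F * u K x = T.jump u F x := by
  classical
  obtain ⟨hP, hFP⟩ := T.plus_spec hF
  rw [← Finset.add_sum_erase _ _ (Finset.mem_filter.2 ⟨hP, hFP⟩), jump, sub_eq_add_neg,
    ← Finset.sum_neg_distrib]
  congr 1
  · simp [sideSign]
  · refine Finset.sum_congr ?_ fun K hK => ?_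
    · ext K
      simp only [Finset.mem_erase, Finset.mem_filter]
      tauto
    · have : K ≠ T.plus F := (Finset.mem_filter.1 hK).2.2
      simp [sideSign, this]

theorem jump_mul_right {F : Finset (E d)} {u : Finset (E d) → E d → ℝ}
    (ψ : E d → ℝ) (x : E d) :
    T.jump (fun K x => u K x * ψ x) F x = T.jump u F x * ψ x := by
  simp only [jump, sub_mul, Finset.sum_mul]

end Triangulation

namespace Triangulation

variable {n : ℕ} {Ω : Set (E (n + 1))} (T : Triangulation Ω)

theorem exists_side_enum {F : Finset (E (n + 1))} (hF : F ∈ T.sides) :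
    ∃ p : Fin (n + 1) → E (n + 1), Function.Injective p ∧ range p = F := by
  have hc := (T.mem_sides.1 hF).2
  refine ⟨fun i => (F.equivFinOfCardEq hc).symm i, ?_, ?_⟩
  · intro i j h; simpa using h
  · ext x
    constructor
    · rintro ⟨i, rfl⟩; simp
    · intro hx; exact ⟨F.equivFinOfCardEq hc ⟨x, hx⟩, by simp⟩

theorem integral_side_sum {F : Finset (E (n + 1))} (hF : F ∈ T.sides) {ι : Type*} (s : Finset ι)
    {f : ι → E (n + 1) → ℝ} (hf : ∀ i ∈ s, Continuous (f i)) :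
    ∫ x in hull F, ∑ i ∈ s, f i x ∂(Measure.euclideanHausdorffMeasure n) =
      ∑ i ∈ s, ∫ x in hull F, f i x ∂(Measure.euclideanHausdorffMeasure n) := by
  obtain ⟨hP, hFP⟩ := T.plus_spec hF
  obtain ⟨a, ha, hFa⟩ := T.exists_erase_eq hF hP hFP
  obtain ⟨p, hp, hr⟩ := T.exists_side_enum hF
  have hr' := hr
  rw [hFa] at hr'
  have hint : ∀ g : E (n + 1) → ℝ, ∫ x in hull F, g x ∂(Measure.euclideanHausdorffMeasure n) =
      simplexDensity (hull (T.plus F)) * ‖baryGrad (T.plus F) a‖ *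
        refInt n (fun l => g (∑ i, l i • p i)) := by
    intro g
    have := (isSimplex hP).integral_erase ha hp hr' g
    rwa [← hFa] at this
  simp only [hint, ← Finset.mul_sum]
  congr 1
  exact integral_finsetSum _ fun i hi => integrableOn_refSimplex
    (G := fun l => f i (∑ j, l j • p j)) ((hf i hi).comp (by fun_prop))

/-- Integration by parts on one element. -/
theorem integral_element_parts {K : Finset (E (n + 1))} (hK : K ∈ T.elements)
    (X : Fin (n + 1) → MvPolynomial (Fin (n + 1)) ℝ) {ψ : E (n + 1) → ℝ} (hψ : ContDiff ℝ 1 ψ) :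
    ∫ x in hull K, ∑ j, polyEval (X j) x * partialDeriv j ψ x =
      -(∫ x in hull K, polyEval (∑ j, MvPolynomial.pderiv j (X j)) x * ψ x) +
      ∑ a ∈ K, T.sideSign K (K.erase a) * ∫ x in hull (K.erase a),
        (∑ j, polyEval (X j) x * T.normal (K.erase a) j) * ψ x
          ∂(Measure.euclideanHausdorffMeasure n) := by
  have hS := isSimplex hK
  have hcd : ∀ j, ContDiff ℝ 1 (fun x : E (n + 1) => polyEval (X j) x * ψ x) :=
    fun j => (contDiff_polyEval (X j)).mul hψ
  have hc1 : ∀ j, Continuous (fun x : E (n + 1) => polyEval (X j) x * partialDeriv j ψ x) :=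
    fun j => (continuous_polyEval _).mul (continuous_partialDeriv j hψ)
  have hc2 : ∀ j, Continuous (fun x : E (n + 1) =>
      polyEval (MvPolynomial.pderiv j (X j)) x * ψ x) :=
    fun j => (continuous_polyEval _).mul hψ.continuous
  have hdiv : ∀ j, ∫ x in hull K, polyEval (X j) x * partialDeriv j ψ x =
      -(∫ x in hull K, polyEval (MvPolynomial.pderiv j (X j)) x * ψ x) +
      ∑ a ∈ K, T.sideSign K (K.erase a) * (T.normal (K.erase a) j *
        ∫ x in hull (K.erase a), polyEval (X j) x * ψ x
          ∂(Measure.euclideanHausdorffMeasure n)) := by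
    intro j
    have h1 := hS.integral_hull_fderiv (hcd j) (EuclideanSpace.single j 1)
    have h2 : ∀ x, fderiv ℝ (fun x : E (n + 1) => polyEval (X j) x * ψ x) x
        (EuclideanSpace.single j 1) = polyEval (X j) x * partialDeriv j ψ x +
          polyEval (MvPolynomial.pderiv j (X j)) x * ψ x := by
      intro x
      rw [← partialDeriv_polyEval j (X j) x]
      exact partialDeriv_mul j ((contDiff_polyEval (X j) (m := 1)).differentiable one_ne_zero x)
        (hψ.differentiable one_ne_zero x)
    simp only [h2] at h1
    rw [integral_add ((hc1 j).continuousOn.integrableOn_compact (isCompact_hull K))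
      ((hc2 j).continuousOn.integrableOn_compact (isCompact_hull K))] at h1
    have h3 : ∑ a ∈ K, T.sideSign K (K.erase a) * (T.normal (K.erase a) j *
        ∫ x in hull (K.erase a), polyEval (X j) x * ψ x
          ∂(Measure.euclideanHausdorffMeasure n)) =
        -∑ a ∈ K, inner ℝ (baryGrad K a) (EuclideanSpace.single j 1) * ‖baryGrad K a‖⁻¹ *
        ∫ x in hull (K.erase a), polyEval (X j) x * ψ x
          ∂(Measure.euclideanHausdorffMeasure n) := by
      rw [← Finset.sum_neg_distrib]
      refine Finset.sum_congr rfl fun a ha => ?_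
      have h4 := congrArg (fun v : E (n + 1) => v j)
        (T.sideSign_smul_normal (by omega) hK ha)
      simp only [PiLp.smul_apply, PiLp.neg_apply, smul_eq_mul] at h4
      rw [← mul_assoc, h4, EuclideanSpace.inner_single_right]
      simp only [conj_trivial, one_mul]
      ring
    rw [h3, ← h1]
    ring
  rw [integral_finsetSum _ fun j _ => (hc1 j).continuousOn.integrableOn_compact (isCompact_hull K),
    Finset.sum_congr rfl fun j _ => hdiv j, Finset.sum_add_distrib, Finset.sum_comm,
    Finset.sum_neg_distrib]
  congr 1
  · rw [← integral_finsetSum _ fun j _ =>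
      (hc2 j).continuousOn.integrableOn_compact (isCompact_hull K)]
    congr 2
    funext x
    simp only [polyEval, map_sum, Finset.sum_mul]
  · refine Finset.sum_congr rfl fun a ha => ?_
    rw [← Finset.mul_sum]
    congr 1
    have h5 : ∀ x : E (n + 1), (∑ j, polyEval (X j) x * T.normal (K.erase a) j) * ψ x =
        ∑ j, T.normal (K.erase a) j * (polyEval (X j) x * ψ x) := by
      intro x
      rw [Finset.sum_mul]
      exact Finset.sum_congr rfl fun j _ => by ring
    simp only [h5]
    rw [T.integral_side_sum (T.erase_mem_sides (by omega) hK ha) _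
      (f := fun j x => T.normal (K.erase a) j * (polyEval (X j) x * ψ x))
      fun j _ => continuous_const.mul (hcd j).continuous]
    simp only [integral_const_mul]

/-- Integration by parts on all elements; the boundary terms are collected in the jumps. -/
theorem sum_integral_parts (X : Finset (E (n + 1)) → Fin (n + 1) → MvPolynomial (Fin (n + 1)) ℝ)
    {ψ : Finset (E (n + 1)) → E (n + 1) → ℝ} (hψ : ∀ K, ContDiff ℝ 1 (ψ K)) :
    ∑ K ∈ T.elements, ∫ x in hull K, ∑ j, polyEval (X K j) x * partialDeriv j (ψ K) x =
      -(∑ K ∈ T.elements, ∫ x in hull K,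
          polyEval (∑ j, MvPolynomial.pderiv j (X K j)) x * ψ K x) +
      ∑ F ∈ T.sides, ∫ x in hull F,
        T.jump (fun K x => (∑ j, polyEval (X K j) x * T.normal F j) * ψ K x) F x
          ∂(Measure.euclideanHausdorffMeasure n) := by
  rw [Finset.sum_congr rfl fun K hK => T.integral_element_parts hK (X K) (hψ K),
    Finset.sum_add_distrib, Finset.sum_neg_distrib,
    T.sum_elements_erase (by omega) (fun K F => T.sideSign K F * ∫ x in hull F,
        (∑ j, polyEval (X K j) x * T.normal F j) * ψ K x
          ∂(Measure.euclideanHausdorffMeasure n))]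
  congr 1
  refine Finset.sum_congr rfl fun F hF => ?_
  simp only [← integral_const_mul]
  rw [← T.integral_side_sum hF]
  · congr 1
    funext x
    exact T.sum_sideSign hF (fun K x => (∑ j, polyEval (X K j) x * T.normal F j) * ψ K x) x
  · intro K _
    refine continuous_const.mul (Continuous.mul ?_ (hψ K).continuous)
    exact continuous_finsetSum _ fun j _ => (continuous_polyEval _).mul continuous_const

theorem eq_zero_of_isBoundary (hopen : IsOpen Ω) {φ : E (n + 1) → ℝ} (hφ : IsTestFunction Ω φ)
    {F : Finset (E (n + 1))} (hF : T.IsBoundary F) {x : E (n + 1)} (hx : x ∈ hull F) : φ x = 0 := by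
  by_contra h
  have h1 : x ∈ Ω := hφ.2.2 (subset_tsupport φ h)
  have h2 := (hF hx).2
  rw [hopen.interior_eq] at h2
  exact h2 h1

/-- A piecewise polynomial field whose normal component is continuous across the interior sides
has a weak divergence, which is computed element by element. -/
theorem integral_weak_div (hopen : IsOpen Ω) (hreg : interior (closure Ω) = Ω)
    {X : Finset (E (n + 1)) → Fin (n + 1) → MvPolynomial (Fin (n + 1)) ℝ}
    (hX : ∀ F ∈ T.sides, ¬ T.IsBoundary F → ∀ x ∈ hull F,
      T.jump (fun K x => ∑ j, polyEval (X K j) x * T.normal F j) F x = 0)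
    {f : Fin (n + 1) → E (n + 1) → ℝ} (hf : ∀ j, T.Agrees (f j) (fun K => polyEval (X K j)))
    {g : E (n + 1) → ℝ}
    (hg : T.Agrees g (fun K => polyEval (∑ j, MvPolynomial.pderiv j (X K j))))
    {φ : E (n + 1) → ℝ} (hφ : IsTestFunction Ω φ) :
    ∫ x in Ω, ∑ j, f j x * partialDeriv j φ x = -∫ x in Ω, g x * φ x := by
  have hφ1 : ContDiff ℝ 1 φ := hφ.1.of_le (by simp)
  have h1 := T.sum_integral_parts X (ψ := fun _ => φ) fun _ => hφ1
  have h2 : ∑ F ∈ T.sides, ∫ x in hull F,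
        T.jump (fun K x => (∑ j, polyEval (X K j) x * T.normal F j) * φ x) F x
          ∂(Measure.euclideanHausdorffMeasure n) = 0 := by
    refine Finset.sum_eq_zero fun F hF => ?_
    rw [← integral_zero (E (n + 1)) ℝ (μ := (Measure.euclideanHausdorffMeasure n).restrict (hull F))]
    refine setIntegral_congr_fun (measurableSet_hull F) fun x hx => ?_
    simp only [T.jump_mul_right]
    by_cases hb : T.IsBoundary F
    · rw [T.eq_zero_of_isBoundary hopen hφ hb hx, mul_zero]
    · rw [hX F hF hb x hx, zero_mul]
  rw [h2, add_zero] at h1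
  rw [hg.integral_mul (fun K _ => continuous_polyEval _) (T.agrees_self φ)
    (fun _ _ => hφ1.continuous) (by omega) hreg, ← h1]
  have h3 : T.Agrees (fun x => ∑ j, f j x * partialDeriv j φ x)
      (fun K x => ∑ j, polyEval (X K j) x * partialDeriv j φ x) := by
    intro K hK
    have := fun j => hf j K hK
    filter_upwards [ae_all_iff.2 this] with x hx
    exact Finset.sum_congr rfl fun j _ => by rw [hx j]
  have h4 := h3.integral_mul (w := fun _ => 1) (z := fun _ _ => 1) (fun K _ => continuous_finsetSum _ fun j _ =>
    (continuous_polyEval _).mul (continuous_partialDeriv j hφ1)) (T.agrees_self _)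
    (fun _ _ => continuous_const) (by omega) hreg
  simpa using h4

end Triangulation

namespace Triangulation

/-! ### The weak `divDiv` of the discrete tensors -/

section Agree

variable {d : ℕ} {Ω : Set (E d)} {T : Triangulation Ω}

theorem openHull_subset_of_mem (hreg : interior (closure Ω) = Ω) {K : Finset (E d)}
    (hK : K ∈ T.elements) : openHull K ⊆ Ω :=
  (interior_maximal ((isSimplex hK).openHull_subset.trans (T.hull_subset_closure hK))
    (isOpen_openHull K)).trans hreg.subset

theorem Agrees.integrableOn {f : E d → ℝ} {u : Finset (E d) → E d → ℝ} (h : T.Agrees f u)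
    (hu : ∀ K ∈ T.elements, Continuous (u K)) (hd : 1 ≤ d) (hreg : interior (closure Ω) = Ω) :
    IntegrableOn f Ω := by
  rw [← integrableOn_congr_set_ae (T.ae_eq_iUnion_openHull hd hreg)]
  refine integrableOn_finset_iUnion.2 fun K hK => ?_
  refine IntegrableOn.mono_set ?_ (isSimplex hK).openHull_subset
  have h1 : IntegrableOn (u K) (hull K) :=
    (hu K hK).continuousOn.integrableOn_compact (isCompact_hull K)
  exact h1.congr (Filter.EventuallyEq.symm (h K hK))

theorem Agrees.mul {f w : E d → ℝ} {u z : Finset (E d) → E d → ℝ} (h : T.Agrees f u)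
    (h' : T.Agrees w z) : T.Agrees (fun x => f x * w x) (fun K x => u K x * z K x) := by
  intro K hK
  filter_upwards [h K hK, h' K hK] with x h1 h2
  rw [h1, h2]

theorem agrees_localPoly {f : E d → ℝ} {m : ℕ} (hf : ∀ K ∈ T.elements, IsPolyOn K m f) :
    T.Agrees f (fun K => polyEval (localPoly K f)) := by
  intro K hK
  obtain ⟨p, -, hp⟩ := hf K hK
  simp only [localPoly_eq (isSimplex hK).interior_nonempty hp]
  exact hp

theorem isPolyOn_of_mem_USpace (hd : 1 ≤ d) (hreg : interior (closure Ω) = Ω) {k : ℕ}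
    {τ : E d → Matrix (Fin d) (Fin d) ℝ} (hτ : τ ∈ T.USpace k) {K : Finset (E d)}
    (hK : K ∈ T.elements) (i j : Fin d) : IsPolyOn K k (fun x => τ x i j) := by
  obtain ⟨-, τc, τb, hsum, -, hc, hb⟩ := hτ
  obtain ⟨p, hp, hpa⟩ := hc.2 K hK i j
  obtain ⟨q, hq, hqa⟩ := hb.1.2 K hK i j
  refine ⟨p + q, (MvPolynomial.totalDegree_add _ _).trans (max_le hp hq), ?_⟩
  have h1 : ∀ᵐ x ∂(volume.restrict (hull K)), τ x = τc x + τb x := by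
    rw [← Measure.restrict_congr_set ((isSimplex hK).openHull_ae_eq hd)]
    exact ae_mono (Measure.restrict_mono (openHull_subset_of_mem hreg hK) le_rfl) hsum
  filter_upwards [h1, hpa, hqa] with x h2 h3 h4
  rw [h2, Matrix.add_apply, h3, h4]
  simp [polyEval]

end Agree

variable {n : ℕ} {Ω : Set (E (n + 1))} {T : Triangulation Ω}

/-- A weak divergence of a piecewise polynomial field is given by the classical one inside each
element. -/
theorem agrees_weak_div (hreg : interior (closure Ω) = Ω)
    {X : Finset (E (n + 1)) → Fin (n + 1) → MvPolynomial (Fin (n + 1)) ℝ}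
    {f : Fin (n + 1) → E (n + 1) → ℝ} (hf : ∀ j, T.Agrees (f j) (fun K => polyEval (X K j)))
    {w : E (n + 1) → ℝ} (hw : InL2 Ω w)
    (hweak : ∀ φ : E (n + 1) → ℝ, IsTestFunction Ω φ →
      ∫ x in Ω, ∑ j, f j x * partialDeriv j φ x = -∫ x in Ω, w x * φ x) :
    T.Agrees w (fun K => polyEval (∑ j, MvPolynomial.pderiv j (X K j))) := by
  intro K hK
  have hS := isSimplex hK
  set q := ∑ j, MvPolynomial.pderiv j (X K j) with hq
  have hsub : openHull K ⊆ Ω := openHull_subset_of_mem hreg hK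
  have hfin : volume (openHull K) < ⊤ :=
    (measure_mono hS.openHull_subset).trans_lt (isCompact_hull K).measure_lt_top
  have hqint : IntegrableOn (fun x : E (n + 1) => polyEval q x) (openHull K) :=
    ((continuous_polyEval q).continuousOn.integrableOn_compact (isCompact_hull K)).mono_set
      hS.openHull_subset
  have hwint : IntegrableOn w (openHull K) := by
    have : IsFiniteMeasure (volume.restrict (openHull K)) :=
      ⟨by rw [Measure.restrict_apply_univ]; exact hfin⟩
    exact (MemLp.mono_measure (Measure.restrict_mono hsub le_rfl) hw).integrable (by norm_num)
  rw [← Measure.restrict_congr_set (hS.openHull_ae_eq (by omega)),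
    ae_restrict_iff' (isOpen_openHull K).measurableSet]
  have key := (isOpen_openHull K).ae_eq_zero_of_integral_contDiff_smul_eq_zero
    (μ := volume) (f := fun x => w x - polyEval q x) (hwint.sub hqint).locallyIntegrableOn ?_
  · filter_upwards [key] with x hx hxK
    exact sub_eq_zero.1 (hx hxK)
  intro φ hφ hcs hsupp
  have htest : IsTestFunction Ω φ := ⟨hφ, hcs, hsupp.trans hsub⟩
  have hφ1 : ContDiff ℝ 1 φ := hφ.of_le (by simp)
  have h0 : ∀ x, x ∉ openHull K → φ x = 0 := fun x hx => by
    by_contra h; exact hx (hsupp (subset_tsupport φ h))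
  have h0' : ∀ j x, x ∉ openHull K → partialDeriv j φ x = 0 := by
    intro j x hx
    by_contra h
    refine hx (hsupp (support_fderiv_subset ℝ (f := φ) ?_))
    intro h'
    exact h (by simp [partialDeriv, h'])
  -- all integrals reduce to the element `K`
  have hred : ∀ G : E (n + 1) → ℝ, (∀ x, x ∉ openHull K → G x = 0) →
      ∫ x in Ω, G x = ∫ x in openHull K, G x := fun G hG =>
    (setIntegral_eq_of_subset_of_ae_sdiff_eq_zero
      ((isOpen_biUnion fun K _ => isOpen_openHull K).measurableSet.nullMeasurableSet.congr
        (T.ae_eq_iUnion_openHull (by omega) hreg)) hsub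
      (Filter.Eventually.of_forall fun x hx => hG x hx.2))
  have h1 := hweak φ htest
  rw [hred _ fun x hx => by simp [h0' _ x hx], hred _ fun x hx => by simp [h0 x hx],
    setIntegral_congr_set (hS.openHull_ae_eq (by omega))] at h1
  have h2 := T.integral_element_parts hK (X K) hφ1
  have h3 : ∑ a ∈ K, T.sideSign K (K.erase a) * ∫ x in hull (K.erase a),
        (∑ j, polyEval (X K j) x * T.normal (K.erase a) j) * φ x
          ∂(Measure.euclideanHausdorffMeasure n) = 0 := by
    refine Finset.sum_eq_zero fun a ha => ?_
    have : ∫ x in hull (K.erase a), (∑ j, polyEval (X K j) x * T.normal (K.erase a) j) * φ x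
          ∂(Measure.euclideanHausdorffMeasure n) =
        ∫ x in hull (K.erase a), (0 : ℝ) ∂(Measure.euclideanHausdorffMeasure n) := by
      refine setIntegral_congr_fun (measurableSet_hull _) fun x hx => ?_
      have hxa := ((hS.mem_hull_iff_of_subset (Finset.erase_subset a K)).1 hx).2 a ha (by simp)
      simp only [h0 x fun hxo => (hxo a ha).ne' hxa, mul_zero]
    rw [this, integral_zero, mul_zero]
  have h4 : ∫ x in hull K, ∑ j, f j x * partialDeriv j φ x =
      ∫ x in hull K, ∑ j, polyEval (X K j) x * partialDeriv j φ x := by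
    refine integral_congr_ae ?_
    filter_upwards [ae_all_iff.2 fun j => hf j K hK] with x hx
    exact Finset.sum_congr rfl fun j _ => by rw [hx j]
  rw [h4, h2, h3, add_zero, neg_inj, ← setIntegral_congr_set (hS.openHull_ae_eq (by omega))] at h1
  have hb : ∀ {G : E (n + 1) → ℝ}, IntegrableOn G (openHull K) →
      IntegrableOn (fun x => G x * φ x) (openHull K) := by
    intro G hG
    obtain ⟨C, hC⟩ := hcs.exists_bound_of_continuous hφ.continuous
    exact hG.mul_bdd (c := C) hφ.continuous.aestronglyMeasurable.restrict
      (Filter.Eventually.of_forall hC)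
  have h5 : ∫ x, φ x • (w x - polyEval q x) = ∫ x in openHull K, φ x • (w x - polyEval q x) :=
    (setIntegral_eq_integral_of_forall_compl_eq_zero fun x hx => by simp [h0 x hx]).symm
  rw [h5]
  have h6 : ∀ x, φ x • (w x - polyEval q x) = w x * φ x - polyEval q x * φ x := by
    intro x; rw [smul_eq_mul]; ring
  simp only [h6]
  rw [integral_sub (hb hwint) (hb hqint), h1, sub_self]

theorem exists_hasWeakDivDiv (hopen : IsOpen Ω) (hreg : interior (closure Ω) = Ω) {k : ℕ}
    {τ : E (n + 1) → Matrix (Fin (n + 1)) (Fin (n + 1)) ℝ} (hτ : τ ∈ T.SigmaH k) :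
    HasWeakDivDiv Ω τ (T.glue fun K => polyEval (∑ i, MvPolynomial.pderiv i
      (∑ j, MvPolynomial.pderiv j (localMat τ K i j)))) := by
  obtain ⟨hU, -, hjump⟩ := hτ
  refine ⟨T.inL2_glue fun K _ => continuous_polyEval _, fun φ hφ => ?_⟩
  have hL : ∀ i j, T.Agrees (fun x => τ x i j) (fun K => polyEval (localMat τ K i j)) :=
    fun i j => agrees_localPoly fun K hK => isPolyOn_of_mem_USpace (by omega) hreg hU hK i j
  obtain ⟨⟨⟨-, hsym⟩, w, hw⟩, -⟩ := hU
  have hwA : ∀ i, T.Agrees (w i)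
      (fun K => polyEval (∑ j, MvPolynomial.pderiv j (localMat τ K i j))) := fun i =>
    agrees_weak_div hreg (f := fun j x => τ x i j) (hL i) (hw i).1 (hw i).2
  have hjump' : ∀ F ∈ T.sides, ¬ T.IsBoundary F → ∀ x ∈ hull F, T.jump (fun K x => ∑ i,
      polyEval (∑ j, MvPolynomial.pderiv j (localMat τ K i j)) x * T.normal F i) F x = 0 := by
    intro F hF _ x hx
    rw [← hjump F hF x hx]
    congr 1
    funext K y
    simp only [divNormal, polyEval, map_sum]
  have h1 := T.integral_weak_div hopen hreg hjump' hwA (T.agrees_glue (by omega) _) hφ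
  have hφi : ∀ i, IsTestFunction Ω (partialDeriv i φ) := fun i => hφ.partialDeriv i
  have hc : ∀ i, Continuous (partialDeriv i φ) := fun i => (hφi i).1.continuous
  have hcc : ∀ i j, Continuous (partialDeriv i (partialDeriv j φ)) :=
    fun i j => ((hφi j).partialDeriv i).1.continuous
  have h2 : ∫ x in Ω, ∑ i, w i x * partialDeriv i φ x =
      ∑ i, ∫ x in Ω, w i x * partialDeriv i φ x :=
    integral_finsetSum _ fun i _ => ((hwA i).mul (T.agrees_self (partialDeriv i φ))).integrableOn
      (fun K _ => (continuous_polyEval _).mul (hc i)) (by omega) hreg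
  have h3 : ∀ i, ∫ x in Ω, w i x * partialDeriv i φ x =
      -∫ x in Ω, ∑ j, τ x i j * partialDeriv j (partialDeriv i φ) x := fun i => by
    rw [(hw i).2 _ (hφi i), neg_neg]
  have h4 : ∀ i j, IntegrableOn (fun x => τ x i j * partialDeriv j (partialDeriv i φ) x) Ω :=
    fun i j => ((hL i j).mul (T.agrees_self _)).integrableOn
      (fun K _ => (continuous_polyEval _).mul (hcc j i)) (by omega) hreg
  have h5 : ∫ x in Ω, ∑ i, ∑ j, τ x i j * partialDeriv i (partialDeriv j φ) x =
      ∫ x in Ω, ∑ i, ∑ j, τ x i j * partialDeriv j (partialDeriv i φ) x := by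
    refine integral_congr_ae ?_
    filter_upwards [hsym] with x hx
    rw [Finset.sum_comm]
    exact Finset.sum_congr rfl fun i _ => Finset.sum_congr rfl fun j _ => by rw [hx.apply i j]
  rw [h5, integral_finsetSum _ fun i _ => integrable_finsetSum _ fun j _ => h4 i j,
    ← neg_inj, ← h1, h2, ← Finset.sum_neg_distrib]
  exact (Finset.sum_congr rfl fun i _ => h3 i).symm

end Triangulation

/-! ### The coefficient norm of a polynomial -/

section CoeffNorm

variable {σ υ : Type*}

/-- The sum of the absolute values of the coefficients of a polynomial. -/
noncomputable def coeffNorm (W : MvPolynomial σ ℝ) : ℝ := ∑ α ∈ W.support, |W.coeff α|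

theorem coeffNorm_eq_sum {W : MvPolynomial σ ℝ} {s : Finset (σ →₀ ℕ)} (h : W.support ⊆ s) :
    coeffNorm W = ∑ α ∈ s, |W.coeff α| := by
  refine Finset.sum_subset h fun α _ hα => ?_
  rw [MvPolynomial.notMem_support_iff.1 hα, abs_zero]

theorem coeffNorm_nonneg (W : MvPolynomial σ ℝ) : 0 ≤ coeffNorm W :=
  Finset.sum_nonneg fun _ _ => abs_nonneg _

@[simp] theorem coeffNorm_zero : coeffNorm (0 : MvPolynomial σ ℝ) = 0 := by simp [coeffNorm]

theorem coeffNorm_add_le (W V : MvPolynomial σ ℝ) :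
    coeffNorm (W + V) ≤ coeffNorm W + coeffNorm V := by
  classical
  rw [coeffNorm_eq_sum (MvPolynomial.support_add (p := W) (q := V)),
    coeffNorm_eq_sum (W := W) (s := W.support ∪ V.support) Finset.subset_union_left,
    coeffNorm_eq_sum (W := V) (s := W.support ∪ V.support) Finset.subset_union_right,
    ← Finset.sum_add_distrib]
  exact Finset.sum_le_sum fun α _ => by rw [MvPolynomial.coeff_add]; exact abs_add_le _ _

theorem coeffNorm_sum_le {ι : Type*} (s : Finset ι) (W : ι → MvPolynomial σ ℝ) :
    coeffNorm (∑ i ∈ s, W i) ≤ ∑ i ∈ s, coeffNorm (W i) := by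
  classical
  induction s using Finset.induction_on with
  | empty => simp
  | insert a s ha ih =>
    rw [Finset.sum_insert ha, Finset.sum_insert ha]
    exact (coeffNorm_add_le _ _).trans (by gcongr)

theorem coeffNorm_monomial (α : σ →₀ ℕ) (c : ℝ) :
    coeffNorm (MvPolynomial.monomial α c) = |c| := by
  classical
  rw [coeffNorm_eq_sum (s := {α}) MvPolynomial.support_monomial_subset]
  simp

/-- A linear map is bounded for the coefficient norm if it is bounded on monomials. -/
theorem coeffNorm_map_le (L : MvPolynomial σ ℝ →ₗ[ℝ] MvPolynomial υ ℝ) {C : ℝ}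
    {W : MvPolynomial σ ℝ}
    (h : ∀ α ∈ W.support, ∀ c, coeffNorm (L (MvPolynomial.monomial α c)) ≤ C * |c|) :
    coeffNorm (L W) ≤ C * coeffNorm W := by
  conv_lhs => rw [MvPolynomial.as_sum W, map_sum]
  refine (coeffNorm_sum_le _ _).trans ?_
  rw [coeffNorm, Finset.mul_sum]
  exact Finset.sum_le_sum fun α hα => h α hα _

theorem coeffNorm_mul_le (W V : MvPolynomial σ ℝ) :
    coeffNorm (W * V) ≤ coeffNorm W * coeffNorm V := by
  refine coeffNorm_map_le (LinearMap.mulLeft ℝ W) fun α _ c => ?_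
  rw [LinearMap.mulLeft_apply, mul_comm, mul_comm (coeffNorm W)]
  refine coeffNorm_map_le (LinearMap.mulLeft ℝ (MvPolynomial.monomial α c)) fun β _ e => ?_
  rw [LinearMap.mulLeft_apply, MvPolynomial.monomial_mul, coeffNorm_monomial, abs_mul]

theorem coeffNorm_C_mul_le (c : ℝ) (W : MvPolynomial σ ℝ) :
    coeffNorm (MvPolynomial.C c * W) ≤ |c| * coeffNorm W := by
  refine (coeffNorm_mul_le _ _).trans_eq ?_
  rw [← MvPolynomial.monomial_zero', coeffNorm_monomial]

theorem coeffNorm_neg (W : MvPolynomial σ ℝ) : coeffNorm (-W) = coeffNorm W := by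
  simp [coeffNorm, MvPolynomial.support_neg]

theorem coeffNorm_prod_X_le (s : Finset σ) :
    coeffNorm (∏ i ∈ s, (MvPolynomial.X i : MvPolynomial σ ℝ)) ≤ 1 := by
  classical
  induction s using Finset.induction_on with
  | empty =>
    rw [Finset.prod_empty, ← MvPolynomial.C_1, ← MvPolynomial.monomial_zero', coeffNorm_monomial]
    simp
  | insert a s ha ih =>
    rw [Finset.prod_insert ha]
    refine (coeffNorm_mul_le _ _).trans ?_
    rw [MvPolynomial.X, coeffNorm_monomial]
    simpa using ih

theorem coeffNorm_rename_le (f : σ → υ) (W : MvPolynomial σ ℝ) :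
    coeffNorm (MvPolynomial.rename f W) ≤ coeffNorm W := by
  have := coeffNorm_map_le (C := 1) (W := W) (MvPolynomial.rename (R := ℝ) f).toLinearMap
    fun α _ c => by
      rw [AlgHom.toLinearMap_apply, MvPolynomial.rename_monomial, coeffNorm_monomial, one_mul]
  simpa using this

theorem coeffNorm_pderiv_le {m : ℕ} {W : MvPolynomial σ ℝ} (hW : W.IsHomogeneous m) (i : σ) :
    coeffNorm (MvPolynomial.pderiv i W) ≤ m * coeffNorm W := by
  refine coeffNorm_map_le (MvPolynomial.pderiv i).toLinearMap fun α hα c => ?_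
  have hdeg : α.degree = m := by
    by_contra h
    exact MvPolynomial.mem_support_iff.1 hα (hW.coeff_eq_zero h)
  rw [show (MvPolynomial.pderiv i).toLinearMap (MvPolynomial.monomial α c) =
    MvPolynomial.pderiv i (MvPolynomial.monomial α c) from rfl, MvPolynomial.pderiv_monomial,
    coeffNorm_monomial, abs_mul, mul_comm, Nat.abs_cast]
  gcongr
  exact (Finsupp.le_degree i α).trans hdeg.le

theorem abs_eval_le {l : σ → ℝ} (hl : ∀ i, |l i| ≤ 1) (W : MvPolynomial σ ℝ) :
    |MvPolynomial.eval l W| ≤ coeffNorm W := by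
  rw [MvPolynomial.eval_eq, coeffNorm]
  refine (Finset.abs_sum_le_sum_abs _ _).trans (Finset.sum_le_sum fun α _ => ?_)
  rw [abs_mul]
  refine mul_le_of_le_one_right (abs_nonneg _) ?_
  rw [Finset.abs_prod]
  refine Finset.prod_le_one (fun _ _ => abs_nonneg _) fun i _ => ?_
  rw [abs_pow]
  exact pow_le_one₀ (abs_nonneg _) (hl i)

end CoeffNorm

/-! ### Equivalence of norms on homogeneous polynomials -/

/-- A continuous positive definite function that is homogeneous of degree two dominates the
square of the norm. -/
theorem exists_norm_sq_le {ι : Type*} [Fintype ι] {Q : (ι → ℝ) → ℝ} (hc : Continuous Q)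
    (hQ : ∀ (t : ℝ) c, Q (t • c) = t ^ 2 * Q c) (hpos : ∀ c, c ≠ 0 → 0 < Q c) :
    ∃ C : ℝ, 0 < C ∧ ∀ c, ‖c‖ ^ 2 ≤ C * Q c := by
  have hQ0 : Q 0 = 0 := by simpa using hQ 0 0
  by_cases hne : (Metric.sphere (0 : ι → ℝ) 1).Nonempty
  · obtain ⟨c₀, hc₀, hmin⟩ := (isCompact_sphere (0 : ι → ℝ) 1).exists_isMinOn hne hc.continuousOn
    have h0 : c₀ ≠ 0 := by
      rintro rfl
      simp at hc₀
    refine ⟨(Q c₀)⁻¹, inv_pos.2 (hpos c₀ h0), fun c => ?_⟩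
    by_cases h : c = 0
    · simp [h, hQ0]
    · have hn : 0 < ‖c‖ := norm_pos_iff.2 h
      have h1 : Q c₀ ≤ Q (‖c‖⁻¹ • c) := hmin (by
        rw [mem_sphere_zero_iff_norm, norm_smul, norm_inv, norm_norm, inv_mul_cancel₀ hn.ne'])
      rw [hQ] at h1
      have h2 := hpos c₀ h0
      rw [inv_mul_eq_div, le_div_iff₀ h2]
      calc ‖c‖ ^ 2 * Q c₀ ≤ ‖c‖ ^ 2 * (‖c‖⁻¹ ^ 2 * Q c) := by gcongr
        _ = Q c := by field_simp
  · refine ⟨1, one_pos, fun c => ?_⟩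
    by_cases h : c = 0
    · simp [h, hQ0]
    · refine absurd ⟨‖c‖⁻¹ • c, ?_⟩ hne
      have hn : 0 < ‖c‖ := norm_pos_iff.2 h
      rw [mem_sphere_zero_iff_norm, norm_smul, norm_inv, norm_norm, inv_mul_cancel₀ hn.ne']

theorem finite_setOf_degree_eq (n m : ℕ) : {α : Fin n →₀ ℕ | α.degree = m}.Finite := by
  refine Set.Finite.subset (Set.finite_Iic (Finsupp.equivFunOnFinite.symm fun _ => m)) ?_
  intro α hα i
  simp only [Finsupp.equivFunOnFinite_symm_apply_apply]
  exact (Finsupp.le_degree i α).trans (le_of_eq hα)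

theorem continuous_eval {σ : Type*} [Finite σ] (W : MvPolynomial σ ℝ) :
    Continuous (fun l : σ → ℝ => MvPolynomial.eval l W) := MvPolynomial.continuous_eval W

/-- On homogeneous polynomials of fixed degree the coefficient norm is bounded by a weighted
`L²`-norm over the reference simplex.  The weight is the square of the bubble function, which is
below all the weights that occur on elements and sides. -/
theorem exists_coeffNorm_sq_le (n m : ℕ) : ∃ C : ℝ, 0 < C ∧
    ∀ W : MvPolynomial (Fin (n + 1)) ℝ, W.IsHomogeneous m →
      coeffNorm W ^ 2 ≤ C * refInt n (fun l => (∏ i, l i) ^ 2 * MvPolynomial.eval l W ^ 2) := by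
  classical
  set s := (finite_setOf_degree_eq (n + 1) m).toFinset with hs
  have hsdeg : ∀ α ∈ s, α.degree = m := fun α hα => by
    rw [hs, Set.Finite.mem_toFinset] at hα
    exact hα
  let P : (s → ℝ) → MvPolynomial (Fin (n + 1)) ℝ := fun c => ∑ α, MvPolynomial.monomial α.1 (c α)
  have hPe : ∀ c l, MvPolynomial.eval l (P c) = ∑ α : s, c α * ∏ i, l i ^ (α.1 i) := by
    intro c l
    simp [P, MvPolynomial.eval_monomial, Finsupp.prod_pow]
  have hPc : ∀ c (α : s), (P c).coeff α.1 = c α := by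
    intro c α
    simp only [P, MvPolynomial.coeff_sum, MvPolynomial.coeff_monomial]
    rw [Finset.sum_eq_single α]
    · simp
    · intro β _ hβ
      rw [if_neg fun h => hβ (Subtype.ext h)]
    · simp
  let I : s → s → ℝ := fun α β => refInt n (fun l =>
    (∏ i, l i) ^ 2 * ((∏ i, l i ^ (α.1 i)) * ∏ i, l i ^ (β.1 i)))
  let Q : (s → ℝ) → ℝ := fun c => refInt n (fun l =>
    (∏ i, l i) ^ 2 * MvPolynomial.eval l (P c) ^ 2)
  have hQI : ∀ c, Q c = ∑ α, ∑ β, c α * c β * I α β := by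
    intro c
    have h1 : ∀ l : Fin (n + 1) → ℝ, (∏ i, l i) ^ 2 * MvPolynomial.eval l (P c) ^ 2 =
        ∑ α : s, ∑ β : s, c α * c β *
          ((∏ i, l i) ^ 2 * ((∏ i, l i ^ (α.1 i)) * ∏ i, l i ^ (β.1 i))) := by
      intro l
      rw [hPe, pow_two (∑ α, _), Finset.sum_mul_sum, Finset.mul_sum]
      refine Finset.sum_congr rfl fun α _ => ?_
      rw [Finset.mul_sum]
      exact Finset.sum_congr rfl fun β _ => by ring
    simp only [Q, h1, I, refInt]
    have hcont : ∀ α β : s, Continuous (fun l : Fin (n + 1) → ℝ => c α * c β *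
          ((∏ i, l i) ^ 2 * ((∏ i, l i ^ (α.1 i)) * ∏ i, l i ^ (β.1 i)))) := fun α β => by fun_prop
    rw [integral_finsetSum _ fun α _ => integrable_finsetSum _ fun β _ =>
      integrableOn_refSimplex (hcont α β)]
    refine Finset.sum_congr rfl fun α _ => ?_
    rw [integral_finsetSum _ fun β _ => integrableOn_refSimplex (hcont α β)]
    exact Finset.sum_congr rfl fun β _ => integral_const_mul _ _
  have hQc : Continuous Q := by
    rw [show Q = fun c => ∑ α, ∑ β, c α * c β * I α β from funext hQI]
    fun_prop
  have hQh : ∀ (t : ℝ) c, Q (t • c) = t ^ 2 * Q c := by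
    intro t c
    simp only [hQI, Finset.mul_sum, Pi.smul_apply, smul_eq_mul]
    exact Finset.sum_congr rfl fun α _ => Finset.sum_congr rfl fun β _ => by ring
  have hQ0 : ∀ c, 0 ≤ Q c := fun c =>
    setIntegral_nonneg (measurableSet_refSimplex n) fun y _ => by positivity
  have hPh : ∀ c, (P c).IsHomogeneous m := fun c => by
    refine MvPolynomial.IsHomogeneous.sum _ _ _ fun α _ => MvPolynomial.isHomogeneous_monomial _ ?_
    exact hsdeg α.1 α.2
  have hQpos : ∀ c, c ≠ 0 → 0 < Q c := by
    intro c hc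
    refine lt_of_le_of_ne (hQ0 c) fun h => hc ?_
    have hcontG : Continuous (fun l : Fin (n + 1) → ℝ =>
        (∏ i, l i) ^ 2 * MvPolynomial.eval l (P c) ^ 2) :=
      (by fun_prop : Continuous fun l : Fin (n + 1) → ℝ => (∏ i, l i) ^ 2).mul
        ((continuous_eval (P c)).pow 2)
    -- by homogeneity the polynomial vanishes on the open positive orthant
    have hz : P c = 0 := by
      refine MvPolynomial.funext_set (fun _ => Ioi (0 : ℝ)) (fun _ => Ioi_infinite 0)
        fun l hl => ?_
      have hl' : ∀ i, 0 < l i := fun i => hl i (mem_univ i)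
      have hsum : 0 < ∑ i, l i := Finset.sum_pos (fun i _ => hl' i) Finset.univ_nonempty
      have h1 := eq_zero_of_refInt_eq_zero hcontG (fun l => by positivity) h.symm
        (l := fun i => (∑ j, l j)⁻¹ * l i) (fun i => mul_pos (inv_pos.2 hsum) (hl' i))
        (by rw [← Finset.mul_sum, inv_mul_cancel₀ hsum.ne'])
      have hprod : (∏ i, (∑ j, l j)⁻¹ * l i) ^ 2 ≠ 0 :=
        pow_ne_zero 2 (Finset.prod_pos fun i _ => mul_pos (inv_pos.2 hsum) (hl' i)).ne'
      have h2 : MvPolynomial.eval (fun i => (∑ j, l j)⁻¹ * l i) (P c) = 0 :=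
        pow_eq_zero_iff two_ne_zero |>.1 ((mul_eq_zero.1 h1).resolve_left hprod)
      have h3 : MvPolynomial.eval (fun i => (∑ j, l j)⁻¹ * l i) (P c) =
          (∑ j, l j)⁻¹ ^ m * MvPolynomial.eval l (P c) := by
        rw [hPe, hPe, Finset.mul_sum]
        refine Finset.sum_congr rfl fun α _ => ?_
        have hα : α.1.degree = m := hsdeg α.1 α.2
        simp only [mul_pow, Finset.prod_mul_distrib, Finset.prod_pow_eq_pow_sum]
        rw [← Finsupp.degree_eq_sum, hα]
        ring
      rw [h3] at h2
      rw [map_zero]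
      exact (mul_eq_zero.1 h2).resolve_left (pow_ne_zero _ (inv_ne_zero hsum.ne'))
    funext α
    rw [← hPc c α, hz]
    simp
  obtain ⟨C, hC, hle⟩ := exists_norm_sq_le hQc hQh hQpos
  refine ⟨(s.card : ℝ) ^ 2 * C + 1, by positivity, fun W hW => ?_⟩
  set c : s → ℝ := fun α => W.coeff α.1 with hcdef
  have hsupp : W.support ⊆ s := by
    intro α hα
    simp only [hs, Set.Finite.mem_toFinset, mem_ofPred_eq]
    by_contra h
    exact MvPolynomial.mem_support_iff.1 hα (hW.coeff_eq_zero h)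
  have hWP : P c = W := by
    ext α
    by_cases hα : α ∈ s
    · exact hPc c ⟨α, hα⟩
    · rw [MvPolynomial.notMem_support_iff.1 fun h => hα (hsupp h)]
      rw [(hPh c).coeff_eq_zero]
      simpa [hs] using hα
  have h1 : coeffNorm W ≤ s.card * ‖c‖ := by
    rw [coeffNorm_eq_sum hsupp, ← Finset.sum_coe_sort, ← nsmul_eq_mul, ← Fintype.card_coe]
    exact Finset.sum_le_card_nsmul _ _ _ fun α _ => norm_le_pi_norm c α
  have h2 := hle c
  have h3 : Q c = refInt n (fun l => (∏ i, l i) ^ 2 * MvPolynomial.eval l W ^ 2) := by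
    simp only [Q, hWP]
  rw [← h3]
  have h4 := hQ0 c
  calc coeffNorm W ^ 2 ≤ (s.card * ‖c‖) ^ 2 := by
        gcongr
        exact coeffNorm_nonneg W
    _ = (s.card : ℝ) ^ 2 * ‖c‖ ^ 2 := by ring
    _ ≤ (s.card : ℝ) ^ 2 * (C * Q c) := by gcongr
    _ ≤ ((s.card : ℝ) ^ 2 * C + 1) * Q c := by nlinarith

/-! ### Polynomials in barycentric variables -/

theorem totalDegree_aeval_le {σ : Type*} {d : ℕ} (W : MvPolynomial σ ℝ)
    {f : σ → MvPolynomial (Fin d) ℝ} (hf : ∀ i, (f i).totalDegree ≤ 1) :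
    (MvPolynomial.aeval f W).totalDegree ≤ W.totalDegree := by
  rw [MvPolynomial.aeval_def, MvPolynomial.eval₂_eq]
  refine MvPolynomial.totalDegree_finsetSum_le fun α hα => ?_
  refine (MvPolynomial.totalDegree_mul _ _).trans ?_
  rw [MvPolynomial.algebraMap_eq, MvPolynomial.totalDegree_C, zero_add]
  refine (MvPolynomial.totalDegree_finsetProd _ _).trans ?_
  refine le_trans ?_ (MvPolynomial.le_totalDegree hα)
  refine Finset.sum_le_sum fun i _ => (MvPolynomial.totalDegree_pow _ _).trans ?_
  calc α i * (f i).totalDegree ≤ α i * 1 := by gcongr; exact hf i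
    _ = α i := mul_one _

/-- A polynomial of degree at most `m` is a homogeneous polynomial of degree `m` in barycentric
coordinates. -/
theorem exists_homogeneous {d : ℕ} {ι : Type*} [Fintype ι] (p : ι → E d) {m : ℕ}
    {q : MvPolynomial (Fin d) ℝ} (hq : q.totalDegree ≤ m) :
    ∃ W : MvPolynomial ι ℝ, W.IsHomogeneous m ∧
      ∀ l : ι → ℝ, ∑ i, l i = 1 → polyEval q (∑ i, l i • p i) = MvPolynomial.eval l W := by
  let L : Fin d → MvPolynomial ι ℝ := fun j => ∑ i, MvPolynomial.C (p i j) * MvPolynomial.X i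
  let S : MvPolynomial ι ℝ := ∑ i, MvPolynomial.X i
  have hS : S.IsHomogeneous 1 :=
    MvPolynomial.IsHomogeneous.sum _ _ _ fun i _ => MvPolynomial.isHomogeneous_X _ i
  have hL : ∀ j, (L j).IsHomogeneous 1 := fun j =>
    MvPolynomial.IsHomogeneous.sum _ _ _ fun i _ => MvPolynomial.isHomogeneous_C_mul_X _ i
  refine ⟨∑ α ∈ q.support, MvPolynomial.C (q.coeff α) * (∏ j, L j ^ α j) * S ^ (m - α.degree),
    ?_, ?_⟩
  · refine MvPolynomial.IsHomogeneous.sum _ _ _ fun α hα => ?_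
    have hdeg : α.degree ≤ m := by
      refine le_trans ?_ hq
      exact MvPolynomial.le_totalDegree hα
    have h1 : (∏ j, L j ^ α j).IsHomogeneous α.degree := by
      rw [Finsupp.degree_eq_sum]
      refine MvPolynomial.IsHomogeneous.prod _ _ _ fun j _ => ?_
      simpa using (hL j).pow (α j)
    have h2 := (h1.C_mul (q.coeff α)).mul (hS.pow (m - α.degree))
    rwa [show α.degree + 1 * (m - α.degree) = m by omega] at h2
  · intro l hl
    have hLe : ∀ j, MvPolynomial.eval l (L j) = (∑ i, l i • p i) j := by
      intro j
      simp only [L, map_sum, map_mul, MvPolynomial.eval_C, MvPolynomial.eval_X]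
      simp [mul_comm]
    have hSe : MvPolynomial.eval l S = 1 := by simp [S, hl]
    rw [polyEval, MvPolynomial.eval_eq']
    simp only [map_sum, map_mul, map_prod, map_pow, MvPolynomial.eval_C, hLe, hSe, one_pow, mul_one]

/-! ### Prescribing the normal component of the divergence of an edge field -/

section EdgeSystem

variable {σ : Type*}

theorem eval_monomial_eq_prod {K : Finset σ} {α : σ →₀ ℕ} (hα : α.support ⊆ K) (l : σ → ℝ)
    (x : ℝ) : MvPolynomial.eval l (MvPolynomial.monomial α x) = x * ∏ i ∈ K, l i ^ α i := by
  rw [MvPolynomial.eval_monomial, Finsupp.prod_of_support_subset _ hα _ (fun i _ => pow_zero _)]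

/-- The edge system for a single monomial `λ^α` prescribed on the face opposite to the vertex `c`.
If some exponent `α j` is at least two, the edge `cj` alone suffices: its contribution to the face
opposite to `j` vanishes.  If `λ^α` is squarefree, all edges between the vertices of
`supp α ∪ {c}` are used, and the coefficients on them solve the linear system
`∑_{j ≠ i} (aᵢ + aⱼ) = δ_{ic}`. -/
theorem exists_edge_monomial [DecidableEq σ] {K : Finset σ} {m : ℕ} {c : σ} (hc : c ∈ K)
    {α : σ →₀ ℕ} (hα : α.degree = m + 2) (hαK : α.support ⊆ K) (x : ℝ) :
    ∃ p : σ → σ → MvPolynomial σ ℝ, (∀ a b, p a b = p b a) ∧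
      (∀ a b, (p a b).totalDegree ≤ m + 1) ∧ (∀ a b, coeffNorm (p a b) ≤ 2 * |x|) ∧
      ∀ e ∈ K, ∀ l : σ → ℝ, l e = 0 → ∑ b ∈ K.erase e, l b * MvPolynomial.eval l (p e b) =
        if e = c then MvPolynomial.eval l (MvPolynomial.monomial α x) else 0 := by
  by_cases hαc : α c = 0
  swap
  · refine ⟨fun _ _ => 0, fun _ _ => rfl, fun _ _ => by simp, fun _ _ => by simp, ?_⟩
    intro e he l hl
    split_ifs with h
    · subst h
      rw [eval_monomial_eq_prod hαK, Finset.prod_eq_zero he (by rw [hl, zero_pow hαc]), mul_zero]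
      simp
    · simp
  by_cases hj : ∃ j, 2 ≤ α j
  · obtain ⟨j, hj⟩ := hj
    have hjc : j ≠ c := by rintro rfl; omega
    have hjK : j ∈ K := hαK (by rw [Finsupp.mem_support_iff]; omega)
    set β : σ →₀ ℕ := α - Finsupp.single j 1 with hβ
    have hαβ : α = β + Finsupp.single j 1 := by
      ext i
      simp only [hβ, Finsupp.add_apply, Finsupp.tsub_apply, Finsupp.single_apply]
      split_ifs with h
      · subst h; omega
      · omega
    have hβj : β j ≠ 0 := by
      simp only [hβ, Finsupp.tsub_apply, Finsupp.single_eq_same]; omega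
    have hβd : β.degree = m + 1 := by
      have : α.degree = β.degree + 1 := by
        conv_lhs => rw [hαβ]
        rw [map_add, Finsupp.degree_single]
      omega
    have hβK : β.support ⊆ K := by
      refine subset_trans ?_ hαK
      intro i hi
      rw [Finsupp.mem_support_iff] at hi ⊢
      rw [hαβ, Finsupp.add_apply]
      omega
    refine ⟨fun a b => if (a = c ∧ b = j) ∨ (a = j ∧ b = c) then MvPolynomial.monomial β x else 0,
      ?_, ?_, ?_, ?_⟩
    · intro a b
      have : ((a = c ∧ b = j) ∨ (a = j ∧ b = c)) = ((b = c ∧ a = j) ∨ (b = j ∧ a = c)) :=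
        propext (by tauto)
      simp only [this]
    · intro a b
      beta_reduce
      split_ifs
      · refine (MvPolynomial.totalDegree_monomial_le _ _).trans ?_
        exact hβd.le
      · simp
    · intro a b
      beta_reduce
      split_ifs
      · rw [coeffNorm_monomial]; linarith [abs_nonneg x]
      · simp
    · intro e he l hl
      beta_reduce
      by_cases hec : e = c
      · subst hec
        rw [if_pos rfl, Finset.sum_eq_single j]
        · rw [if_pos (Or.inl ⟨rfl, rfl⟩)]
          conv_rhs => rw [hαβ]
          rw [MvPolynomial.monomial_add_single, map_mul, map_pow, MvPolynomial.eval_X, pow_one,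
            mul_comm]
        · intro b _ hbj
          rw [if_neg (by rintro (h | h); exacts [hbj h.2, hjc h.1.symm])]
          simp
        · intro h
          exact absurd (Finset.mem_erase.2 ⟨hjc, hjK⟩) h
      · rw [if_neg hec]
        refine Finset.sum_eq_zero fun b _ => ?_
        by_cases hej : e = j
        · subst hej
          split_ifs
          · rw [eval_monomial_eq_prod hβK, Finset.prod_eq_zero he (by rw [hl, zero_pow hβj])]
            ring
          · simp
        · rw [if_neg (by rintro (h | h); exacts [hec h.1, hej h.1])]
          simp
  · push Not at hj
    set S := α.support with hS
    have hα1 : ∀ i ∈ S, α i = 1 := by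
      intro i hi
      have := hj i
      have := Finsupp.mem_support_iff.1 hi
      omega
    have hcS : c ∉ S := by rw [hS, Finsupp.mem_support_iff]; simpa using hαc
    have hcard : S.card = m + 2 := by
      rw [← hα, Finsupp.degree, Finset.card_eq_sum_ones]
      exact (Finset.sum_congr rfl hα1).symm
    set T := insert c S with hT
    have hTK : T ⊆ K := Finset.insert_subset hc hαK
    have hTc : (T.card : ℝ) = m + 3 := by
      rw [hT, Finset.card_insert_of_notMem hcS, hcard]; push_cast; ring
    set s : ℝ := (2 * (m + 2))⁻¹ with hs
    set A : σ → ℝ := fun i => ((if i = c then 1 else 0) - s) / (m + 1) with hA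
    have hm : (0 : ℝ) < m + 1 := by positivity
    have hs0 : 0 < s := by positivity
    have hs1 : s ≤ 1 := by
      rw [hs]
      refine inv_le_one_of_one_le₀ ?_
      have : (0 : ℝ) ≤ m := by positivity
      linarith
    have hsumA : ∑ i ∈ T, A i = s := by
      simp only [hA]
      rw [← Finset.sum_div, Finset.sum_sub_distrib, Finset.sum_ite_eq' T c, if_pos (by simp [hT]),
        Finset.sum_const, nsmul_eq_mul, hTc, hs]
      field_simp
      ring
    have hAbd : ∀ i, |A i| ≤ 1 := by
      intro i
      simp only [hA]
      rw [abs_div, abs_of_pos hm, div_le_one hm]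
      have : (0 : ℝ) ≤ m := by positivity
      split_ifs <;> rw [abs_le] <;> constructor <;> linarith
    have hrow : ∀ i ∈ T, ∑ b ∈ T.erase i, (A i + A b) = if i = c then 1 else 0 := by
      intro i hi
      have h1 := Finset.add_sum_erase T A hi
      rw [hsumA] at h1
      have h2 : ((T.erase i).card : ℝ) = m + 2 := by
        have := Finset.card_erase_add_one hi
        have h3 : (((T.erase i).card + 1 : ℕ) : ℝ) = m + 3 := by rw [this, hTc]
        push_cast at h3
        linarith
      rw [Finset.sum_add_distrib, Finset.sum_const, nsmul_eq_mul, h2,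
        show ∑ b ∈ T.erase i, A b = s - A i by linarith]
      simp only [hA]
      field_simp
      ring
    refine ⟨fun a b => if a ≠ b ∧ a ∈ T ∧ b ∈ T then MvPolynomial.C ((A a + A b) * x) *
      ∏ i ∈ (T.erase a).erase b, MvPolynomial.X i else 0, ?_, ?_, ?_, ?_⟩
    · intro a b
      have : (a ≠ b ∧ a ∈ T ∧ b ∈ T) = (b ≠ a ∧ b ∈ T ∧ a ∈ T) := by
        apply propext
        constructor <;> rintro ⟨h1, h2, h3⟩ <;> exact ⟨h1.symm, h3, h2⟩
      simp only [this, add_comm (A a) (A b), Finset.erase_right_comm (a := a) (b := b)]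
    · intro a b
      beta_reduce
      split_ifs with h
      · refine (MvPolynomial.totalDegree_mul _ _).trans ?_
        rw [MvPolynomial.totalDegree_C, zero_add]
        refine (MvPolynomial.totalDegree_finsetProd _ _).trans ?_
        simp only [MvPolynomial.totalDegree_X, Finset.sum_const, smul_eq_mul, mul_one]
        rw [Finset.card_erase_of_mem (Finset.mem_erase.2 ⟨h.1.symm, h.2.2⟩),
          Finset.card_erase_of_mem h.2.1, hT, Finset.card_insert_of_notMem hcS, hcard]
        omega
      · simp
    · intro a b
      beta_reduce
      split_ifs with h
      · refine (coeffNorm_C_mul_le _ _).trans ?_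
        refine (mul_le_of_le_one_right (abs_nonneg _) (coeffNorm_prod_X_le _)).trans ?_
        rw [abs_mul]
        refine mul_le_mul_of_nonneg_right ?_ (abs_nonneg x)
        exact (abs_add_le _ _).trans (by linarith [hAbd a, hAbd b])
      · simp
    · intro e he l hl
      beta_reduce
      by_cases heT : e ∈ T
      · have h1 : ∑ b ∈ T.erase e, l b * MvPolynomial.eval l (MvPolynomial.C ((A e + A b) * x) *
            ∏ i ∈ (T.erase e).erase b, MvPolynomial.X i) =
            (if e = c then 1 else 0) * (x * ∏ i ∈ T.erase e, l i) := by
          rw [← hrow e heT, Finset.sum_mul]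
          refine Finset.sum_congr rfl fun b hb => ?_
          simp only [map_mul, MvPolynomial.eval_C, map_prod, MvPolynomial.eval_X]
          rw [← Finset.mul_prod_erase (T.erase e) l hb]
          ring
        have h2 : ∑ b ∈ K.erase e, l b * MvPolynomial.eval l (if e ≠ b ∧ e ∈ T ∧ b ∈ T then
            MvPolynomial.C ((A e + A b) * x) * ∏ i ∈ (T.erase e).erase b, MvPolynomial.X i else 0) =
            ∑ b ∈ T.erase e, l b * MvPolynomial.eval l (MvPolynomial.C ((A e + A b) * x) *
            ∏ i ∈ (T.erase e).erase b, MvPolynomial.X i) := by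
          symm
          refine (Finset.sum_congr rfl fun b hb => ?_).trans
            (Finset.sum_subset (Finset.erase_subset_erase e hTK) fun b hbK hb => ?_)
          · rw [if_pos ⟨(Finset.ne_of_mem_erase hb).symm, heT, Finset.mem_of_mem_erase hb⟩]
          · rw [if_neg fun h => hb (Finset.mem_erase.2 ⟨h.1.symm, h.2.2⟩)]
            simp
        rw [h2, h1]
        split_ifs with hec
        · subst hec
          rw [one_mul, hT, Finset.erase_insert hcS, eval_monomial_eq_prod (Finset.Subset.refl _)]
          congr 1
          exact Finset.prod_congr rfl fun i hi => by rw [hα1 i hi, pow_one]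
        · rw [zero_mul]
      · rw [if_neg (by rintro rfl; exact heT (by simp [hT]))]
        refine Finset.sum_eq_zero fun b _ => ?_
        rw [if_neg fun h => heT h.2.1]
        simp

/-- The edge system is solvable for all data: given homogeneous polynomials `w c` of degree
`m + 2 ≥ 2` on the faces, there are symmetric edge polynomials `p a b` of degree `m + 1` such that
`∑_b λ_b p c b = w c` on the face `λ_c = 0`, for all vertices `c` at the same time. -/
theorem exists_edge_system [DecidableEq σ] (K : Finset σ) {m : ℕ} {w : σ → MvPolynomial σ ℝ}
    (hw : ∀ c ∈ K, (w c).IsHomogeneous (m + 2))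
    (hv : ∀ c ∈ K, ∀ α ∈ (w c).support, α.support ⊆ K) :
    ∃ p : σ → σ → MvPolynomial σ ℝ, (∀ a b, p a b = p b a) ∧
      (∀ a b, (p a b).totalDegree ≤ m + 1) ∧
      (∀ a b, coeffNorm (p a b) ≤ 2 * ∑ c ∈ K, coeffNorm (w c)) ∧
      ∀ c ∈ K, ∀ l : σ → ℝ, l c = 0 → ∑ b ∈ K.erase c, l b * MvPolynomial.eval l (p c b) =
        MvPolynomial.eval l (w c) := by
  have hex : ∀ (c : σ) (α : σ →₀ ℕ), c ∈ K → α ∈ (w c).support →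
      ∃ p : σ → σ → MvPolynomial σ ℝ, (∀ a b, p a b = p b a) ∧
      (∀ a b, (p a b).totalDegree ≤ m + 1) ∧ (∀ a b, coeffNorm (p a b) ≤ 2 * |(w c).coeff α|) ∧
      ∀ e ∈ K, ∀ l : σ → ℝ, l e = 0 → ∑ b ∈ K.erase e, l b * MvPolynomial.eval l (p e b) =
        if e = c then MvPolynomial.eval l (MvPolynomial.monomial α ((w c).coeff α)) else 0 := by
    intro c α hc hα
    refine exists_edge_monomial hc ?_ (hv c hc α hα) _
    by_contra h
    exact MvPolynomial.mem_support_iff.1 hα ((hw c hc).coeff_eq_zero h)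
  choose! p hsym hdeg hbd hsol using hex
  refine ⟨fun a b => ∑ c ∈ K, ∑ α ∈ (w c).support, p c α a b, ?_, ?_, ?_, ?_⟩
  · intro a b
    exact Finset.sum_congr rfl fun c hc => Finset.sum_congr rfl fun α hα => hsym c α hc hα a b
  · intro a b
    exact MvPolynomial.totalDegree_finsetSum_le fun c hc =>
      MvPolynomial.totalDegree_finsetSum_le fun α hα => hdeg c α hc hα a b
  · intro a b
    rw [Finset.mul_sum]
    refine (coeffNorm_sum_le _ _).trans (Finset.sum_le_sum fun c hc => ?_)
    refine (coeffNorm_sum_le _ _).trans ?_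
    rw [coeffNorm, Finset.mul_sum]
    exact Finset.sum_le_sum fun α hα => hbd c α hc hα a b
  · intro e he l hl
    simp only [map_sum, Finset.mul_sum]
    rw [Finset.sum_comm]
    have h1 : ∀ c ∈ K, ∑ b ∈ K.erase e, ∑ α ∈ (w c).support,
        l b * MvPolynomial.eval l (p c α e b) =
        if e = c then MvPolynomial.eval l (w c) else 0 := by
      intro c hc
      rw [Finset.sum_comm, Finset.sum_congr rfl fun α hα => hsol c α hc hα e he l hl]
      split_ifs with h
      · rw [← map_sum, ← MvPolynomial.as_sum]
      · simp
    rw [Finset.sum_congr rfl h1, Finset.sum_ite_eq K e, if_pos he]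

end EdgeSystem

/-! ### Polynomials in barycentric coordinates -/

section BaryPoly

variable {d : ℕ} {K : Finset (E d)}

theorem inner_eq_sum (x y : E d) : inner ℝ x y = ∑ i, x i * y i := by
  rw [PiLp.inner_apply]
  exact Finset.sum_congr rfl fun i _ => by simp [mul_comm]

theorem polyEval_sum {ι : Type*} (s : Finset ι) (p : ι → MvPolynomial (Fin d) ℝ) (x : E d) :
    polyEval (∑ i ∈ s, p i) x = ∑ i ∈ s, polyEval (p i) x :=
  map_sum _ _ _

theorem polyEval_mul (p q : MvPolynomial (Fin d) ℝ) (x : E d) :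
    polyEval (p * q) x = polyEval p x * polyEval q x :=
  map_mul _ _ _

theorem polyEval_C_mul (c : ℝ) (p : MvPolynomial (Fin d) ℝ) (x : E d) :
    polyEval (MvPolynomial.C c * p) x = c * polyEval p x := by
  simp [polyEval]

/-- The barycentric coordinate of the vertex `a` of `K` as a polynomial in the coordinates. -/
noncomputable def baryPoly (K : Finset (E d)) (a : E d) : MvPolynomial (Fin d) ℝ :=
  MvPolynomial.C (baryConst K a) + ∑ i, MvPolynomial.C (baryGrad K a i) * MvPolynomial.X i

theorem polyEval_baryPoly (K : Finset (E d)) (a x : E d) :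
    polyEval (baryPoly K a) x = bary K a x := by
  simp [polyEval, baryPoly, bary, inner_eq_sum]

theorem totalDegree_baryPoly_le (K : Finset (E d)) (a : E d) :
    (baryPoly K a).totalDegree ≤ 1 := by
  refine (MvPolynomial.totalDegree_add _ _).trans (max_le (by simp) ?_)
  refine MvPolynomial.totalDegree_finsetSum_le fun i _ => ?_
  refine (MvPolynomial.totalDegree_mul _ _).trans ?_
  simp

theorem pderiv_baryPoly (K : Finset (E d)) (a : E d) (i : Fin d) :
    MvPolynomial.pderiv i (baryPoly K a) = MvPolynomial.C (baryGrad K a i) := by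
  classical
  simp [baryPoly, MvPolynomial.pderiv_X, Pi.single_apply]

/-- The polynomial obtained by inserting the barycentric coordinates of `K` into a polynomial
whose variables are points; the variables that are not vertices of `K` become zero.  In this way
a single polynomial attached to a side can be used on all elements containing the side. -/
noncomputable def onElement (K : Finset (E d)) (W : MvPolynomial (E d) ℝ) :
    MvPolynomial (Fin d) ℝ :=
  MvPolynomial.aeval (baryPoly K) W

theorem polyEval_onElement (K : Finset (E d)) (W : MvPolynomial (E d) ℝ) (x : E d) :
    polyEval (onElement K W) x = MvPolynomial.eval (fun a => bary K a x) W := by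
  induction W using MvPolynomial.induction_on with
  | C r => simp [onElement, polyEval]
  | add p q hp hq =>
    simp only [onElement, polyEval, map_add] at hp hq ⊢
    rw [hp, hq]
  | mul_X p a hp =>
    have h := polyEval_baryPoly K a x
    simp only [onElement, polyEval, map_mul, MvPolynomial.aeval_X, MvPolynomial.eval_X] at hp h ⊢
    rw [hp, h]

theorem totalDegree_onElement_le (K : Finset (E d)) (W : MvPolynomial (E d) ℝ) :
    (onElement K W).totalDegree ≤ W.totalDegree :=
  totalDegree_aeval_le W (totalDegree_baryPoly_le K)

/-- The chain rule for polynomials in barycentric coordinates. -/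
theorem pderiv_onElement (hK : IsSimplex K) (i : Fin d) (W : MvPolynomial (E d) ℝ) :
    MvPolynomial.pderiv i (onElement K W) =
      ∑ a ∈ K, MvPolynomial.C (baryGrad K a i) * onElement K (MvPolynomial.pderiv a W) := by
  classical
  induction W using MvPolynomial.induction_on with
  | C r => simp [onElement]
  | add p q hp hq =>
    simp only [onElement, map_add, mul_add, Finset.sum_add_distrib] at hp hq ⊢
    rw [hp, hq]
  | mul_X p b hp =>
    simp only [onElement, map_mul, MvPolynomial.aeval_X, MvPolynomial.pderiv_mul, map_add,
      MvPolynomial.pderiv_X, mul_add, Finset.sum_add_distrib, Pi.single_apply] at hp ⊢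
    rw [hp, pderiv_baryPoly, Finset.sum_mul]
    refine congrArg₂ (· + ·) (Finset.sum_congr rfl fun a _ => mul_assoc _ _ _) ?_
    · by_cases hb : b ∈ K
      · rw [Finset.sum_eq_single b]
        · simp [mul_comm]
        · intro a _ hab
          simp [hab.symm]
        · exact fun h => absurd hb h
      · rw [hK.baryGrad_of_notMem hb]
        symm
        simp only [PiLp.zero_apply, map_zero, mul_zero]
        refine Finset.sum_eq_zero fun a ha => ?_
        rw [if_neg (by rintro rfl; exact hb ha)]
        simp

/-- The derivative of a polynomial in the direction `t`. -/
noncomputable def dirDeriv (t : E d) (p : MvPolynomial (Fin d) ℝ) : MvPolynomial (Fin d) ℝ :=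
  ∑ j, MvPolynomial.C (t j) * MvPolynomial.pderiv j p

theorem dirDeriv_mul (t : E d) (p q : MvPolynomial (Fin d) ℝ) :
    dirDeriv t (p * q) = dirDeriv t p * q + p * dirDeriv t q := by
  simp only [dirDeriv, MvPolynomial.pderiv_mul, Finset.sum_mul, Finset.mul_sum,
    ← Finset.sum_add_distrib]
  exact Finset.sum_congr rfl fun j _ => by ring

theorem dirDeriv_baryPoly (t : E d) (a : E d) :
    dirDeriv t (baryPoly K a) = MvPolynomial.C (inner ℝ (baryGrad K a) t) := by
  simp only [dirDeriv, pderiv_baryPoly, inner_eq_sum, ← map_mul, ← map_sum]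
  congr 1
  exact Finset.sum_congr rfl fun j _ => by ring

/-! ### Edge fields -/

/-- The matrix field `∑ₐ ∑_b q_{ab} λₐ λ_b (b - a)(b - a)ᵀ` on the simplex `K`.  Its normal trace
vanishes on the boundary of `K`, since `λₐ λ_b` and `(b - a) · n` do not vanish on the same face. -/
noncomputable def edgeField (K : Finset (E d)) (Q : E d → E d → MvPolynomial (Fin d) ℝ) :
    Matrix (Fin d) (Fin d) (MvPolynomial (Fin d) ℝ) := fun i j =>
  ∑ a ∈ K, ∑ b ∈ K, MvPolynomial.C ((b - a) i * (b - a) j) *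
    (baryPoly K a * baryPoly K b * Q a b)

theorem edgeField_symm (K : Finset (E d)) (Q : E d → E d → MvPolynomial (Fin d) ℝ) (i j : Fin d) :
    edgeField K Q i j = edgeField K Q j i := by
  simp only [edgeField, mul_comm]

theorem totalDegree_edgeField_le {Q : E d → E d → MvPolynomial (Fin d) ℝ} {m : ℕ}
    (hQ : ∀ a b, (Q a b).totalDegree ≤ m) (i j : Fin d) :
    (edgeField K Q i j).totalDegree ≤ m + 2 := by
  refine MvPolynomial.totalDegree_finsetSum_le fun a _ =>
    MvPolynomial.totalDegree_finsetSum_le fun b _ => ?_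
  refine (MvPolynomial.totalDegree_mul _ _).trans ?_
  rw [MvPolynomial.totalDegree_C, zero_add]
  refine (MvPolynomial.totalDegree_mul _ _).trans ?_
  have h := MvPolynomial.totalDegree_mul (baryPoly K a) (baryPoly K b)
  have := totalDegree_baryPoly_le K a
  have := totalDegree_baryPoly_le K b
  have := hQ a b
  omega

theorem polyEval_edgeField (K : Finset (E d)) (Q : E d → E d → MvPolynomial (Fin d) ℝ)
    (i j : Fin d) (x : E d) : polyEval (edgeField K Q i j) x =
      ∑ a ∈ K, ∑ b ∈ K, (b - a) i * (b - a) j *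
        (bary K a x * bary K b x * polyEval (Q a b) x) := by
  simp only [← polyEval_baryPoly, polyEval, edgeField, map_sum, map_mul, MvPolynomial.eval_C]

theorem edgeField_mul_baryGrad (hK : IsSimplex K) (Q : E d → E d → MvPolynomial (Fin d) ℝ)
    {c x : E d} (hc : c ∈ K) (hx : bary K c x = 0) (i : Fin d) :
    ∑ j, polyEval (edgeField K Q i j) x * baryGrad K c j = 0 := by
  have h1 : ∑ j, polyEval (edgeField K Q i j) x * baryGrad K c j =
      ∑ a ∈ K, ∑ b ∈ K, (b - a) i * (bary K a x * bary K b x * polyEval (Q a b) x) *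
        inner ℝ (baryGrad K c) (b - a) := by
    simp only [polyEval_edgeField, Finset.sum_mul]
    rw [Finset.sum_comm]
    refine Finset.sum_congr rfl fun a _ => ?_
    rw [Finset.sum_comm]
    refine Finset.sum_congr rfl fun b _ => ?_
    rw [inner_eq_sum, Finset.mul_sum]
    exact Finset.sum_congr rfl fun j _ => by ring
  rw [h1]
  refine Finset.sum_eq_zero fun a ha => Finset.sum_eq_zero fun b hb => ?_
  by_cases hca : c = a
  · subst hca; simp [hx]
  by_cases hcb : c = b
  · subst hcb; simp [hx]
  rw [hK.inner_baryGrad_sub hc hb ha, if_neg hca, if_neg hcb]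
  ring

/-- On the face opposite to the vertex `c`, the normal component of the divergence of an edge field
only sees the edges ending in `c`. -/
theorem div_edgeField_mul_baryGrad (hK : IsSimplex K) {Q : E d → E d → MvPolynomial (Fin d) ℝ}
    (hQ : ∀ a b, Q a b = Q b a) {c x : E d} (hc : c ∈ K) (hx : bary K c x = 0) :
    ∑ i, (∑ j, polyEval (MvPolynomial.pderiv j (edgeField K Q i j)) x) * baryGrad K c i =
      2 * ∑ b ∈ K.erase c, bary K b x * polyEval (Q c b) x := by
  set D : E d → E d → ℝ := fun a b => polyEval
    (dirDeriv (b - a) (baryPoly K a * baryPoly K b * Q a b)) x with hD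
  have h1 : ∑ i, (∑ j, polyEval (MvPolynomial.pderiv j (edgeField K Q i j)) x) * baryGrad K c i =
      ∑ a ∈ K, ∑ b ∈ K, inner ℝ (baryGrad K c) (b - a) * D a b := by
    have h2 : ∀ i, ∑ j, polyEval (MvPolynomial.pderiv j (edgeField K Q i j)) x =
        ∑ a ∈ K, ∑ b ∈ K, (b - a) i * D a b := by
      intro i
      simp only [hD, dirDeriv, edgeField, polyEval_sum, polyEval_C_mul, map_sum,
        MvPolynomial.pderiv_C_mul, Finset.mul_sum]
      rw [Finset.sum_comm]
      refine Finset.sum_congr rfl fun a _ => ?_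
      rw [Finset.sum_comm]
      refine Finset.sum_congr rfl fun b _ => ?_
      exact Finset.sum_congr rfl fun j _ => by ring
    simp only [h2, Finset.sum_mul]
    rw [Finset.sum_comm]
    refine Finset.sum_congr rfl fun a _ => ?_
    rw [Finset.sum_comm]
    refine Finset.sum_congr rfl fun b _ => ?_
    rw [inner_eq_sum, Finset.sum_mul]
    exact Finset.sum_congr rfl fun j _ => by ring
  have hDval : ∀ a b, D a b = inner ℝ (baryGrad K a) (b - a) * bary K b x * polyEval (Q a b) x +
      bary K a x * inner ℝ (baryGrad K b) (b - a) * polyEval (Q a b) x +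
      bary K a x * bary K b x * polyEval (dirDeriv (b - a) (Q a b)) x := by
    intro a b
    simp only [hD, dirDeriv_mul, dirDeriv_baryPoly, ← polyEval_baryPoly, polyEval, map_add,
      map_mul, MvPolynomial.eval_C]
    ring
  have h3 : ∀ a ∈ K, ∀ b ∈ K, inner ℝ (baryGrad K c) (b - a) * D a b =
      (if a = c then (if b = c then 0 else bary K b x * polyEval (Q c b) x) else 0) +
      (if b = c then (if a = c then 0 else bary K a x * polyEval (Q c a) x) else 0) := by
    intro a ha b hb
    rw [hDval, hK.inner_baryGrad_sub hc hb ha, hK.inner_baryGrad_sub ha hb ha,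
      hK.inner_baryGrad_sub hb hb ha]
    by_cases hac : a = c
    · subst hac
      by_cases hba : b = a
      · subst hba; simp
      · simp [hba, Ne.symm hba, hx]
    · by_cases hbc : b = c
      · subst hbc
        simp [hac, Ne.symm hac, hx, hQ a b]
      · simp [hac, hbc, Ne.symm hac, Ne.symm hbc]
  have h4 : ∑ b ∈ K, (if b = c then 0 else bary K b x * polyEval (Q c b) x) =
      ∑ b ∈ K.erase c, bary K b x * polyEval (Q c b) x := by
    rw [← Finset.add_sum_erase K _ hc, if_pos rfl, zero_add]
    exact Finset.sum_congr rfl fun b hb => if_neg (Finset.ne_of_mem_erase hb)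
  rw [h1, Finset.sum_congr rfl fun a ha => Finset.sum_congr rfl fun b hb => h3 a ha b hb]
  simp only [Finset.sum_add_distrib]
  rw [two_mul, ← h4]
  congr 1
  · rw [Finset.sum_eq_single c]
    · simp
    · intro a _ hac; simp [hac]
    · exact fun h => absurd hc h
  · refine Finset.sum_congr rfl fun a ha => ?_
    rw [Finset.sum_ite_eq' K c, if_pos hc]

end BaryPoly

/-! ### The fields carrying the normal-normal components -/

namespace Triangulation

variable {d : ℕ} {Ω : Set (E d)} (T : Triangulation Ω)

open scoped Classical in
/-- The matrix field `∑_F z_F n_F n_Fᵀ` on the element `K`, where the sum is over the sides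
of `K`. -/
noncomputable def sideField (Z : Finset (E d) → MvPolynomial (E d) ℝ) (K : Finset (E d)) :
    Matrix (Fin d) (Fin d) (MvPolynomial (Fin d) ℝ) := fun i j =>
  ∑ F ∈ T.sides with F ⊆ K, MvPolynomial.C (T.normal F i * T.normal F j) * onElement K (Z F)

variable {T}

theorem sideField_symm (Z : Finset (E d) → MvPolynomial (E d) ℝ) (K : Finset (E d)) (i j : Fin d) :
    T.sideField Z K i j = T.sideField Z K j i := by
  simp only [sideField, mul_comm (T.normal _ i)]

theorem totalDegree_sideField_le {Z : Finset (E d) → MvPolynomial (E d) ℝ} {m : ℕ}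
    (hZ : ∀ F ∈ T.sides, (Z F).totalDegree ≤ m) (K : Finset (E d)) (i j : Fin d) :
    (T.sideField Z K i j).totalDegree ≤ m := by
  refine MvPolynomial.totalDegree_finsetSum_le fun F hF => ?_
  refine (MvPolynomial.totalDegree_mul _ _).trans ?_
  rw [MvPolynomial.totalDegree_C, zero_add]
  exact (totalDegree_onElement_le K _).trans (hZ F (Finset.mem_filter.1 hF).1)

open scoped Classical in
theorem polyEval_sideField (Z : Finset (E d) → MvPolynomial (E d) ℝ) (K : Finset (E d))
    (i j : Fin d) (x : E d) : polyEval (T.sideField Z K i j) x =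
      ∑ F ∈ T.sides with F ⊆ K, T.normal F i * T.normal F j *
        MvPolynomial.eval (fun a => bary K a x) (Z F) := by
  simp only [← polyEval_onElement, polyEval, sideField, map_sum, map_mul, MvPolynomial.eval_C]

open scoped Classical in
/-- The polynomial in barycentric coordinates whose restriction to `K` is
`Div τ · g` for `τ = ∑_F z_F n_F n_Fᵀ`. -/
noncomputable def divSidePoly (T : Triangulation Ω) (Z : Finset (E d) → MvPolynomial (E d) ℝ)
    (K : Finset (E d)) (g : E d) : MvPolynomial (E d) ℝ :=
  ∑ F ∈ T.sides with F ⊆ K, MvPolynomial.C (inner ℝ g (T.normal F)) *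
    ∑ a ∈ K, MvPolynomial.C (inner ℝ (baryGrad K a) (T.normal F)) * MvPolynomial.pderiv a (Z F)

theorem div_sideField_mul (Z : Finset (E d) → MvPolynomial (E d) ℝ) {K : Finset (E d)}
    (hK : IsSimplex K) (g x : E d) :
    ∑ i, (∑ j, polyEval (MvPolynomial.pderiv j (T.sideField Z K i j)) x) * g i =
      MvPolynomial.eval (fun a => bary K a x) (T.divSidePoly Z K g) := by
  classical
  have h2 : ∀ i, ∑ j, polyEval (MvPolynomial.pderiv j (T.sideField Z K i j)) x =
      ∑ F ∈ T.sides with F ⊆ K, T.normal F i *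
        ∑ a ∈ K, inner ℝ (baryGrad K a) (T.normal F) *
          MvPolynomial.eval (fun a => bary K a x) (MvPolynomial.pderiv a (Z F)) := by
    intro i
    simp only [← polyEval_onElement, sideField, map_sum, MvPolynomial.pderiv_C_mul,
      pderiv_onElement hK, polyEval_sum, polyEval_C_mul, Finset.mul_sum]
    rw [Finset.sum_comm]
    refine Finset.sum_congr rfl fun F _ => ?_
    rw [Finset.sum_comm]
    refine Finset.sum_congr rfl fun a _ => ?_
    rw [inner_eq_sum, Finset.sum_mul, Finset.mul_sum]
    exact Finset.sum_congr rfl fun j _ => by ring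
  simp only [h2, divSidePoly, map_sum, map_mul, MvPolynomial.eval_C, Finset.sum_mul]
  rw [Finset.sum_comm]
  refine Finset.sum_congr rfl fun F _ => ?_
  rw [inner_eq_sum, Finset.sum_mul]
  exact Finset.sum_congr rfl fun i _ => by ring

end Triangulation

namespace Triangulation

/-! ### Piecewise polynomial matrix fields -/

section GlueMat

variable {d : ℕ} {Ω : Set (E d)} (T : Triangulation Ω)

/-- The matrix function that is the matrix of polynomials `P K` on each element `K`. -/
noncomputable def glueMat (P : Finset (E d) → Matrix (Fin d) (Fin d) (MvPolynomial (Fin d) ℝ))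
    (x : E d) : Matrix (Fin d) (Fin d) ℝ := fun i j => T.glue (fun K => polyEval (P K i j)) x

variable {T} {P : Finset (E d) → Matrix (Fin d) (Fin d) (MvPolynomial (Fin d) ℝ)}

theorem localMat_glueMat (hd : 1 ≤ d) {K : Finset (E d)} (hK : K ∈ T.elements) :
    localMat (T.glueMat P) K = P K := by
  funext i j
  exact localPoly_eq (isSimplex hK).interior_nonempty (T.agrees_glue hd _ K hK)

theorem inL2Sym_glueMat (hP : ∀ K i j, P K i j = P K j i) : InL2Sym Ω (T.glueMat P) := by
  refine ⟨fun i j => T.inL2_glue fun K _ => continuous_polyEval _,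
    Filter.Eventually.of_forall fun x => ?_⟩
  refine Matrix.IsSymm.ext fun i j => ?_
  simp only [glueMat, hP _ i j]

theorem piecewisePolySym_glueMat (hd : 1 ≤ d) (hP : ∀ K i j, P K i j = P K j i) {k : ℕ}
    (hk : ∀ K ∈ T.elements, ∀ i j, (P K i j).totalDegree ≤ k) :
    T.PiecewisePolySym k (T.glueMat P) :=
  ⟨inL2Sym_glueMat hP, fun K hK i j => ⟨P K i j, hk K hK i j, T.agrees_glue hd _ K hK⟩⟩

theorem jump_eq_zero (hd : 1 ≤ d) (hopen : IsOpen Ω) {F : Finset (E d)} (hF : F ∈ T.sides)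
    (hb : ¬ T.IsBoundary F) {u : Finset (E d) → E d → ℝ} {x : E d} {c : ℝ}
    (hu : ∀ K ∈ T.elements, F ⊆ K → u K x = c) : T.jump u F x = 0 := by
  classical
  obtain ⟨K, hK, hFK, hKp⟩ := T.exists_ne_plus_of_not_isBoundary hd hopen hF hb
  have h1 : T.elements.filter (fun K => F ⊆ K ∧ K ≠ T.plus F) = {K} := by
    ext K'
    simp only [Finset.mem_filter, Finset.mem_singleton]
    constructor
    · rintro ⟨h, h', h''⟩
      exact T.eq_of_ne_plus hd hF h h' h'' hK hFK hKp
    · rintro rfl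
      exact ⟨hK, hFK, hKp⟩
  unfold jump
  have h2 : ∑ K' ∈ T.elements.filter (fun K => F ⊆ K ∧ K ≠ T.plus F), u K' x = u K x := by
    rw [h1, Finset.sum_singleton]
  rw [hu _ (T.plus_spec hF).1 (T.plus_spec hF).2]
  convert sub_self c
  rw [← hu K hK hFK, ← h2]

end GlueMat

variable {n : ℕ} {Ω : Set (E (n + 1))} {T : Triangulation Ω}

theorem bary_eq_of_mem_side {F K K' : Finset (E (n + 1))} (hK : K ∈ T.elements)
    (hK' : K' ∈ T.elements) (h : F ⊆ K) (h' : F ⊆ K') {x : E (n + 1)} (hx : x ∈ hull F)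
    {a : E (n + 1)} (ha : a ∈ F) : bary K a x = bary K' a x := by
  obtain ⟨w, -, hw, rfl⟩ := Finset.mem_convexHull'.1 hx
  rw [(isSimplex hK).bary_combination_mem (h ha) h hw,
    (isSimplex hK').bary_combination_mem (h' ha) h' hw]

/-- A piecewise polynomial that is continuous across the interior sides has weak partial
derivatives. -/
theorem hasWeakPartial_glue (hopen : IsOpen Ω) (hreg : interior (closure Ω) = Ω)
    {p : Finset (E (n + 1)) → MvPolynomial (Fin (n + 1)) ℝ}
    (hp : ∀ F ∈ T.sides, ∀ x ∈ hull F, ∃ c, ∀ K ∈ T.elements, F ⊆ K → polyEval (p K) x = c)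
    (l : Fin (n + 1)) :
    HasWeakPartial Ω l (T.glue fun K => polyEval (p K))
      (T.glue fun K => polyEval (MvPolynomial.pderiv l (p K))) := by
  refine ⟨T.inL2_glue fun K _ => continuous_polyEval _, fun φ hφ => ?_⟩
  have h := T.integral_weak_div hopen hreg
    (X := fun K j => if j = l then p K else 0) (fun F hF hb x hx => by
      obtain ⟨c, hc⟩ := hp F hF x hx
      refine jump_eq_zero (by omega) hopen hF hb (c := c * T.normal F l) fun K hK hFK => ?_
      rw [Finset.sum_eq_single l]
      · rw [if_pos rfl, hc K hK hFK]
      · intro j _ hj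
        simp [hj, polyEval]
      · simp)
    (f := fun j => T.glue fun K => polyEval (if j = l then p K else 0))
    (fun j => T.agrees_glue (by omega) _)
    (T.agrees_glue (by omega) fun K => polyEval (∑ j, MvPolynomial.pderiv j
      (if j = l then p K else 0))) hφ
  have h1 : ∀ K, ∑ j, MvPolynomial.pderiv j (if j = l then p K else 0) =
      MvPolynomial.pderiv l (p K) := by
    intro K
    rw [Finset.sum_eq_single l]
    · rw [if_pos rfl]
    · intro j _ hj
      rw [if_neg hj, map_zero]
    · simp
  simp only [h1] at h
  rw [← h]
  congr 1
  funext x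
  rw [Finset.sum_eq_single l]
  · simp only [if_true]
  · intro j _ hj
    have h0 : ∀ y : E (n + 1), polyEval (0 : MvPolynomial (Fin (n + 1)) ℝ) y = 0 :=
      fun y => map_zero _
    simp [glue, hj, Set.indicator, h0]
  · simp

/-! ### A local construction of elements of `Σ_h` -/

/-- The matrix of polynomials on the element `K` given by the polynomials `Z` on the sides and the
edge polynomials `Q K`. -/
noncomputable def localField (T : Triangulation Ω)
    (Z : Finset (E (n + 1)) → MvPolynomial (E (n + 1)) ℝ)
    (Q : Finset (E (n + 1)) → E (n + 1) → E (n + 1) → MvPolynomial (Fin (n + 1)) ℝ)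
    (K : Finset (E (n + 1))) :
    Matrix (Fin (n + 1)) (Fin (n + 1)) (MvPolynomial (Fin (n + 1)) ℝ) := fun i j =>
  T.sideField Z K i j + edgeField K (Q K) i j

/-- Conditions on side polynomials `Z`, `D` and edge polynomials `Q` which ensure that the field
`∑_F z_F n_F n_Fᵀ + ∑ q_{ab} λₐ λ_b (b - a)(b - a)ᵀ` belongs to `Σ_h` and that on every side `F`
its normal trace is `z_F n_F` and the normal component of its divergence is `D_F`. -/
structure IsFieldData (T : Triangulation Ω) (k : ℕ)
    (Z D : Finset (E (n + 1)) → MvPolynomial (E (n + 1)) ℝ)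
    (Q : Finset (E (n + 1)) → E (n + 1) → E (n + 1) → MvPolynomial (Fin (n + 1)) ℝ) : Prop where
  degree_side : ∀ F ∈ T.sides, (Z F).totalDegree ≤ k
  degree_edge : ∀ K ∈ T.elements, ∀ a b, (Q K a b).totalDegree + 2 ≤ k
  symm : ∀ K ∈ T.elements, ∀ a b, Q K a b = Q K b a
  vanish : ∀ F ∈ T.sides, ∀ l : E (n + 1) → ℝ, ∀ a ∈ F, l a = 0 → MvPolynomial.eval l (Z F) = 0
  side_local : ∀ F ∈ T.sides, ∀ l l' : E (n + 1) → ℝ, (∀ a ∈ F, l a = l' a) →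
    MvPolynomial.eval l (Z F) = MvPolynomial.eval l' (Z F)
  div_local : ∀ F ∈ T.sides, ∀ l l' : E (n + 1) → ℝ, (∀ a ∈ F, l a = l' a) →
    MvPolynomial.eval l (D F) = MvPolynomial.eval l' (D F)
  div_boundary : ∀ F ∈ T.sides, T.IsBoundary F → D F = 0
  div_eq : ∀ K ∈ T.elements, ∀ c ∈ K, ∀ x, bary K c x = 0 →
    2 * ∑ b ∈ K.erase c, bary K b x * polyEval (Q K c b) x +
      MvPolynomial.eval (fun a => bary K a x) (T.divSidePoly Z K (baryGrad K c)) =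
    -(T.sideSign K (K.erase c) * ‖baryGrad K c‖) *
      MvPolynomial.eval (fun a => bary K a x) (D (K.erase c))

namespace IsFieldData

variable {k : ℕ} {Z D : Finset (E (n + 1)) → MvPolynomial (E (n + 1)) ℝ}
  {Q : Finset (E (n + 1)) → E (n + 1) → E (n + 1) → MvPolynomial (Fin (n + 1)) ℝ}

theorem polyEval_sideField_of_bary_eq_zero (h : T.IsFieldData k Z D Q) {K : Finset (E (n + 1))}
    (hK : K ∈ T.elements) {c x : E (n + 1)} (hc : c ∈ K) (hx : bary K c x = 0)
    (i j : Fin (n + 1)) :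
    polyEval (T.sideField Z K i j) x = T.normal (K.erase c) i * T.normal (K.erase c) j *
      MvPolynomial.eval (fun a => bary K a x) (Z (K.erase c)) := by
  classical
  have hF := T.erase_mem_sides (by omega) hK hc
  rw [polyEval_sideField, Finset.sum_eq_single (K.erase c)]
  · intro F' hF' hne
    rw [Finset.mem_filter] at hF'
    have hcF : c ∈ F' := by
      by_contra hcF
      refine hne (Finset.eq_of_subset_of_card_le (Finset.subset_erase.2 ⟨hF'.2, hcF⟩) ?_)
      rw [(T.mem_sides.1 hF).2, (T.mem_sides.1 hF'.1).2]
    rw [h.vanish F' hF'.1 _ c hcF hx, mul_zero]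
  · intro hn
    rw [Finset.mem_filter] at hn
    exact absurd ⟨hF, Finset.erase_subset _ _⟩ hn

theorem normal_eq_smul {K : Finset (E (n + 1))} (hK : K ∈ T.elements) {c : E (n + 1)}
    (hc : c ∈ K) : T.normal (K.erase c) =
      -(T.sideSign K (K.erase c) * ‖baryGrad K c‖⁻¹) • baryGrad K c := by
  have h := T.sideSign_smul_normal (by omega) hK hc
  have hs : T.sideSign K (K.erase c) * T.sideSign K (K.erase c) = 1 := by
    unfold sideSign
    split_ifs <;> norm_num
  have h2 := congrArg (fun v => T.sideSign K (K.erase c) • v) h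
  simp only [smul_smul, hs, one_smul, smul_neg] at h2
  rw [h2, neg_smul]

theorem normalTrace_edgeField {K : Finset (E (n + 1))}
    (hK : K ∈ T.elements) {c x : E (n + 1)} (hc : c ∈ K) (hx : bary K c x = 0)
    (i : Fin (n + 1)) :
    ∑ j, polyEval (edgeField K (Q K) i j) x * T.normal (K.erase c) j = 0 := by
  have h := edgeField_mul_baryGrad (isSimplex hK) (Q K) hc hx i
  rw [normal_eq_smul hK hc]
  simp only [PiLp.smul_apply, smul_eq_mul]
  calc _ = -(T.sideSign K (K.erase c) * ‖baryGrad K c‖⁻¹) *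
        ∑ j, polyEval (edgeField K (Q K) i j) x * baryGrad K c j := by
        rw [Finset.mul_sum]; exact Finset.sum_congr rfl fun j _ => by ring
    _ = 0 := by rw [h, mul_zero]

theorem normalTrace_localField (h : T.IsFieldData k Z D Q) {K : Finset (E (n + 1))}
    (hK : K ∈ T.elements) {c x : E (n + 1)} (hc : c ∈ K) (hx : bary K c x = 0)
    (i : Fin (n + 1)) :
    ∑ j, polyEval (T.localField Z Q K i j) x * T.normal (K.erase c) j =
      MvPolynomial.eval (fun a => bary K a x) (Z (K.erase c)) * T.normal (K.erase c) i := by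
  have hF := T.erase_mem_sides (by omega) hK hc
  have h1 : ∀ j, polyEval (T.localField Z Q K i j) x = polyEval (T.sideField Z K i j) x +
      polyEval (edgeField K (Q K) i j) x := fun j => map_add _ _ _
  have hn : ∑ j, T.normal (K.erase c) j * T.normal (K.erase c) j = 1 := by
    rw [← inner_eq_sum, real_inner_self_eq_norm_sq, (T.normal_spec (by omega) hF).1, one_pow]
  simp only [h1, add_mul, Finset.sum_add_distrib]
  rw [normalTrace_edgeField hK hc hx, add_zero]
  simp only [h.polyEval_sideField_of_bary_eq_zero hK hc hx]
  calc _ = MvPolynomial.eval (fun a => bary K a x) (Z (K.erase c)) * T.normal (K.erase c) i *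
        ∑ j, T.normal (K.erase c) j * T.normal (K.erase c) j := by
        rw [Finset.mul_sum]; exact Finset.sum_congr rfl fun j _ => by ring
    _ = _ := by rw [hn, mul_one]

theorem div_localField (h : T.IsFieldData k Z D Q) {K : Finset (E (n + 1))}
    (hK : K ∈ T.elements) {c x : E (n + 1)} (hc : c ∈ K) (hx : bary K c x = 0) :
    ∑ i, (∑ j, polyEval (MvPolynomial.pderiv j (T.localField Z Q K i j)) x) *
        T.normal (K.erase c) i =
      MvPolynomial.eval (fun a => bary K a x) (D (K.erase c)) := by
  have h1 : ∀ i j, polyEval (MvPolynomial.pderiv j (T.localField Z Q K i j)) x =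
      polyEval (MvPolynomial.pderiv j (T.sideField Z K i j)) x +
      polyEval (MvPolynomial.pderiv j (edgeField K (Q K) i j)) x := fun i j => by
    simp only [localField, map_add, polyEval]
  have h2 : ∑ i, (∑ j, polyEval (MvPolynomial.pderiv j (T.localField Z Q K i j)) x) *
      baryGrad K c i = -(T.sideSign K (K.erase c) * ‖baryGrad K c‖) *
      MvPolynomial.eval (fun a => bary K a x) (D (K.erase c)) := by
    rw [← h.div_eq K hK c hc x hx, ← div_edgeField_mul_baryGrad (isSimplex hK) (h.symm K hK) hc hx,
      ← div_sideField_mul Z (isSimplex hK)]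
    simp only [h1, Finset.sum_add_distrib, add_mul]
    ring
  have hg : ‖baryGrad K c‖ ≠ 0 := norm_ne_zero_iff.2
    ((isSimplex hK).baryGrad_ne_zero (by omega) hc)
  have hs : T.sideSign K (K.erase c) * T.sideSign K (K.erase c) = 1 := by
    unfold sideSign
    split_ifs <;> norm_num
  rw [normal_eq_smul hK hc]
  simp only [PiLp.smul_apply, smul_eq_mul]
  calc _ = -(T.sideSign K (K.erase c) * ‖baryGrad K c‖⁻¹) *
        ∑ i, (∑ j, polyEval (MvPolynomial.pderiv j (T.localField Z Q K i j)) x) *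
          baryGrad K c i := by
        rw [Finset.mul_sum]; exact Finset.sum_congr rfl fun j _ => by ring
    _ = (T.sideSign K (K.erase c) * T.sideSign K (K.erase c)) *
        (‖baryGrad K c‖⁻¹ * ‖baryGrad K c‖) *
        MvPolynomial.eval (fun a => bary K a x) (D (K.erase c)) := by rw [h2]; ring
    _ = _ := by rw [hs, inv_mul_cancel₀ hg, one_mul, one_mul]

theorem bary_eq_zero_of_mem {K : Finset (E (n + 1))} (hK : K ∈ T.elements) {c x : E (n + 1)}
    (hc : c ∈ K) (hx : x ∈ hull (K.erase c)) : bary K c x = 0 :=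
  (((isSimplex hK).mem_hull_iff_of_subset (Finset.erase_subset c K)).1 hx).2 c hc
    (Finset.notMem_erase c K)

/-- On a side `F` the normal traces from the elements containing `F` coincide. -/
theorem normalTrace_localField_of_mem (h : T.IsFieldData k Z D Q) {F K : Finset (E (n + 1))}
    (hF : F ∈ T.sides) (hK : K ∈ T.elements) (hFK : F ⊆ K) {x : E (n + 1)} (hx : x ∈ hull F)
    (i : Fin (n + 1)) :
    ∑ j, polyEval (T.localField Z Q K i j) x * T.normal F j =
      MvPolynomial.eval (fun a => bary (T.plus F) a x) (Z F) * T.normal F i := by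
  have hloc := h.side_local F hF (fun a => bary K a x) (fun a => bary (T.plus F) a x)
    fun a ha => bary_eq_of_mem_side hK (T.plus_spec hF).1 hFK (T.plus_spec hF).2 hx ha
  obtain ⟨c, hc, rfl⟩ := T.exists_erase_eq hF hK hFK
  rw [h.normalTrace_localField hK hc (bary_eq_zero_of_mem hK hc hx), hloc]

theorem div_localField_of_mem (h : T.IsFieldData k Z D Q) {F K : Finset (E (n + 1))}
    (hF : F ∈ T.sides) (hK : K ∈ T.elements) (hFK : F ⊆ K) {x : E (n + 1)} (hx : x ∈ hull F) :
    ∑ i, (∑ j, polyEval (MvPolynomial.pderiv j (T.localField Z Q K i j)) x) * T.normal F i =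
      MvPolynomial.eval (fun a => bary (T.plus F) a x) (D F) := by
  have hloc := h.div_local F hF (fun a => bary K a x) (fun a => bary (T.plus F) a x)
    fun a ha => bary_eq_of_mem_side hK (T.plus_spec hF).1 hFK (T.plus_spec hF).2 hx ha
  obtain ⟨c, hc, rfl⟩ := T.exists_erase_eq hF hK hFK
  rw [h.div_localField hK hc (bary_eq_zero_of_mem hK hc hx), hloc]

theorem sideField_of_mem (h : T.IsFieldData k Z D Q) {F K : Finset (E (n + 1))}
    (hF : F ∈ T.sides) (hK : K ∈ T.elements) (hFK : F ⊆ K) {x : E (n + 1)} (hx : x ∈ hull F)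
    (i j : Fin (n + 1)) :
    polyEval (T.sideField Z K i j) x = T.normal F i * T.normal F j *
      MvPolynomial.eval (fun a => bary (T.plus F) a x) (Z F) := by
  have hloc := h.side_local F hF (fun a => bary K a x) (fun a => bary (T.plus F) a x)
    fun a ha => bary_eq_of_mem_side hK (T.plus_spec hF).1 hFK (T.plus_spec hF).2 hx ha
  obtain ⟨c, hc, rfl⟩ := T.exists_erase_eq hF hK hFK
  rw [h.polyEval_sideField_of_bary_eq_zero hK hc (bary_eq_zero_of_mem hK hc hx), hloc]

theorem localField_symm (K : Finset (E (n + 1))) (i j : Fin (n + 1)) :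
    T.localField Z Q K i j = T.localField Z Q K j i := by
  simp only [localField, sideField_symm Z K i j, edgeField_symm K (Q K) i j]

theorem mem_USpace (h : T.IsFieldData k Z D Q) (hopen : IsOpen Ω)
    (hreg : interior (closure Ω) = Ω) : T.glueMat (T.localField Z Q) ∈ T.USpace k := by
  have hd : 1 ≤ n + 1 := by omega
  refine ⟨⟨inL2Sym_glueMat localField_symm, fun i => T.glue fun K =>
    polyEval (∑ j, MvPolynomial.pderiv j (T.localField Z Q K i j)), fun i => ⟨T.inL2_glue
      fun K _ => continuous_polyEval _, fun φ hφ => ?_⟩⟩, T.glueMat (T.sideField Z),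
    T.glueMat (fun K => edgeField K (Q K)), Filter.Eventually.of_forall fun x => ?_,
    ⟨inL2Sym_glueMat (sideField_symm Z), fun i j l =>
      ⟨_, hasWeakPartial_glue hopen hreg (fun F hF x hx => ⟨_, fun K hK hFK =>
        h.sideField_of_mem hF hK hFK hx i j⟩) l⟩⟩, ?_, ?_, ?_⟩
  · refine T.integral_weak_div hopen hreg (X := fun K j => T.localField Z Q K i j) ?_
      (fun j => T.agrees_glue hd _) (T.agrees_glue hd _) hφ
    intro F hF hb x hx
    exact jump_eq_zero hd hopen hF hb fun K hK hFK =>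
      h.normalTrace_localField_of_mem hF hK hFK hx i
  · ext i j
    simp only [glueMat, glue, Matrix.add_apply, ← Finset.sum_add_distrib, localField]
    refine Finset.sum_congr rfl fun K _ => ?_
    by_cases hx : x ∈ openHull K <;> simp [hx, polyEval]
  · exact piecewisePolySym_glueMat hd (sideField_symm Z) fun K _ i j =>
      totalDegree_sideField_le h.degree_side K i j
  · refine piecewisePolySym_glueMat hd (fun K => edgeField_symm K (Q K)) fun K hK i j => ?_
    have h2 := h.degree_edge K hK
    refine (totalDegree_edgeField_le (m := k - 2) (fun a b => ?_) i j).trans ?_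
    · have := h2 a b; omega
    · have := h2 0 0; omega
  · intro K hK F hF hFK x hx
    rw [localMat_glueMat hd hK]
    obtain ⟨c, hc, rfl⟩ := T.exists_erase_eq hF hK hFK
    ext i
    exact normalTrace_edgeField hK hc (bary_eq_zero_of_mem hK hc hx) i

theorem mem_SigmaH (h : T.IsFieldData k Z D Q) (hopen : IsOpen Ω)
    (hreg : interior (closure Ω) = Ω) : T.glueMat (T.localField Z Q) ∈ T.SigmaH k := by
  classical
  have hd : 1 ≤ n + 1 := by omega
  have hdiv : ∀ F ∈ T.sides, ∀ x ∈ hull F, ∀ K ∈ T.elements, F ⊆ K →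
      divNormal (T.glueMat (T.localField Z Q)) (T.normal F) K x =
        MvPolynomial.eval (fun a => bary (T.plus F) a x) (D F) := by
    intro F hF x hx K hK hFK
    rw [divNormal, localMat_glueMat hd hK]
    exact h.div_localField_of_mem hF hK hFK hx
  refine ⟨h.mem_USpace hopen hreg, ?_, ?_⟩
  · intro F hF _ x hx
    have hp := T.plus_spec hF
    have h1 : normalTrace (localMat (T.glueMat (T.localField Z Q)) (T.plus F)) (T.normal F) x =
        MvPolynomial.eval (fun a => bary (T.plus F) a x) (Z F) • T.normal F := by
      ext i
      rw [localMat_glueMat hd hp.1]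
      exact h.normalTrace_localField_of_mem hF hp.1 hp.2 hx i
    rw [h1, tangentialPart, inner_smul_right, real_inner_self_eq_norm_sq,
      (T.normal_spec hd hF).1, one_pow, mul_one, sub_self]
  · intro F hF x hx
    by_cases hb : T.IsBoundary F
    · have h0 : ∀ K ∈ T.elements, F ⊆ K →
          divNormal (T.glueMat (T.localField Z Q)) (T.normal F) K x = 0 := by
        intro K hK hFK
        rw [hdiv F hF x hx K hK hFK, h.div_boundary F hF hb, map_zero]
      rw [jump, h0 _ (T.plus_spec hF).1 (T.plus_spec hF).2, zero_sub, neg_eq_zero]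
      refine Finset.sum_eq_zero fun K hK => ?_
      rw [Finset.mem_filter] at hK
      exact h0 K hK.1 hK.2.1
    · exact jump_eq_zero hd hopen hF hb fun K hK hFK => hdiv F hF x hx K hK hFK

end IsFieldData

end Triangulation

/-! ### Integration by parts for `divDiv` -/

theorem integrableOn_hull {d : ℕ} {K : Finset (E d)} {f : E d → ℝ} (hf : Continuous f) :
    IntegrableOn f (hull K) :=
  hf.continuousOn.integrableOn_compact (isCompact_hull K)

theorem pderiv_pderiv_comm {σ : Type*} (i j : σ) (p : MvPolynomial σ ℝ) :
    MvPolynomial.pderiv i (MvPolynomial.pderiv j p) =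
      MvPolynomial.pderiv j (MvPolynomial.pderiv i p) := by
  classical
  have h : ⁅(MvPolynomial.pderiv i : Derivation ℝ (MvPolynomial σ ℝ) (MvPolynomial σ ℝ)),
      (MvPolynomial.pderiv j : Derivation ℝ (MvPolynomial σ ℝ) (MvPolynomial σ ℝ))⁆ = 0 := by
    apply MvPolynomial.derivation_ext
    intro l
    simp only [Derivation.commutator_apply, MvPolynomial.pderiv_X, Pi.single_apply]
    split_ifs <;> simp
  have h2 := congrArg (fun D => D p) h
  simpa [Derivation.commutator_apply, sub_eq_zero] using h2

namespace Triangulation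

section Jump

variable {d : ℕ} {Ω : Set (E d)} {T : Triangulation Ω}

theorem jump_congr {F : Finset (E d)} (hF : F ∈ T.sides) {u w : Finset (E d) → E d → ℝ} {x : E d}
    (h : ∀ K ∈ T.elements, F ⊆ K → u K x = w K x) : T.jump u F x = T.jump w F x := by
  unfold jump
  rw [h _ (T.plus_spec hF).1 (T.plus_spec hF).2]
  congr 1
  refine Finset.sum_congr rfl fun K hK => ?_
  rw [Finset.mem_filter] at hK
  exact h K hK.1 hK.2.1

theorem jump_eq_mul {F : Finset (E d)} (hF : F ∈ T.sides) {u w : Finset (E d) → E d → ℝ}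
    {x : E d} {c : ℝ} (h : ∀ K ∈ T.elements, F ⊆ K → u K x = c * w K x) :
    T.jump u F x = c * T.jump w F x := by
  rw [jump_congr hF (w := fun K x => c * w K x) h]
  simp only [jump, mul_sub, Finset.mul_sum]

theorem continuous_jump {u : Finset (E d) → E d → ℝ} (hu : ∀ K, Continuous (u K))
    (F : Finset (E d)) : Continuous (T.jump u F) :=
  (hu _).sub (continuous_finsetSum _ fun K _ => hu K)

theorem jump_sum {ι : Type*} (s : Finset ι) (u : ι → Finset (E d) → E d → ℝ) (F : Finset (E d))
    (x : E d) : T.jump (fun K x => ∑ i ∈ s, u i K x) F x = ∑ i ∈ s, T.jump (u i) F x := by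
  simp only [jump]
  rw [Finset.sum_sub_distrib, Finset.sum_comm]

end Jump

variable {n : ℕ} {Ω : Set (E (n + 1))} {T : Triangulation Ω}

variable (T) in
theorem integral_side_add {F : Finset (E (n + 1))} (hF : F ∈ T.sides) {f g : E (n + 1) → ℝ}
    (hf : Continuous f) (hg : Continuous g) :
    ∫ x in hull F, (f x + g x) ∂(Measure.euclideanHausdorffMeasure n) =
      (∫ x in hull F, f x ∂(Measure.euclideanHausdorffMeasure n)) +
        ∫ x in hull F, g x ∂(Measure.euclideanHausdorffMeasure n) := by
  have h := T.integral_side_sum hF Finset.univ (f := fun b : Bool => if b then f else g)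
    (fun b _ => by cases b <;> simpa)
  simpa [Fintype.sum_bool] using h

/-- Integration by parts, twice on each element.  Only the jumps of `v` and of its normal
derivative remain, weighted with the degrees of freedom of the field on the sides. -/
theorem IsFieldData.integral_divDiv {k : ℕ}
    {Z D : Finset (E (n + 1)) → MvPolynomial (E (n + 1)) ℝ}
    {Q : Finset (E (n + 1)) → E (n + 1) → E (n + 1) → MvPolynomial (Fin (n + 1)) ℝ}
    (h : T.IsFieldData k Z D Q) (hreg : interior (closure Ω) = Ω) {v : E (n + 1) → ℝ}
    {V : Finset (E (n + 1)) → MvPolynomial (Fin (n + 1)) ℝ}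
    (hv : T.Agrees v fun K => polyEval (V K)) :
    ∫ x in Ω, T.glue (fun K => polyEval (∑ i, MvPolynomial.pderiv i
        (∑ j, MvPolynomial.pderiv j (T.localField Z Q K i j)))) x * v x =
      (∑ K ∈ T.elements, ∫ x in hull K, ∑ i, ∑ j, polyEval (T.localField Z Q K i j) x *
        polyEval (MvPolynomial.pderiv i (MvPolynomial.pderiv j (V K))) x) +
      ∑ F ∈ T.sides, ∫ x in hull F,
        (MvPolynomial.eval (fun a => bary (T.plus F) a x) (D F) *
          T.jump (fun K => polyEval (V K)) F x -
        MvPolynomial.eval (fun a => bary (T.plus F) a x) (Z F) *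
          T.jump (fun K x => ∑ i, polyEval (MvPolynomial.pderiv i (V K)) x * T.normal F i) F x)
          ∂(Measure.euclideanHausdorffMeasure n) := by
  have hd : 1 ≤ n + 1 := by omega
  set P := T.localField Z Q with hP
  set X : Finset (E (n + 1)) → Fin (n + 1) → MvPolynomial (Fin (n + 1)) ℝ := fun K i =>
    ∑ j, MvPolynomial.pderiv j (P K i j) with hX
  have hc : ∀ p : MvPolynomial (Fin (n + 1)) ℝ, Continuous (fun x : E (n + 1) => polyEval p x) :=
    continuous_polyEval
  have e1 := T.sum_integral_parts X (ψ := fun K => polyEval (V K)) fun K => contDiff_polyEval _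
  have e2 := fun i => T.sum_integral_parts (fun K j => P K i j)
    (ψ := fun K => polyEval (MvPolynomial.pderiv i (V K))) fun K => contDiff_polyEval _
  have hpd : ∀ (i : Fin (n + 1)) (p : MvPolynomial (Fin (n + 1)) ℝ) (x : E (n + 1)),
    partialDeriv i (polyEval p) x = polyEval (MvPolynomial.pderiv i p) x := partialDeriv_polyEval
  simp only [hpd] at e1 e2
  -- the sum of the second integrations by parts over the rows
  have e3 := Finset.sum_congr (rfl : (Finset.univ : Finset (Fin (n + 1))) = Finset.univ)
    fun i _ => e2 i
  rw [Finset.sum_add_distrib, Finset.sum_neg_distrib, Finset.sum_comm,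
    Finset.sum_comm (s := Finset.univ) (t := T.elements),
    Finset.sum_comm (s := Finset.univ) (t := T.sides)] at e3
  have hjc : ∀ (F : Finset (E (n + 1))) (i : Fin (n + 1)), Continuous (T.jump (fun K x =>
      (∑ j, polyEval (P K i j) x * T.normal F j) *
        polyEval (MvPolynomial.pderiv i (V K)) x) F) := fun F i =>
    continuous_jump (fun K => (continuous_finsetSum _ fun j _ => (hc _).mul
      continuous_const).mul (hc _)) F
  have e4 : ∀ K ∈ T.elements, ∑ i, ∫ x in hull K, ∑ j, polyEval (P K i j) x *
      polyEval (MvPolynomial.pderiv j (MvPolynomial.pderiv i (V K))) x =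
      ∫ x in hull K, ∑ i, ∑ j, polyEval (P K i j) x *
        polyEval (MvPolynomial.pderiv i (MvPolynomial.pderiv j (V K))) x := by
    intro K _
    rw [← integral_finsetSum]
    · refine integral_congr_ae (Filter.Eventually.of_forall fun x => ?_)
      refine Finset.sum_congr rfl fun i _ => Finset.sum_congr rfl fun j _ => ?_
      rw [pderiv_pderiv_comm]
    · exact fun i _ => integrableOn_hull
        (continuous_finsetSum _ fun j _ => (hc _).mul (hc _))
  have e5 : ∀ K ∈ T.elements, ∑ i, ∫ x in hull K,
      polyEval (∑ j, MvPolynomial.pderiv j (P K i j)) x *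
        polyEval (MvPolynomial.pderiv i (V K)) x =
      ∫ x in hull K, ∑ i, polyEval (X K i) x * polyEval (MvPolynomial.pderiv i (V K)) x := by
    intro K _
    rw [← integral_finsetSum]
    exact fun i _ => integrableOn_hull ((hc _).mul (hc _))
  have e6 : ∀ F ∈ T.sides, ∑ i, ∫ x in hull F, T.jump (fun K x =>
      (∑ j, polyEval (P K i j) x * T.normal F j) *
        polyEval (MvPolynomial.pderiv i (V K)) x) F x ∂(Measure.euclideanHausdorffMeasure n) =
      ∫ x in hull F, MvPolynomial.eval (fun a => bary (T.plus F) a x) (Z F) *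
          T.jump (fun K x => ∑ i, polyEval (MvPolynomial.pderiv i (V K)) x * T.normal F i) F x
          ∂(Measure.euclideanHausdorffMeasure n) := by
    intro F hF
    rw [← T.integral_side_sum hF _ fun i _ => hjc F i]
    refine setIntegral_congr_fun (measurableSet_hull F) fun x hx => ?_
    beta_reduce
    rw [← jump_sum]
    refine jump_eq_mul hF fun K hK hFK => ?_
    rw [Finset.mul_sum]
    refine Finset.sum_congr rfl fun i _ => ?_
    rw [h.normalTrace_localField_of_mem hF hK hFK hx]
    ring
  have e7 : ∀ F ∈ T.sides, ∫ x in hull F, T.jump (fun K x =>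
      (∑ i, polyEval (X K i) x * T.normal F i) * polyEval (V K) x) F x
        ∂(Measure.euclideanHausdorffMeasure n) =
      ∫ x in hull F, MvPolynomial.eval (fun a => bary (T.plus F) a x) (D F) *
          T.jump (fun K => polyEval (V K)) F x ∂(Measure.euclideanHausdorffMeasure n) := by
    intro F hF
    refine setIntegral_congr_fun (measurableSet_hull F) fun x hx => ?_
    beta_reduce
    refine jump_eq_mul hF fun K hK hFK => ?_
    have h1 := h.div_localField_of_mem hF hK hFK hx
    simp only [hX, polyEval_sum]
    rw [h1]
  rw [Finset.sum_congr rfl e4, Finset.sum_congr rfl e5, Finset.sum_congr rfl e6] at e3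
  rw [Finset.sum_congr rfl e7] at e1
  rw [(T.agrees_glue hd _).integral_mul (fun K _ => hc _) hv (fun K _ => hc _) hd hreg]
  have hec : ∀ (F : Finset (E (n + 1))) (W : MvPolynomial (E (n + 1)) ℝ),
      Continuous (fun x => MvPolynomial.eval (fun a => bary (T.plus F) a x) W) := by
    intro F W
    simp only [← polyEval_onElement]
    exact hc _
  have e8 : ∀ F ∈ T.sides, ∫ x in hull F,
        (MvPolynomial.eval (fun a => bary (T.plus F) a x) (D F) *
          T.jump (fun K => polyEval (V K)) F x -
        MvPolynomial.eval (fun a => bary (T.plus F) a x) (Z F) *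
          T.jump (fun K x => ∑ i, polyEval (MvPolynomial.pderiv i (V K)) x * T.normal F i) F x)
          ∂(Measure.euclideanHausdorffMeasure n) =
      (∫ x in hull F, MvPolynomial.eval (fun a => bary (T.plus F) a x) (D F) *
          T.jump (fun K => polyEval (V K)) F x ∂(Measure.euclideanHausdorffMeasure n)) -
      ∫ x in hull F, MvPolynomial.eval (fun a => bary (T.plus F) a x) (Z F) *
          T.jump (fun K x => ∑ i, polyEval (MvPolynomial.pderiv i (V K)) x * T.normal F i) F x
          ∂(Measure.euclideanHausdorffMeasure n) := by
    intro F hF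
    simp only [sub_eq_add_neg, ← integral_neg]
    exact T.integral_side_add hF
      (f := fun x => MvPolynomial.eval (fun a => bary (T.plus F) a x) (D F) *
        T.jump (fun K => polyEval (V K)) F x)
      (g := fun x => -(MvPolynomial.eval (fun a => bary (T.plus F) a x) (Z F) *
        T.jump (fun K x => ∑ i, polyEval (MvPolynomial.pderiv i (V K)) x * T.normal F i) F x))
      ((hec F _).mul (continuous_jump (fun K => hc _) F))
      ((hec F _).mul (continuous_jump (fun K => continuous_finsetSum _ fun i _ =>
        (hc _).mul continuous_const) F)).neg
  rw [Finset.sum_congr rfl e8, Finset.sum_sub_distrib]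
  simp only [hX] at e1 e3
  linarith

end Triangulation

/-! ### Scaling -/

theorem eq_zero_pderiv_of_totalDegree {σ : Type*} {p : MvPolynomial σ ℝ} (hp : p.totalDegree ≤ 0)
    (i : σ) : MvPolynomial.pderiv i p = 0 := by
  rw [MvPolynomial.totalDegree_eq_zero_iff_eq_C.1 (Nat.le_zero.1 hp), MvPolynomial.pderiv_C]

theorem totalDegree_pderiv_le {σ : Type*} {p : MvPolynomial σ ℝ} {m : ℕ}
    (hp : p.totalDegree ≤ m + 1) (i : σ) : (MvPolynomial.pderiv i p).totalDegree ≤ m := by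
  rw [p.as_sum, map_sum]
  refine MvPolynomial.totalDegree_finsetSum_le fun s hs => ?_
  rw [MvPolynomial.pderiv_monomial]
  by_cases h : s i = 0
  · simp [h]
  · refine (MvPolynomial.totalDegree_monomial_le _ _).trans ?_
    have h1 : (s - Finsupp.single i 1 : σ →₀ ℕ).degree + 1 = s.degree := by
      conv_rhs => rw [← tsub_add_cancel_of_le (Finsupp.single_le_iff.2
        (Nat.one_le_iff_ne_zero.2 h))]
      rw [map_add, Finsupp.degree_single]
    have h2 : s.degree ≤ p.totalDegree := MvPolynomial.le_totalDegree hs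
    change (s - Finsupp.single i 1 : σ →₀ ℕ).degree ≤ m
    omega

theorem refInt_congr {n : ℕ} {G G' : (Fin (n + 1) → ℝ) → ℝ}
    (h : ∀ l : Fin (n + 1) → ℝ, ∑ i, l i = 1 → G l = G' l) : refInt n G = refInt n G' := by
  unfold refInt
  congr 1
  funext y
  exact h _ (sum_refBary y)

theorem refInt_const_mul {n : ℕ} (c : ℝ) (G : (Fin (n + 1) → ℝ) → ℝ) :
    refInt n (fun l => c * G l) = c * refInt n G :=
  integral_const_mul _ _

/-- The norm equivalences on the reference simplex in the form in which they are used: weights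
given by products of barycentric coordinates do not matter. -/
theorem exists_refInt_bounds (n m : ℕ) : ∃ C : ℝ, 0 < C ∧
    ∀ W : MvPolynomial (Fin (n + 1)) ℝ, W.IsHomogeneous m →
      coeffNorm W ^ 2 ≤ C * refInt n (fun l => MvPolynomial.eval l W ^ 2) ∧
      refInt n (fun l => MvPolynomial.eval l W ^ 2) ≤
        C * refInt n (fun l => (∏ i, l i) ^ 2 * MvPolynomial.eval l W ^ 2) := by
  obtain ⟨C, hC, h⟩ := exists_coeffNorm_sq_le n m
  have hR := refInt_one_pos n
  refine ⟨C + C * refInt n (fun _ => 1), by positivity, fun W hW => ?_⟩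
  have hcW := continuous_eval W
  have hc1 : Continuous fun l : Fin (n + 1) → ℝ => MvPolynomial.eval l W ^ 2 := hcW.pow 2
  have hc2 : Continuous fun l : Fin (n + 1) → ℝ =>
      (∏ i, l i) ^ 2 * MvPolynomial.eval l W ^ 2 := by fun_prop
  have h1 : refInt n (fun l => (∏ i, l i) ^ 2 * MvPolynomial.eval l W ^ 2) ≤
      refInt n (fun l => MvPolynomial.eval l W ^ 2) := by
    refine refInt_mono hc2 hc1 fun l h0 h1 _ => ?_
    refine mul_le_of_le_one_left (sq_nonneg _) ?_
    exact pow_le_one₀ (Finset.prod_nonneg fun i _ => h0 i)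
      (Finset.prod_le_one (fun i _ => h0 i) fun i _ => h1 i)
  have h2 : refInt n (fun l => MvPolynomial.eval l W ^ 2) ≤
      coeffNorm W ^ 2 * refInt n (fun _ => 1) := by
    rw [← refInt_const_mul]
    refine refInt_mono hc1 (by fun_prop) fun l h0 h1 _ => ?_
    rw [mul_one, ← sq_abs]
    refine pow_le_pow_left₀ (abs_nonneg _) (abs_eval_le (fun i => ?_) W) 2
    rw [abs_of_nonneg (h0 i)]
    exact h1 i
  have h3 : 0 ≤ refInt n (fun l => (∏ i, l i) ^ 2 * MvPolynomial.eval l W ^ 2) := by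
    refine integral_nonneg fun y => ?_
    positivity
  have h4 := h W hW
  constructor
  · nlinarith [mul_pos hC hR]
  · nlinarith [mul_le_mul_of_nonneg_right h4 hR.le]

namespace Triangulation

variable {n : ℕ} {Ω : Set (E (n + 1))} {T : Triangulation Ω}

theorem diam_hull_pos {K : Finset (E (n + 1))} (hK : K ∈ T.elements) :
    0 < Metric.diam (hull K) := by
  obtain ⟨a, ha⟩ := (isSimplex hK).nonempty
  obtain ⟨b, hb, hba⟩ := (isSimplex hK).exists_ne (by omega) a
  exact (norm_pos_iff.2 (sub_ne_zero.2 hba)).trans_le (dist_le_diam_hull hb ha)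

theorem ShapeRegular.pos {γ : ℝ} (hT : T.ShapeRegular γ) {K : Finset (E (n + 1))}
    (hK : K ∈ T.elements) : 0 < γ := by
  obtain ⟨x, r, hr, -, h⟩ := hT K hK
  have h1 := (diam_hull_pos hK).trans_le h
  by_contra hγ
  nlinarith

theorem ShapeRegular.norm_baryGrad_le {γ : ℝ} (hT : T.ShapeRegular γ) {K : Finset (E (n + 1))}
    (hK : K ∈ T.elements) (a : E (n + 1)) :
    ‖baryGrad K a‖ * Metric.diam (hull K) ≤ γ := by
  have hγ := hT.pos hK
  obtain ⟨x, r, hr, hball, h⟩ := hT K hK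
  have h1 := (isSimplex hK).norm_baryGrad_le hr hball a
  calc _ ≤ ‖baryGrad K a‖ * (γ * (2 * r)) := mul_le_mul_of_nonneg_left h (norm_nonneg _)
    _ = γ * (2 * r * ‖baryGrad K a‖) := by ring
    _ ≤ γ := mul_le_of_le_one_right hγ.le h1

theorem one_le_norm_baryGrad_mul {K : Finset (E (n + 1))} (hK : K ∈ T.elements) {a b : E (n + 1)}
    (ha : a ∈ K) (hb : b ∈ K) (hab : a ≠ b) : 1 ≤ ‖baryGrad K a‖ * ‖a - b‖ := by
  have h := (isSimplex hK).inner_baryGrad_sub ha ha hb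
  rw [if_pos rfl, if_neg hab, sub_zero] at h
  rw [← h]
  exact real_inner_le_norm _ _

theorem one_le_norm_baryGrad_mul_diam {K : Finset (E (n + 1))} (hK : K ∈ T.elements)
    {a : E (n + 1)} (ha : a ∈ K) : 1 ≤ ‖baryGrad K a‖ * Metric.diam (hull K) := by
  obtain ⟨b, hb, hba⟩ := (isSimplex hK).exists_ne (by omega) a
  exact (one_le_norm_baryGrad_mul hK ha hb hba.symm).trans
    (mul_le_mul_of_nonneg_left (dist_le_diam_hull ha hb) (norm_nonneg _))

theorem exists_ne_mem_side (hn : 1 ≤ n) {F : Finset (E (n + 1))} (hF : F ∈ T.sides) :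
    ∃ a ∈ F, ∃ b ∈ F, a ≠ b :=
  Finset.one_lt_card.1 (by rw [(T.mem_sides.1 hF).2]; omega)

theorem sideDiam_pos (hn : 1 ≤ n) {F : Finset (E (n + 1))} (hF : F ∈ T.sides) :
    0 < sideDiam F := by
  obtain ⟨a, ha, b, hb, hab⟩ := exists_ne_mem_side hn hF
  exact (norm_pos_iff.2 (sub_ne_zero.2 hab)).trans_le (dist_le_diam_hull ha hb)

/-- Shape regularity: the diameter of an element is controlled by the diameters of its sides. -/
theorem ShapeRegular.diam_le (hn : 1 ≤ n) {γ : ℝ} (hT : T.ShapeRegular γ)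
    {F K : Finset (E (n + 1))} (hF : F ∈ T.sides) (hK : K ∈ T.elements) (hFK : F ⊆ K) :
    Metric.diam (hull K) ≤ γ * sideDiam F := by
  obtain ⟨a, ha, b, hb, hab⟩ := exists_ne_mem_side hn hF
  have h1 := one_le_norm_baryGrad_mul hK (hFK ha) (hFK hb) hab
  have h2 := hT.norm_baryGrad_le hK a
  have h3 : ‖a - b‖ ≤ sideDiam F := dist_le_diam_hull ha hb
  have h4 := diam_hull_pos hK
  calc Metric.diam (hull K) ≤ Metric.diam (hull K) * (‖baryGrad K a‖ * ‖a - b‖) :=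
        le_mul_of_one_le_right h4.le h1
    _ = (‖baryGrad K a‖ * Metric.diam (hull K)) * ‖a - b‖ := by ring
    _ ≤ γ * sideDiam F := mul_le_mul h2 h3 (norm_nonneg _) (hT.pos hK).le

theorem card_elements_filter_le {F : Finset (E (n + 1))} (hF : F ∈ T.sides) :
    (T.elements.filter (fun K => F ⊆ K)).card ≤ 2 := by
  have h : T.elements.filter (fun K => F ⊆ K) ⊆ insert (T.plus F)
      ((T.elements.filter (fun K => F ⊆ K)).erase (T.plus F)) := fun K hK => by
    by_cases hp : K = T.plus F
    · simp [hp]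
    · exact Finset.mem_insert_of_mem (Finset.mem_erase.2 ⟨hp, hK⟩)
  refine (Finset.card_le_card h).trans ((Finset.card_insert_le _ _).trans ?_)
  have h2 : ((T.elements.filter (fun K => F ⊆ K)).erase (T.plus F)).card ≤ 1 := by
    rw [Finset.card_le_one]
    intro K hK K' hK'
    simp only [Finset.mem_erase, Finset.mem_filter] at hK hK'
    exact T.eq_of_ne_plus (by omega) hF hK.2.1 hK.2.2 hK.1 hK'.2.1 hK'.2.2 hK'.1
  omega

open scoped Classical in
theorem card_sides_filter_le {K : Finset (E (n + 1))} (hK : K ∈ T.elements) :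
    (T.sides.filter (fun F => F ⊆ K)).card ≤ n + 2 := by
  have h : T.sides.filter (fun F => F ⊆ K) ⊆ K.image (fun a => K.erase a) := by
    intro F hF
    rw [Finset.mem_filter] at hF
    obtain ⟨a, ha, rfl⟩ := T.exists_erase_eq hF.1 hK hF.2
    exact Finset.mem_image_of_mem _ ha
  refine (Finset.card_le_card h).trans (Finset.card_image_le.trans ?_)
  rw [(T.mem_elements.1 hK).2]

open scoped Classical in
/-- Every side belongs to at most two elements. -/
theorem sum_elements_sum_sides_le {M : Finset (E (n + 1)) → ℝ} (hM : ∀ F ∈ T.sides, 0 ≤ M F) :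
    ∑ K ∈ T.elements, ∑ F ∈ T.sides with F ⊆ K, M F ≤ 2 * ∑ F ∈ T.sides, M F := by
  simp only [Finset.sum_filter]
  rw [Finset.sum_comm, Finset.mul_sum]
  refine Finset.sum_le_sum fun F hF => ?_
  rw [← Finset.sum_filter, Finset.sum_const, nsmul_eq_mul]
  refine mul_le_mul_of_nonneg_right ?_ (hM F hF)
  have := card_elements_filter_le hF
  convert (Nat.cast_le (α := ℝ)).2 this using 1
  norm_num

/-! ### Polynomials on the sides representing jumps -/

theorem refInt_side {K : Finset (E (n + 1))} (hK : K ∈ T.elements) {c : E (n + 1)} (hc : c ∈ K)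
    {p : Fin (n + 1) → E (n + 1)} (hp : Function.Injective p)
    (hr : range p = (K.erase c : Finset (E (n + 1)))) {J : E (n + 1) → ℝ}
    {G : (Fin (n + 1) → ℝ) → ℝ} (h : ∀ l : Fin (n + 1) → ℝ, ∑ i, l i = 1 →
      J (∑ i, l i • p i) = G l) :
    ∫ x in hull (K.erase c), J x ∂(Measure.euclideanHausdorffMeasure n) =
      simplexDensity (hull K) * ‖baryGrad K c‖ * refInt n G := by
  rw [(isSimplex hK).integral_erase hc hp hr, refInt_congr h]

theorem sum_enum {ι : Type*} [Fintype ι] {F : Finset (E (n + 1))} {p : ι → E (n + 1)}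
    (hp : Function.Injective p) (hr : range p = F) {M : Type*} [AddCommMonoid M]
    (f : E (n + 1) → M) : ∑ i, f (p i) = ∑ a ∈ F, f a := by
  classical
  have h1 : F = Finset.univ.image p := by
    apply Finset.coe_injective
    rw [← hr, Finset.coe_image, Finset.coe_univ, image_univ]
  rw [h1, Finset.sum_image fun i _ j _ h => hp h]

theorem prod_enum {ι : Type*} [Fintype ι] {F : Finset (E (n + 1))} {p : ι → E (n + 1)}
    (hp : Function.Injective p) (hr : range p = F) {M : Type*} [CommMonoid M]
    (f : E (n + 1) → M) : ∏ i, f (p i) = ∏ a ∈ F, f a := by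
  classical
  have h1 : F = Finset.univ.image p := by
    apply Finset.coe_injective
    rw [← hr, Finset.coe_image, Finset.coe_univ, image_univ]
  rw [h1, Finset.prod_image fun i _ j _ h => hp h]

theorem bary_enum {ι : Type*} [Fintype ι] {F K : Finset (E (n + 1))} (hK : K ∈ T.elements)
    (hFK : F ⊆ K) {p : ι → E (n + 1)} (hp : Function.Injective p) (hr : range p = F) {l : ι → ℝ}
    (hl : ∑ i, l i = 1) (i : ι) : bary K (p i) (∑ j, l j • p j) = l i := by
  have hm : ∀ j, p j ∈ F := fun j => by
    rw [← Finset.mem_coe, ← hr]; exact mem_range_self j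
  have h1 : ∑ j, l j • p j = ∑ b ∈ F, (Function.extend p l 0) b • b := by
    rw [← sum_enum hp hr]
    exact Finset.sum_congr rfl fun j _ => by rw [hp.extend_apply]
  have h2 : ∑ b ∈ F, (Function.extend p l 0) b = 1 := by
    rw [← sum_enum hp hr (Function.extend p l 0), ← hl]
    exact Finset.sum_congr rfl fun j _ => by rw [hp.extend_apply]
  rw [h1, (isSimplex hK).bary_combination_mem (hFK (hm i)) hFK h2, if_pos (hm i),
    hp.extend_apply]

/-- A polynomial `q` of degree at most `m` on a side `F`, written as a homogeneous polynomial of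
degree `m` in the barycentric coordinates of `F`, together with the scaled norm equivalences. -/
theorem exists_sidePoly (n m : ℕ) : ∃ C : ℝ, 0 < C ∧
    ∀ {Ω : Set (E (n + 1))} {T : Triangulation Ω} {F : Finset (E (n + 1))}, F ∈ T.sides →
    ∀ {q : MvPolynomial (Fin (n + 1)) ℝ}, q.totalDegree ≤ m →
    ∃ W : MvPolynomial (E (n + 1)) ℝ, W.IsHomogeneous m ∧ W ∈ MvPolynomial.supported ℝ (F : Set _) ∧
      (∀ K ∈ T.elements, F ⊆ K → ∀ x ∈ hull F,
        MvPolynomial.eval (fun a => bary K a x) W = polyEval q x) ∧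
      (∀ K ∈ T.elements, F ⊆ K → volume.real (hull K) * coeffNorm W ^ 2 ≤
        C * Metric.diam (hull K) * sideNormSq F (polyEval q)) ∧
      sideNormSq F (polyEval q) ≤ C * ∫ x in hull F, (∏ a ∈ F, bary (T.plus F) a x) *
        polyEval q x ^ 2 ∂(Measure.euclideanHausdorffMeasure n) := by
  obtain ⟨C, hC, hbd⟩ := exists_refInt_bounds n m
  have hR := refInt_one_pos (n + 1)
  refine ⟨C + C * refInt (n + 1) (fun _ => 1), by positivity, ?_⟩
  intro Ω T F hF q hq
  obtain ⟨p, hp, hr⟩ := T.exists_side_enum hF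
  obtain ⟨W, hW, hWq⟩ := exists_homogeneous p hq
  obtain ⟨h1, h2⟩ := hbd W hW
  have hint0 : 0 ≤ refInt n (fun l => MvPolynomial.eval l W ^ 2) :=
    integral_nonneg fun y => sq_nonneg _
  refine ⟨MvPolynomial.rename p W, hW.rename_isHomogeneous, ?_, ?_, ?_, ?_⟩
  · rw [MvPolynomial.supported_eq_range_rename, ← hr]
    refine ⟨MvPolynomial.rename (fun i => ⟨p i, mem_range_self i⟩) W, ?_⟩
    exact MvPolynomial.rename_rename _ _ W
  · intro K hK hFK x hx
    obtain ⟨c, hc, rfl⟩ := T.exists_erase_eq hF hK hFK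
    have hx0 := IsFieldData.bary_eq_zero_of_mem hK hc hx
    rw [MvPolynomial.eval_rename]
    have hs : ∑ i, bary K (p i) x = 1 := by
      rw [sum_enum hp hr (fun a => bary K a x), ← (isSimplex hK).sum_bary x, ← Finset.add_sum_erase K _ hc, hx0,
        zero_add]
    have hxs : ∑ i, bary K (p i) x • p i = x := by
      rw [sum_enum hp hr (fun a => bary K a x • a)]
      conv_rhs => rw [← (isSimplex hK).sum_bary_smul x, ← Finset.add_sum_erase K _ hc, hx0,
        zero_smul, zero_add]
    have h3 := hWq _ hs
    rw [hxs] at h3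
    exact h3.symm
  · intro K hK hFK
    obtain ⟨c, hc, rfl⟩ := T.exists_erase_eq hF hK hFK
    have hdens := (isSimplex hK).simplexDensity_pos
    have h3 : sideNormSq (K.erase c) (polyEval q) = simplexDensity (hull K) * ‖baryGrad K c‖ *
        refInt n (fun l => MvPolynomial.eval l W ^ 2) :=
      refInt_side hK hc hp hr fun l hl => by rw [hWq l hl]
    have h4 : volume.real (hull K) = simplexDensity (hull K) * refInt (n + 1) (fun _ => 1) := by
      rw [simplexDensity, div_mul_cancel₀ _ hR.ne']
    have h5 := one_le_norm_baryGrad_mul_diam hK hc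
    have h6 : coeffNorm (MvPolynomial.rename p W) ^ 2 ≤
        C * refInt n (fun l => MvPolynomial.eval l W ^ 2) :=
      (pow_le_pow_left₀ (coeffNorm_nonneg _) (coeffNorm_rename_le p W) 2).trans h1
    set S := refInt n (fun l => MvPolynomial.eval l W ^ 2)
    set R := refInt (n + 1) (fun _ => 1)
    set δ := simplexDensity (hull K)
    rw [h3, h4]
    calc δ * R * coeffNorm (MvPolynomial.rename p W) ^ 2 ≤ δ * R * (C * S) :=
          mul_le_mul_of_nonneg_left h6 (by positivity)
      _ ≤ δ * R * (C * S) * (‖baryGrad K c‖ * Metric.diam (hull K)) :=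
          le_mul_of_one_le_right (by positivity) h5
      _ ≤ (C * R * Metric.diam (hull K)) * (δ * ‖baryGrad K c‖ * S) := le_of_eq (by ring)
      _ ≤ _ := by
          refine mul_le_mul_of_nonneg_right ?_ (by positivity)
          refine mul_le_mul_of_nonneg_right ?_ Metric.diam_nonneg
          linarith
  · obtain ⟨hP, hFP⟩ := T.plus_spec hF
    set K := T.plus F with hKdef
    obtain ⟨c, hc, hFc⟩ := T.exists_erase_eq hF hP hFP
    have hdens := (isSimplex hP).simplexDensity_pos
    rw [hFc] at hr ⊢
    have h3 : sideNormSq (K.erase c) (polyEval q) = simplexDensity (hull K) * ‖baryGrad K c‖ *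
        refInt n (fun l => MvPolynomial.eval l W ^ 2) :=
      refInt_side hP hc hp hr fun l hl => by rw [hWq l hl]
    have h4 : ∫ x in hull (K.erase c), (∏ a ∈ K.erase c, bary K a x) * polyEval q x ^ 2
        ∂(Measure.euclideanHausdorffMeasure n) = simplexDensity (hull K) * ‖baryGrad K c‖ *
        refInt n (fun l => (∏ i, l i) * MvPolynomial.eval l W ^ 2) := by
      refine refInt_side hP hc hp hr fun l hl => ?_
      rw [hWq l hl, ← prod_enum hp hr]
      congr 1
      exact Finset.prod_congr rfl fun i _ => bary_enum hP (Finset.erase_subset _ _) hp hr hl i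
    have hcW := continuous_eval W
    have h5 : refInt n (fun l => (∏ i, l i) ^ 2 * MvPolynomial.eval l W ^ 2) ≤
        refInt n (fun l => (∏ i, l i) * MvPolynomial.eval l W ^ 2) := by
      refine refInt_mono (by fun_prop) (by fun_prop) fun l h0 h1 _ => ?_
      refine mul_le_mul_of_nonneg_right ?_ (sq_nonneg _)
      exact pow_le_of_le_one (Finset.prod_nonneg fun i _ => h0 i)
        (Finset.prod_le_one (fun i _ => h0 i) fun i _ => h1 i) two_ne_zero
    rw [h3, h4]
    set S' := refInt n (fun l => (∏ i, l i) * MvPolynomial.eval l W ^ 2)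
    have h6 : refInt n (fun l => MvPolynomial.eval l W ^ 2) ≤ C * S' :=
      h2.trans (mul_le_mul_of_nonneg_left h5 hC.le)
    have h7 : 0 ≤ S' := nonneg_of_mul_nonneg_right (hint0.trans h6) hC
    calc _ ≤ simplexDensity (hull K) * ‖baryGrad K c‖ * (C * S') :=
          mul_le_mul_of_nonneg_left h6 (by positivity)
      _ = C * (simplexDensity (hull K) * ‖baryGrad K c‖ * S') := by ring
      _ ≤ _ := by
          refine mul_le_mul_of_nonneg_right ?_ (by positivity)
          have : 0 < C * refInt (n + 1) (fun _ => 1) := by positivity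
          linarith

end Triangulation

/-! ### The edge field testing the elementwise Hessian -/

section Hessian

variable {d : ℕ} {K : Finset (E d)}

/-- The second derivative of the polynomial `V` in the direction of the edge from `a` to `b`. -/
noncomputable def edgeHess (V : MvPolynomial (Fin d) ℝ) (a b : E d) : MvPolynomial (Fin d) ℝ :=
  ∑ i, ∑ j, MvPolynomial.C ((b - a) i * (b - a) j) *
    MvPolynomial.pderiv i (MvPolynomial.pderiv j V)

theorem polyEval_edgeHess (V : MvPolynomial (Fin d) ℝ) (a b x : E d) :
    polyEval (edgeHess V a b) x = ∑ i, ∑ j, (b - a) i * (b - a) j *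
      polyEval (MvPolynomial.pderiv i (MvPolynomial.pderiv j V)) x := by
  simp only [edgeHess, polyEval_sum, polyEval_C_mul]

theorem edgeHess_symm (V : MvPolynomial (Fin d) ℝ) (a b : E d) :
    edgeHess V a b = edgeHess V b a := by
  unfold edgeHess
  refine Finset.sum_congr rfl fun i _ => Finset.sum_congr rfl fun j _ => ?_
  rw [← neg_sub a b]
  simp only [PiLp.neg_apply, neg_mul_neg]

theorem edgeHess_self (V : MvPolynomial (Fin d) ℝ) (a : E d) : edgeHess V a a = 0 := by
  simp [edgeHess]

theorem totalDegree_edgeHess_le {V : MvPolynomial (Fin d) ℝ} {m : ℕ} (hV : V.totalDegree ≤ m + 1)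
    (a b : E d) : (edgeHess V a b).totalDegree ≤ m := by
  refine MvPolynomial.totalDegree_finsetSum_le fun i _ =>
    MvPolynomial.totalDegree_finsetSum_le fun j _ => ?_
  refine (MvPolynomial.totalDegree_mul _ _).trans ?_
  rw [MvPolynomial.totalDegree_C, zero_add]
  exact totalDegree_pderiv_le ((totalDegree_pderiv_le hV j).trans (Nat.le_succ m)) i

/-- The edge polynomials `s λₐ λ_b ∂²V/∂(b-a)²`. -/
noncomputable def hessEdgePoly (K : Finset (E d)) (V : MvPolynomial (Fin d) ℝ) (s : ℝ) (a b : E d) :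
    MvPolynomial (Fin d) ℝ :=
  MvPolynomial.C s * (baryPoly K a * baryPoly K b * edgeHess V a b)

theorem hessEdgePoly_symm (K : Finset (E d)) (V : MvPolynomial (Fin d) ℝ) (s : ℝ) (a b : E d) :
    hessEdgePoly K V s a b = hessEdgePoly K V s b a := by
  rw [hessEdgePoly, hessEdgePoly, edgeHess_symm, mul_comm (baryPoly K a)]

theorem totalDegree_hessEdgePoly_le {V : MvPolynomial (Fin d) ℝ} {m : ℕ}
    (hV : V.totalDegree ≤ m + 1) (s : ℝ) (a b : E d) :
    (hessEdgePoly K V s a b).totalDegree ≤ m + 1 := by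
  rcases m with _ | m
  · have h : edgeHess V a b = 0 := by
      unfold edgeHess
      refine Finset.sum_eq_zero fun i _ => Finset.sum_eq_zero fun j _ => ?_
      rw [eq_zero_pderiv_of_totalDegree (totalDegree_pderiv_le hV j), mul_zero]
    simp [hessEdgePoly, h]
  · have h : (edgeHess V a b).totalDegree ≤ m := by
      refine MvPolynomial.totalDegree_finsetSum_le fun i _ =>
        MvPolynomial.totalDegree_finsetSum_le fun j _ => ?_
      refine (MvPolynomial.totalDegree_mul _ _).trans ?_
      rw [MvPolynomial.totalDegree_C, zero_add]
      exact totalDegree_pderiv_le (totalDegree_pderiv_le hV j) i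
    refine (MvPolynomial.totalDegree_mul _ _).trans ?_
    rw [MvPolynomial.totalDegree_C, zero_add]
    refine (MvPolynomial.totalDegree_mul _ _).trans ?_
    have h1 := MvPolynomial.totalDegree_mul (baryPoly K a) (baryPoly K b)
    have := totalDegree_baryPoly_le K a
    have := totalDegree_baryPoly_le K b
    omega

theorem sum_edgeField_mul_hess (Q : E d → E d → MvPolynomial (Fin d) ℝ)
    (V : MvPolynomial (Fin d) ℝ) (x : E d) :
    ∑ i, ∑ j, polyEval (edgeField K Q i j) x *
      polyEval (MvPolynomial.pderiv i (MvPolynomial.pderiv j V)) x =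
    ∑ a ∈ K, ∑ b ∈ K, bary K a x * bary K b x * polyEval (Q a b) x *
      polyEval (edgeHess V a b) x := by
  simp only [polyEval_edgeField, polyEval_edgeHess, Finset.sum_mul, Finset.mul_sum]
  rw [Finset.sum_comm' (t' := Finset.univ) (s' := fun _ => Finset.univ) (by simp)]
  conv_lhs => enter [2, j]; rw [Finset.sum_comm]
  rw [Finset.sum_comm]
  refine Finset.sum_congr rfl fun a _ => ?_
  conv_lhs => enter [2, j]; rw [Finset.sum_comm]
  rw [Finset.sum_comm]
  refine Finset.sum_congr rfl fun b _ => ?_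
  rw [Finset.sum_comm]
  exact Finset.sum_congr rfl fun i _ => Finset.sum_congr rfl fun j _ => by ring

theorem sum_baryGrad_apply (hK : IsSimplex K) (i : Fin d) : ∑ a ∈ K, baryGrad K a i = 0 := by
  have h := hK.sum_inner_baryGrad (EuclideanSpace.single i 1)
  simpa [inner_eq_sum] using h

theorem sum_baryGrad_apply_mul (hK : IsSimplex K) (i k : Fin d) :
    ∑ a ∈ K, baryGrad K a i * a k = if k = i then 1 else 0 := by
  have h := congrArg (fun v : E d => v k) (hK.sum_inner_baryGrad_smul (EuclideanSpace.single i 1))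
  simp only [WithLp.ofLp_sum, Finset.sum_apply, PiLp.smul_apply, smul_eq_mul] at h
  simpa [inner_eq_sum, Pi.single_apply] using h

/-- The Hessian is recovered from the second derivatives along the edges. -/
theorem hess_eq_sum_edgeHess (hK : IsSimplex K) (V : MvPolynomial (Fin d) ℝ) (i j : Fin d)
    (x : E d) : polyEval (MvPolynomial.pderiv i (MvPolynomial.pderiv j V)) x =
      -(1 / 2) * ∑ a ∈ K, ∑ b ∈ K, baryGrad K a i * baryGrad K b j *
        polyEval (edgeHess V a b) x := by
  set H : Fin d → Fin d → ℝ := fun k l =>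
    polyEval (MvPolynomial.pderiv k (MvPolynomial.pderiv l V)) x with hH
  have h1 : ∀ k l, ∑ a ∈ K, ∑ b ∈ K, baryGrad K a i * baryGrad K b j *
      ((b - a) k * (b - a) l) =
      -((if l = i then 1 else 0) * (if k = j then 1 else 0)) -
        (if k = i then 1 else 0) * (if l = j then 1 else 0) := by
    intro k l
    have h2 : ∀ a b : E d, baryGrad K a i * baryGrad K b j * ((b - a) k * (b - a) l) =
        baryGrad K a i * (baryGrad K b j * (b k * b l)) -
        (baryGrad K a i * a l) * (baryGrad K b j * b k) -
        (baryGrad K a i * a k) * (baryGrad K b j * b l) +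
        (baryGrad K a i * (a k * a l)) * baryGrad K b j := by
      intro a b
      simp only [PiLp.sub_apply]
      ring
    simp only [h2, Finset.sum_add_distrib, Finset.sum_sub_distrib, ← Finset.sum_mul_sum,
      sum_baryGrad_apply hK, sum_baryGrad_apply_mul hK]
    ring
  have h3 : ∑ a ∈ K, ∑ b ∈ K, baryGrad K a i * baryGrad K b j * polyEval (edgeHess V a b) x =
      ∑ k, ∑ l, H k l * ∑ a ∈ K, ∑ b ∈ K, baryGrad K a i * baryGrad K b j *
        ((b - a) k * (b - a) l) := by
    simp only [polyEval_edgeHess, Finset.mul_sum]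
    conv_lhs => enter [2, a]; rw [Finset.sum_comm]
    rw [Finset.sum_comm]
    refine Finset.sum_congr rfl fun k _ => ?_
    conv_lhs => enter [2, a]; rw [Finset.sum_comm]
    rw [Finset.sum_comm]
    refine Finset.sum_congr rfl fun l _ => ?_
    exact Finset.sum_congr rfl fun a _ => Finset.sum_congr rfl fun b _ => by
      simp only [hH]; ring
  have h4 : H j i = H i j := by
    simp only [hH, pderiv_pderiv_comm j i]
  rw [h3]
  have h5 : ∀ k l, H k l * (-((if l = i then 1 else 0) * (if k = j then 1 else 0)) -
      (if k = i then 1 else 0) * (if l = j then 1 else 0)) =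
      -(if k = j then (if l = i then H k l else 0) else 0) -
        (if k = i then (if l = j then H k l else 0) else 0) := by
    intro k l
    split_ifs <;> ring
  simp only [h1, h5, Finset.sum_sub_distrib, Finset.sum_neg_distrib, Finset.sum_ite_irrel,
    Finset.sum_const_zero, Finset.sum_ite_eq', Finset.mem_univ, if_true]
  rw [h4]
  ring

end Hessian

/-! ### Elementwise estimates -/

theorem integral_hull_sum_sum {d : ℕ} {K : Finset (E d)} {ι κ : Type*} (s : Finset ι)
    (t : Finset κ) {f : ι → κ → E d → ℝ} (hf : ∀ a b, Continuous (f a b)) :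
    ∫ x in hull K, ∑ a ∈ s, ∑ b ∈ t, f a b x = ∑ a ∈ s, ∑ b ∈ t, ∫ x in hull K, f a b x := by
  rw [integral_finsetSum _ fun a _ => integrableOn_hull (continuous_finsetSum _ fun b _ => hf a b)]
  refine Finset.sum_congr rfl fun a _ => ?_
  rw [integral_finsetSum _ fun b _ => integrableOn_hull (hf a b)]

theorem abs_apply_le_norm {d : ℕ} (t : E d) (i : Fin d) : |t i| ≤ ‖t‖ := by
  have h := PiLp.norm_apply_le t i
  rwa [Real.norm_eq_abs] at h

namespace Triangulation

variable {n : ℕ} {Ω : Set (E (n + 1))} {T : Triangulation Ω}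

/-- On the elements, the square of the product of all barycentric coordinates is a harmless weight
for polynomials. -/
theorem exists_integral_hull_sq_le (n m : ℕ) : ∃ C : ℝ, 0 < C ∧
    ∀ {Ω : Set (E (n + 1))} {T : Triangulation Ω} {K : Finset (E (n + 1))}, K ∈ T.elements →
    ∀ {q : MvPolynomial (Fin (n + 1)) ℝ}, q.totalDegree ≤ m →
      ∫ x in hull K, polyEval q x ^ 2 ≤
        C * ∫ x in hull K, (∏ a ∈ K, bary K a x) ^ 2 * polyEval q x ^ 2 := by
  obtain ⟨C, hC, hbd⟩ := exists_refInt_bounds (n + 1) m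
  refine ⟨C, hC, ?_⟩
  intro Ω T K hK q hq
  obtain ⟨p, hp, hr⟩ : ∃ p : Fin (n + 1 + 1) → E (n + 1), Function.Injective p ∧ range p = K := by
    refine ⟨fun i => ((K.equivFinOfCardEq (T.mem_elements.1 hK).2).symm i : E (n + 1)),
      fun i j h => by simpa using h, ?_⟩
    ext x
    constructor
    · rintro ⟨i, rfl⟩
      exact Subtype.mem _
    · intro hx
      exact ⟨K.equivFinOfCardEq (T.mem_elements.1 hK).2 ⟨x, hx⟩, by simp⟩
  obtain ⟨W, hW, hWq⟩ := exists_homogeneous p hq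
  have hm : ∀ j, p j ∈ K := fun j => by
    rw [← Finset.mem_coe, ← hr]; exact mem_range_self j
  have hli := (isSimplex hK).linearIndependent_of_injective hp hm
  have hint : ∀ f : E (n + 1) → ℝ, ∫ x in hull K, f x = simplexDensity (hull K) *
      refInt (n + 1) (fun l => f (∑ i, l i • p i)) := by
    intro f
    have h := integral_convexHull hli f
    rw [hr] at h
    exact h
  rw [hint, hint, refInt_congr (G' := fun l => MvPolynomial.eval l W ^ 2)
      fun l hl => by rw [hWq l hl],
    refInt_congr (G := fun l => _ * _)
      (G' := fun l => (∏ i, l i) ^ 2 * MvPolynomial.eval l W ^ 2) fun l hl => by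
      rw [hWq l hl, ← prod_enum hp hr]
      congr 2
      exact Finset.prod_congr rfl fun i _ => bary_enum hK (Finset.Subset.refl K) hp hr hl i]
  rw [mul_left_comm]
  exact mul_le_mul_of_nonneg_left (hbd W hW).2 (isSimplex hK).simplexDensity_pos.le

theorem abs_edge_apply_le {K : Finset (E (n + 1))} {a b : E (n + 1)}
    (ha : a ∈ K) (hb : b ∈ K) (i : Fin (n + 1)) : |(b - a) i| ≤ Metric.diam (hull K) :=
  (abs_apply_le_norm _ i).trans (dist_le_diam_hull hb ha)

/-- An edge field is bounded by the edge polynomials. -/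
theorem abs_edgeField_le {K : Finset (E (n + 1))} (hK : K ∈ T.elements)
    {Q : E (n + 1) → E (n + 1) → MvPolynomial (Fin (n + 1)) ℝ} {B : ℝ} {x : E (n + 1)}
    (hx : x ∈ hull K)
    (hQ : ∀ a ∈ K, ∀ b ∈ K, Metric.diam (hull K) ^ 2 * |polyEval (Q a b) x| ≤ B)
    (i j : Fin (n + 1)) : |polyEval (edgeField K Q i j) x| ≤ (n + 2) ^ 2 * B := by
  rw [polyEval_edgeField]
  have h1 : ∀ a ∈ K, ∀ b ∈ K, |(b - a) i * (b - a) j *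
      (bary K a x * bary K b x * polyEval (Q a b) x)| ≤ B := by
    intro a ha b hb
    refine le_trans ?_ (hQ a ha b hb)
    rw [abs_mul, abs_mul, abs_mul, abs_mul, sq]
    refine mul_le_mul (mul_le_mul (abs_edge_apply_le ha hb i) (abs_edge_apply_le ha hb j)
      (abs_nonneg _) Metric.diam_nonneg) ?_ (by positivity)
      (mul_nonneg Metric.diam_nonneg Metric.diam_nonneg)
    refine mul_le_of_le_one_left (abs_nonneg _) ?_
    have h0 := (isSimplex hK).bary_nonneg hx
    rw [abs_of_nonneg (h0 a), abs_of_nonneg (h0 b)]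
    exact mul_le_one₀ ((isSimplex hK).bary_le_one hx a) (h0 b) ((isSimplex hK).bary_le_one hx b)
  have hcard : (K.card : ℝ) = n + 2 := by
    rw [(T.mem_elements.1 hK).2]; push_cast; ring
  calc _ ≤ ∑ a ∈ K, ∑ b ∈ K, |(b - a) i * (b - a) j *
        (bary K a x * bary K b x * polyEval (Q a b) x)| :=
        (Finset.abs_sum_le_sum_abs _ _).trans
          (Finset.sum_le_sum fun a _ => Finset.abs_sum_le_sum_abs _ _)
    _ ≤ ∑ a ∈ K, ∑ b ∈ K, B := Finset.sum_le_sum fun a ha => Finset.sum_le_sum fun b hb =>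
        h1 a ha b hb
    _ = (n + 2) ^ 2 * B := by
        rw [Finset.sum_const, Finset.sum_const, nsmul_eq_mul, nsmul_eq_mul, hcard]; ring

theorem abs_edgeHess_le {K : Finset (E (n + 1))} {a b : E (n + 1)} (ha : a ∈ K) (hb : b ∈ K)
    (V : MvPolynomial (Fin (n + 1)) ℝ) (x : E (n + 1)) :
    |polyEval (edgeHess V a b) x| ≤ Metric.diam (hull K) ^ 2 * ∑ i, ∑ j,
      |polyEval (MvPolynomial.pderiv i (MvPolynomial.pderiv j V)) x| := by
  rw [polyEval_edgeHess, Finset.mul_sum]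
  refine (Finset.abs_sum_le_sum_abs _ _).trans (Finset.sum_le_sum fun i _ => ?_)
  rw [Finset.mul_sum]
  refine (Finset.abs_sum_le_sum_abs _ _).trans (Finset.sum_le_sum fun j _ => ?_)
  rw [abs_mul, abs_mul, sq]
  exact mul_le_mul_of_nonneg_right (mul_le_mul (abs_edge_apply_le ha hb i)
    (abs_edge_apply_le ha hb j) (abs_nonneg _) Metric.diam_nonneg) (abs_nonneg _)

/-- The second derivatives along the edges control the Hessian. -/
theorem ShapeRegular.sum_hess_sq_le {γ : ℝ} (hT : T.ShapeRegular γ) {K : Finset (E (n + 1))}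
    (hK : K ∈ T.elements) (V : MvPolynomial (Fin (n + 1)) ℝ) (x : E (n + 1)) :
    Metric.diam (hull K) ^ 4 *
      ∑ i, ∑ j, polyEval (MvPolynomial.pderiv i (MvPolynomial.pderiv j V)) x ^ 2 ≤
      (n + 1) ^ 2 * (γ ^ 4 * (n + 2) ^ 2) * ∑ a ∈ K, ∑ b ∈ K,
        polyEval (edgeHess V a b) x ^ 2 := by
  set h := Metric.diam (hull K) with hh
  have hpos := diam_hull_pos hK
  have hγ := hT.pos hK
  have hcard : (K.card : ℝ) = n + 2 := by
    rw [(T.mem_elements.1 hK).2]; push_cast; ring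
  have hg : ∀ a i, |baryGrad K a i| * h ≤ γ := fun a i =>
    (mul_le_mul_of_nonneg_right (abs_apply_le_norm _ i) hpos.le).trans (hT.norm_baryGrad_le hK a)
  have h1 : ∀ i j, h ^ 2 * |polyEval (MvPolynomial.pderiv i (MvPolynomial.pderiv j V)) x| ≤
      γ ^ 2 * ∑ y ∈ K ×ˢ K, |polyEval (edgeHess V y.1 y.2) x| := by
    intro i j
    rw [hess_eq_sum_edgeHess (isSimplex hK), Finset.sum_product, abs_mul, abs_neg]
    have h2 : |∑ a ∈ K, ∑ b ∈ K, baryGrad K a i * baryGrad K b j * polyEval (edgeHess V a b) x| ≤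
        ∑ a ∈ K, ∑ b ∈ K, |baryGrad K a i| * |baryGrad K b j| * |polyEval (edgeHess V a b) x| := by
      refine (Finset.abs_sum_le_sum_abs _ _).trans (Finset.sum_le_sum fun a _ => ?_)
      refine (Finset.abs_sum_le_sum_abs _ _).trans (Finset.sum_le_sum fun b _ => ?_)
      rw [abs_mul, abs_mul]
    have h3 : h ^ 2 * ∑ a ∈ K, ∑ b ∈ K, |baryGrad K a i| * |baryGrad K b j| *
        |polyEval (edgeHess V a b) x| ≤
        γ ^ 2 * ∑ a ∈ K, ∑ b ∈ K, |polyEval (edgeHess V a b) x| := by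
      rw [Finset.mul_sum, Finset.mul_sum]
      refine Finset.sum_le_sum fun a _ => ?_
      rw [Finset.mul_sum, Finset.mul_sum]
      refine Finset.sum_le_sum fun b _ => ?_
      calc _ = (|baryGrad K a i| * h) * (|baryGrad K b j| * h) *
            |polyEval (edgeHess V a b) x| := by ring
        _ ≤ γ * γ * |polyEval (edgeHess V a b) x| :=
            mul_le_mul_of_nonneg_right (mul_le_mul (hg a i) (hg b j) (by positivity) hγ.le)
              (abs_nonneg _)
        _ = _ := by ring
    have h4 : |(1 / 2 : ℝ)| ≤ 1 := by norm_num [abs_of_pos]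
    calc _ ≤ h ^ 2 * (1 * ∑ a ∈ K, ∑ b ∈ K, |baryGrad K a i| * |baryGrad K b j| *
          |polyEval (edgeHess V a b) x|) :=
          mul_le_mul_of_nonneg_left (mul_le_mul h4 h2 (abs_nonneg _) zero_le_one) (by positivity)
      _ ≤ _ := by rw [one_mul]; exact h3
  have h5 : ∀ i j, h ^ 4 * polyEval (MvPolynomial.pderiv i (MvPolynomial.pderiv j V)) x ^ 2 ≤
      γ ^ 4 * (n + 2) ^ 2 * ∑ a ∈ K, ∑ b ∈ K, polyEval (edgeHess V a b) x ^ 2 := by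
    intro i j
    calc _ = (h ^ 2 * |polyEval (MvPolynomial.pderiv i (MvPolynomial.pderiv j V)) x|) ^ 2 := by
          rw [mul_pow, sq_abs]; ring
      _ ≤ (γ ^ 2 * ∑ y ∈ K ×ˢ K, |polyEval (edgeHess V y.1 y.2) x|) ^ 2 :=
          pow_le_pow_left₀ (by positivity) (h1 i j) 2
      _ = γ ^ 4 * (∑ y ∈ K ×ˢ K, |polyEval (edgeHess V y.1 y.2) x|) ^ 2 := by ring
      _ ≤ γ ^ 4 * ((K ×ˢ K).card * ∑ y ∈ K ×ˢ K, |polyEval (edgeHess V y.1 y.2) x| ^ 2) :=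
          mul_le_mul_of_nonneg_left sq_sum_le_card_mul_sum_sq (by positivity)
      _ = _ := by
          rw [Finset.card_product, Finset.sum_product]
          push_cast
          rw [hcard]
          simp only [sq_abs]
          ring
  calc _ = ∑ i, ∑ j, h ^ 4 *
        polyEval (MvPolynomial.pderiv i (MvPolynomial.pderiv j V)) x ^ 2 := by
        simp only [Finset.mul_sum]
    _ ≤ ∑ i : Fin (n + 1), ∑ j : Fin (n + 1), γ ^ 4 * (n + 2) ^ 2 *
        ∑ a ∈ K, ∑ b ∈ K, polyEval (edgeHess V a b) x ^ 2 :=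
        Finset.sum_le_sum fun i _ => Finset.sum_le_sum fun j _ => h5 i j
    _ = _ := by
        rw [Finset.sum_const, Finset.sum_const, nsmul_eq_mul, nsmul_eq_mul, Finset.card_univ,
          Fintype.card_fin]
        push_cast
        ring

/-- The edge field `∑ h⁻⁴ λₐ² λ_b² (∂²V/∂(b-a)²) (b-a)(b-a)ᵀ` is a bounded and coercive test field
for the Hessian of `V`. -/
theorem exists_hess_bounds (n m : ℕ) (γ : ℝ) : ∃ C : ℝ, 0 < C ∧
    ∀ {Ω : Set (E (n + 1))} {T : Triangulation Ω}, T.ShapeRegular γ →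
    ∀ {K : Finset (E (n + 1))}, K ∈ T.elements →
    ∀ {V : MvPolynomial (Fin (n + 1)) ℝ}, V.totalDegree ≤ m + 1 →
      (∫ x in hull K, ∑ i, ∑ j, polyEval (MvPolynomial.pderiv i (MvPolynomial.pderiv j V)) x ^ 2 ≤
        C * ∫ x in hull K, ∑ i, ∑ j,
          polyEval (edgeField K (hessEdgePoly K V (Metric.diam (hull K) ^ 4)⁻¹) i j) x *
          polyEval (MvPolynomial.pderiv i (MvPolynomial.pderiv j V)) x) ∧
      ∀ x ∈ hull K, ∀ i j,
        |polyEval (edgeField K (hessEdgePoly K V (Metric.diam (hull K) ^ 4)⁻¹) i j) x| ≤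
          C * ∑ i, ∑ j, |polyEval (MvPolynomial.pderiv i (MvPolynomial.pderiv j V)) x| := by
  obtain ⟨C, hC, hbd⟩ := exists_integral_hull_sq_le n m
  set C4 : ℝ := (n + 1) ^ 2 * (γ ^ 4 * (n + 2) ^ 2) with hC4
  have hC40 : 0 ≤ C4 := by positivity
  refine ⟨C4 * C + (n + 2) ^ 2, by positivity, ?_⟩
  intro Ω T hT K hK V hV
  have hpos := diam_hull_pos hK
  have hc : ∀ p : MvPolynomial (Fin (n + 1)) ℝ, Continuous (fun x : E (n + 1) => polyEval p x) :=
    continuous_polyEval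
  have hcb := continuous_bary K
  set h := Metric.diam (hull K) with hh
  constructor
  · have h1 : ∀ x, ∑ i, ∑ j, polyEval (edgeField K (hessEdgePoly K V (h ^ 4)⁻¹) i j) x *
        polyEval (MvPolynomial.pderiv i (MvPolynomial.pderiv j V)) x =
        (h ^ 4)⁻¹ * ∑ a ∈ K, ∑ b ∈ K, (bary K a x * bary K b x) ^ 2 *
          polyEval (edgeHess V a b) x ^ 2 := by
      intro x
      rw [sum_edgeField_mul_hess, Finset.mul_sum]
      refine Finset.sum_congr rfl fun a _ => ?_
      rw [Finset.mul_sum]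
      refine Finset.sum_congr rfl fun b _ => ?_
      rw [hessEdgePoly, polyEval_C_mul, polyEval_mul, polyEval_mul, polyEval_baryPoly,
        polyEval_baryPoly]
      ring
    have h2 : ∀ x ∈ hull K, ∀ a ∈ K, ∀ b ∈ K,
        (∏ c ∈ K, bary K c x) ^ 2 * polyEval (edgeHess V a b) x ^ 2 ≤
        (bary K a x * bary K b x) ^ 2 * polyEval (edgeHess V a b) x ^ 2 := by
      intro x hx a ha b hb
      by_cases hab : a = b
      · subst hab
        simp [edgeHess_self, polyEval]
      · have h0 := (isSimplex hK).bary_nonneg hx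
        refine mul_le_mul_of_nonneg_right (pow_le_pow_left₀ (Finset.prod_nonneg fun c _ => h0 c)
          ?_ 2) (sq_nonneg _)
        rw [← Finset.mul_prod_erase K _ ha,
          ← Finset.mul_prod_erase (K.erase a) _ (Finset.mem_erase.2 ⟨Ne.symm hab, hb⟩), ← mul_assoc]
        exact mul_le_of_le_one_right (mul_nonneg (h0 a) (h0 b))
          (Finset.prod_le_one (fun c _ => h0 c) fun c _ => (isSimplex hK).bary_le_one hx c)
    have hcp : Continuous fun x => ∏ c ∈ K, bary K c x := continuous_finsetProd _ fun c _ => hcb c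
    have hci : ∀ a b, Continuous fun x => (∏ c ∈ K, bary K c x) ^ 2 *
        polyEval (edgeHess V a b) x ^ 2 := fun a b => (hcp.pow 2).mul ((hc _).pow 2)
    have hcj : ∀ a b, Continuous fun x => (bary K a x * bary K b x) ^ 2 *
        polyEval (edgeHess V a b) x ^ 2 := fun a b =>
      (((hcb a).mul (hcb b)).pow 2).mul ((hc _).pow 2)
    have h3 : ∀ a ∈ K, ∀ b ∈ K, ∫ x in hull K, polyEval (edgeHess V a b) x ^ 2 ≤
        C * ∫ x in hull K, (bary K a x * bary K b x) ^ 2 * polyEval (edgeHess V a b) x ^ 2 := by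
      intro a ha b hb
      refine (hbd hK (totalDegree_edgeHess_le hV a b)).trans
        (mul_le_mul_of_nonneg_left ?_ hC.le)
      exact setIntegral_mono_on (integrableOn_hull (hci a b)) (integrableOn_hull (hcj a b))
        (measurableSet_hull K) fun x hx => h2 x hx a ha b hb
    have h4 : h ^ 4 * ∫ x in hull K, ∑ i, ∑ j,
        polyEval (MvPolynomial.pderiv i (MvPolynomial.pderiv j V)) x ^ 2 ≤
        C4 * ∑ a ∈ K, ∑ b ∈ K, ∫ x in hull K, polyEval (edgeHess V a b) x ^ 2 := by
      have hsum : ∑ a ∈ K, ∑ b ∈ K, ∫ x in hull K, polyEval (edgeHess V a b) x ^ 2 =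
          ∫ x in hull K, ∑ a ∈ K, ∑ b ∈ K, polyEval (edgeHess V a b) x ^ 2 := by
        exact (integral_hull_sum_sum K K fun a b => (hc _).pow 2).symm
      rw [hsum, ← integral_const_mul, ← integral_const_mul]
      refine setIntegral_mono_on (integrableOn_hull ?_) (integrableOn_hull ?_)
        (measurableSet_hull K) fun x _ => hT.sum_hess_sq_le hK V x
      · exact continuous_const.mul (continuous_finsetSum _ fun i _ => continuous_finsetSum _
          fun j _ => (hc _).pow 2)
      · exact continuous_const.mul (continuous_finsetSum _ fun i _ => continuous_finsetSum _
          fun j _ => (hc _).pow 2)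
    have h5 : ∑ a ∈ K, ∑ b ∈ K, ∫ x in hull K, (bary K a x * bary K b x) ^ 2 *
          polyEval (edgeHess V a b) x ^ 2 = h ^ 4 * ∫ x in hull K, ∑ i, ∑ j,
          polyEval (edgeField K (hessEdgePoly K V (h ^ 4)⁻¹) i j) x *
          polyEval (MvPolynomial.pderiv i (MvPolynomial.pderiv j V)) x := by
      simp only [h1]
      rw [integral_const_mul, mul_inv_cancel_left₀ (by positivity),
        integral_hull_sum_sum K K hcj]
    set I := ∫ x in hull K, ∑ i, ∑ j,
          polyEval (edgeField K (hessEdgePoly K V (h ^ 4)⁻¹) i j) x *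
          polyEval (MvPolynomial.pderiv i (MvPolynomial.pderiv j V)) x with hI
    have hI0 : 0 ≤ h ^ 4 * I := by
      rw [← h5]
      exact Finset.sum_nonneg fun a _ => Finset.sum_nonneg fun b _ =>
        integral_nonneg fun x => by positivity
    have h6 : ∑ a ∈ K, ∑ b ∈ K, ∫ x in hull K, polyEval (edgeHess V a b) x ^ 2 ≤
        C * (h ^ 4 * I) := by
      rw [← h5, Finset.mul_sum]
      refine Finset.sum_le_sum fun a ha => ?_
      rw [Finset.mul_sum]
      exact Finset.sum_le_sum fun b hb => h3 a ha b hb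
    have h7 : h ^ 4 * ∫ x in hull K, ∑ i, ∑ j,
        polyEval (MvPolynomial.pderiv i (MvPolynomial.pderiv j V)) x ^ 2 ≤
        h ^ 4 * ((C4 * C + (n + 2) ^ 2) * I) := by
      refine h4.trans ((mul_le_mul_of_nonneg_left h6 hC40).trans ?_)
      have : 0 ≤ (n + 2 : ℝ) ^ 2 * (h ^ 4 * I) := mul_nonneg (by positivity) hI0
      linarith
    exact le_of_mul_le_mul_left h7 (by positivity)
  · intro x hx i j
    set S := ∑ i, ∑ j, |polyEval (MvPolynomial.pderiv i (MvPolynomial.pderiv j V)) x| with hS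
    have hS0 : 0 ≤ S := Finset.sum_nonneg fun i _ => Finset.sum_nonneg fun j _ => abs_nonneg _
    refine (abs_edgeField_le hK (B := S) hx (fun a ha b hb => ?_) i j).trans ?_
    · rw [hessEdgePoly, polyEval_C_mul, polyEval_mul, polyEval_mul, polyEval_baryPoly,
        polyEval_baryPoly, abs_mul, abs_mul, abs_mul, abs_of_pos (by positivity : 0 < (h ^ 4)⁻¹)]
      have h0 := (isSimplex hK).bary_nonneg hx
      have h1 := (isSimplex hK).bary_le_one hx
      rw [abs_of_nonneg (h0 a), abs_of_nonneg (h0 b)]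
      have h2 := abs_edgeHess_le ha hb V x
      have h3 : bary K a x * bary K b x * |polyEval (edgeHess V a b) x| ≤ h ^ 2 * S :=
        (mul_le_of_le_one_left (abs_nonneg _) (mul_le_one₀ (h1 a) (h0 b) (h1 b))).trans h2
      calc _ ≤ h ^ 2 * ((h ^ 4)⁻¹ * (h ^ 2 * S)) :=
            mul_le_mul_of_nonneg_left (mul_le_mul_of_nonneg_left h3 (by positivity))
              (by positivity)
        _ = S := by field_simp
    · refine mul_le_mul_of_nonneg_right ?_ hS0
      have : 0 ≤ C4 * C := by positivity
      linarith

end Triangulation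

theorem pderiv_mem_supported {σ : Type*} {s : Set σ} {p : MvPolynomial σ ℝ}
    (hp : p ∈ MvPolynomial.supported ℝ s) (i : σ) :
    MvPolynomial.pderiv i p ∈ MvPolynomial.supported ℝ s := by
  classical
  refine Algebra.adjoin_induction (p := fun q _ => MvPolynomial.pderiv i q ∈
    MvPolynomial.supported ℝ s) ?_ ?_ ?_ ?_ hp
  · rintro _ ⟨j, -, rfl⟩
    rw [MvPolynomial.pderiv_X, Pi.single_apply]
    split_ifs
    · exact one_mem _
    · exact zero_mem _
  · intro r
    rw [MvPolynomial.algebraMap_eq, MvPolynomial.pderiv_C]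
    exact zero_mem _
  · intro x y _ _ hx hy
    rw [map_add]
    exact add_mem hx hy
  · intro x y hx' hy' hx hy
    rw [MvPolynomial.pderiv_mul]
    exact add_mem (mul_mem hx hy') (mul_mem hx' hy)

theorem C_mem_supported {σ : Type*} (s : Set σ) (r : ℝ) :
    MvPolynomial.C r ∈ MvPolynomial.supported ℝ s :=
  Subalgebra.algebraMap_mem _ r

namespace Triangulation

variable {n : ℕ} {Ω : Set (E (n + 1))} {T : Triangulation Ω}

theorem abs_normal_le {F : Finset (E (n + 1))} (hF : F ∈ T.sides) (i : Fin (n + 1)) :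
    |T.normal F i| ≤ 1 :=
  (abs_apply_le_norm _ i).trans (T.normal_spec (by omega) hF).1.le

theorem abs_inner_normal_le {F : Finset (E (n + 1))} (hF : F ∈ T.sides) (g : E (n + 1)) :
    |inner ℝ g (T.normal F)| ≤ ‖g‖ := by
  have h := abs_real_inner_le_norm g (T.normal F)
  rwa [(T.normal_spec (by omega) hF).1, mul_one] at h

section DivSide

variable {Z : Finset (E (n + 1)) → MvPolynomial (E (n + 1)) ℝ}

theorem isHomogeneous_divSidePoly {m : ℕ} (hZ : ∀ F ∈ T.sides, (Z F).IsHomogeneous (m + 1))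
    (K : Finset (E (n + 1))) (g : E (n + 1)) : (T.divSidePoly Z K g).IsHomogeneous m := by
  classical
  refine MvPolynomial.IsHomogeneous.sum _ _ _ fun F hF => ?_
  refine MvPolynomial.IsHomogeneous.C_mul ?_ _
  refine MvPolynomial.IsHomogeneous.sum _ _ _ fun a _ => ?_
  exact MvPolynomial.IsHomogeneous.C_mul (hZ F (Finset.mem_filter.1 hF).1).pderiv _

theorem divSidePoly_mem_supported
    (hZ : ∀ F ∈ T.sides, Z F ∈ MvPolynomial.supported ℝ (F : Set (E (n + 1))))
    (K : Finset (E (n + 1))) (g : E (n + 1)) :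
    T.divSidePoly Z K g ∈ MvPolynomial.supported ℝ (K : Set (E (n + 1))) := by
  classical
  refine sum_mem fun F hF => mul_mem (C_mem_supported _ _) (sum_mem fun a _ =>
    mul_mem (C_mem_supported _ _) (pderiv_mem_supported ?_ _))
  rw [Finset.mem_filter] at hF
  exact MvPolynomial.supported_mono (Finset.coe_subset.2 hF.2) (hZ F hF.1)

open scoped Classical in
/-- Each derivative costs one factor `h⁻¹`: one comes from the chain rule, the other from the vector
`∇λ_c` that replaces the normal. -/
theorem ShapeRegular.coeffNorm_divSidePoly_le {γ : ℝ} (hT : T.ShapeRegular γ) {m : ℕ}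
    (hZ : ∀ F ∈ T.sides, (Z F).IsHomogeneous m) {K : Finset (E (n + 1))} (hK : K ∈ T.elements)
    (c : E (n + 1)) :
    Metric.diam (hull K) ^ 2 * coeffNorm (T.divSidePoly Z K (baryGrad K c)) ≤
      γ ^ 2 * (n + 2) * m * ∑ F ∈ T.sides with F ⊆ K, coeffNorm (Z F) := by
  set h := Metric.diam (hull K) with hh
  have hpos := diam_hull_pos hK
  have hγ := hT.pos hK
  have hcard : (K.card : ℝ) = n + 2 := by
    rw [(T.mem_elements.1 hK).2]; push_cast; ring
  have h1 : ∀ F ∈ T.sides, coeffNorm (∑ a ∈ K, MvPolynomial.C (inner ℝ (baryGrad K a)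
      (T.normal F)) * MvPolynomial.pderiv a (Z F)) * h ≤ (n + 2) * (γ * (m * coeffNorm (Z F))) := by
    intro F hF
    rw [← hcard, ← nsmul_eq_mul, ← Finset.sum_const]
    refine (mul_le_mul_of_nonneg_right (coeffNorm_sum_le _ _) hpos.le).trans ?_
    rw [Finset.sum_mul]
    refine Finset.sum_le_sum fun a _ => ?_
    calc _ ≤ (‖baryGrad K a‖ * (m * coeffNorm (Z F))) * h :=
          mul_le_mul_of_nonneg_right ((coeffNorm_C_mul_le _ _).trans (mul_le_mul
            (abs_inner_normal_le hF _) (coeffNorm_pderiv_le (hZ F hF) a) (coeffNorm_nonneg _)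
            (norm_nonneg _))) hpos.le
      _ = (‖baryGrad K a‖ * h) * (m * coeffNorm (Z F)) := by ring
      _ ≤ _ := mul_le_mul_of_nonneg_right (hT.norm_baryGrad_le hK a)
          (mul_nonneg (by positivity) (coeffNorm_nonneg _))
  unfold divSidePoly
  refine (mul_le_mul_of_nonneg_left (coeffNorm_sum_le _ _) (by positivity)).trans ?_
  rw [Finset.mul_sum, Finset.mul_sum]
  refine Finset.sum_le_sum fun F hF => ?_
  have hF' := (Finset.mem_filter.1 hF).1
  set S := coeffNorm (∑ a ∈ K, MvPolynomial.C (inner ℝ (baryGrad K a)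
      (T.normal F)) * MvPolynomial.pderiv a (Z F)) with hS
  have hS0 : 0 ≤ S := coeffNorm_nonneg _
  calc _ ≤ h ^ 2 * (‖baryGrad K c‖ * S) :=
        mul_le_mul_of_nonneg_left ((coeffNorm_C_mul_le _ _).trans (mul_le_mul_of_nonneg_right
          (abs_inner_normal_le hF' _) hS0)) (by positivity)
    _ = (‖baryGrad K c‖ * h) * (S * h) := by ring
    _ ≤ γ * ((n + 2) * (γ * (m * coeffNorm (Z F)))) :=
        mul_le_mul (hT.norm_baryGrad_le hK c) (h1 F hF') (by positivity) hγ.le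
    _ = _ := by ring

end DivSide

open scoped Classical in
/-- Given the side polynomials `Z` and `D`, there are edge fields that correct the normal component
of the divergence of `∑_F z_F n_F n_Fᵀ` to `D`, with the natural scaling. -/
theorem exists_correction (n m : ℕ) (γ : ℝ) : ∃ C : ℝ, 0 < C ∧
    ∀ {Ω : Set (E (n + 1))} {T : Triangulation Ω}, T.ShapeRegular γ →
    ∀ {Z D : Finset (E (n + 1)) → MvPolynomial (E (n + 1)) ℝ},
      (∀ F ∈ T.sides, (Z F).IsHomogeneous (m + 3)) →
      (∀ F ∈ T.sides, Z F ∈ MvPolynomial.supported ℝ (F : Set (E (n + 1)))) →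
      (∀ F ∈ T.sides, (D F).IsHomogeneous (m + 2)) →
      (∀ F ∈ T.sides, D F ∈ MvPolynomial.supported ℝ (F : Set (E (n + 1)))) →
    ∀ K ∈ T.elements, ∃ Q : E (n + 1) → E (n + 1) → MvPolynomial (Fin (n + 1)) ℝ,
      (∀ a b, Q a b = Q b a) ∧ (∀ a b, (Q a b).totalDegree ≤ m + 1) ∧
      (∀ c ∈ K, ∀ x, bary K c x = 0 →
        2 * ∑ b ∈ K.erase c, bary K b x * polyEval (Q c b) x +
          MvPolynomial.eval (fun a => bary K a x) (T.divSidePoly Z K (baryGrad K c)) =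
        -(T.sideSign K (K.erase c) * ‖baryGrad K c‖) *
          MvPolynomial.eval (fun a => bary K a x) (D (K.erase c))) ∧
      ∀ x ∈ hull K, ∀ i j,
        |polyEval (T.sideField Z K i j) x| + |polyEval (edgeField K Q i j) x| ≤
          C * ∑ F ∈ T.sides with F ⊆ K,
            (coeffNorm (Z F) + Metric.diam (hull K) * coeffNorm (D F)) := by
  set B : ℝ := |γ| + γ ^ 2 * (n + 2) * (m + 3 : ℕ) with hB
  refine ⟨1 + (n + 2) ^ 2 * (2 * ((n + 2) * B)), by positivity, ?_⟩
  intro Ω T hT Z D hZ hZs hD hDs K hK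
  set h := Metric.diam (hull K) with hh
  have hpos := diam_hull_pos hK
  have hγ := hT.pos hK
  have hcard : (K.card : ℝ) = n + 2 := by
    rw [(T.mem_elements.1 hK).2]; push_cast; ring
  have hsign : ∀ F, |T.sideSign K F| = 1 := by
    intro F
    unfold sideSign
    split_ifs <;> simp
  have hside : ∀ c ∈ K, K.erase c ∈ T.sides := fun c hc => T.erase_mem_sides (by omega) hK hc
  -- the right-hand sides of the edge system: the defect of the normal component of the divergence
  set w : E (n + 1) → MvPolynomial (E (n + 1)) ℝ := fun c => MvPolynomial.C (1 / 2) *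
    (MvPolynomial.C (-(T.sideSign K (K.erase c) * ‖baryGrad K c‖)) * D (K.erase c) -
      T.divSidePoly Z K (baryGrad K c)) with hw
  have hwh : ∀ c ∈ K, (w c).IsHomogeneous (m + 2) := fun c hc =>
    MvPolynomial.IsHomogeneous.C_mul (((hD _ (hside c hc)).C_mul _).sub
      (isHomogeneous_divSidePoly hZ K _)) _
  have hws : ∀ c ∈ K, w c ∈ MvPolynomial.supported ℝ (K : Set (E (n + 1))) := fun c hc =>
    mul_mem (C_mem_supported _ _) (sub_mem (mul_mem (C_mem_supported _ _)
      (MvPolynomial.supported_mono (Finset.coe_subset.2 (Finset.erase_subset c K))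
        (hDs _ (hside c hc)))) (divSidePoly_mem_supported hZs K _))
  obtain ⟨p, hsym, hdeg, hbd, hsol⟩ := exists_edge_system K hwh fun c hc α hα i hi => by
    have h1 := MvPolynomial.mem_supported.1 (hws c hc)
    exact Finset.mem_coe.1 (h1 (Finset.mem_coe.2 ((MvPolynomial.mem_vars_iff_mem_support i).2 ⟨α, hα, hi⟩)))
  refine ⟨fun a b => onElement K (p a b), fun a b =>
    congrArg (onElement K) (hsym a b), fun a b =>
    (totalDegree_onElement_le K _).trans (hdeg a b), ?_, ?_⟩
  · intro c hc x hx
    have h1 := hsol c hc (fun a => bary K a x) hx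
    simp only [← polyEval_onElement] at h1
    rw [h1]
    simp only [hw, polyEval_onElement, map_mul, map_sub, MvPolynomial.eval_C]
    ring
  · intro x hx i j
    have h0 := (isSimplex hK).bary_nonneg hx
    have habs : ∀ a, |bary K a x| ≤ 1 := fun a => by
      rw [abs_of_nonneg (h0 a)]; exact (isSimplex hK).bary_le_one hx a
    set S := ∑ F ∈ T.sides with F ⊆ K, (coeffNorm (Z F) + h * coeffNorm (D F)) with hS
    have hterm : ∀ F, 0 ≤ coeffNorm (Z F) + h * coeffNorm (D F) := fun F =>
      add_nonneg (coeffNorm_nonneg _) (mul_nonneg hpos.le (coeffNorm_nonneg _))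
    have hS0 : 0 ≤ S := Finset.sum_nonneg fun F _ => hterm F
    have hZS : ∑ F ∈ T.sides with F ⊆ K, coeffNorm (Z F) ≤ S :=
      Finset.sum_le_sum fun F _ => le_add_of_nonneg_right (mul_nonneg hpos.le (coeffNorm_nonneg _))
    have h1 : |polyEval (T.sideField Z K i j) x| ≤ S := by
      refine le_trans ?_ hZS
      rw [polyEval_sideField]
      refine (Finset.abs_sum_le_sum_abs _ _).trans (Finset.sum_le_sum fun F hF => ?_)
      have hF' := (Finset.mem_filter.1 hF).1
      rw [abs_mul, abs_mul]
      calc _ ≤ 1 * 1 * coeffNorm (Z F) := mul_le_mul (mul_le_mul (abs_normal_le hF' i)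
            (abs_normal_le hF' j) (abs_nonneg _) zero_le_one) (abs_eval_le habs _)
            (abs_nonneg _) (by norm_num)
        _ = _ := by ring
    have h2 : ∀ c ∈ K, h ^ 2 * coeffNorm (w c) ≤ B * S := by
      intro c hc
      have e1 : coeffNorm (w c) ≤ ‖baryGrad K c‖ * coeffNorm (D (K.erase c)) +
          coeffNorm (T.divSidePoly Z K (baryGrad K c)) := by
        have e2 := coeffNorm_C_mul_le (1 / 2) (MvPolynomial.C
          (-(T.sideSign K (K.erase c) * ‖baryGrad K c‖)) * D (K.erase c) -
          T.divSidePoly Z K (baryGrad K c))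
        have e3 := coeffNorm_add_le (MvPolynomial.C
          (-(T.sideSign K (K.erase c) * ‖baryGrad K c‖)) * D (K.erase c))
          (-T.divSidePoly Z K (baryGrad K c))
        have e4 := coeffNorm_C_mul_le (-(T.sideSign K (K.erase c) * ‖baryGrad K c‖))
          (D (K.erase c))
        rw [abs_neg, abs_mul, hsign, one_mul, abs_norm] at e4
        rw [coeffNorm_neg, ← sub_eq_add_neg] at e3
        rw [abs_of_pos (by norm_num : (0 : ℝ) < 1 / 2)] at e2
        have e5 := coeffNorm_nonneg (MvPolynomial.C
          (-(T.sideSign K (K.erase c) * ‖baryGrad K c‖)) * D (K.erase c) -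
          T.divSidePoly Z K (baryGrad K c))
        simp only [hw]
        linarith
      have e6 : h ^ 2 * (‖baryGrad K c‖ * coeffNorm (D (K.erase c))) ≤ |γ| * S := by
        calc _ = (‖baryGrad K c‖ * h) * (h * coeffNorm (D (K.erase c))) := by ring
          _ ≤ |γ| * S := by
              refine mul_le_mul ((hT.norm_baryGrad_le hK c).trans (le_abs_self γ)) ?_
                (mul_nonneg hpos.le (coeffNorm_nonneg _)) (abs_nonneg _)
              refine le_trans (le_add_of_nonneg_left (coeffNorm_nonneg (Z (K.erase c))))
                (Finset.single_le_sum (f := fun F => coeffNorm (Z F) + h * coeffNorm (D F))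
                  (fun F _ => hterm F) ?_)
              rw [Finset.mem_filter]
              exact ⟨hside c hc, Finset.erase_subset _ _⟩
      have e7 := hT.coeffNorm_divSidePoly_le hZ hK c
      have e8 : γ ^ 2 * (n + 2) * (m + 3 : ℕ) * ∑ F ∈ T.sides with F ⊆ K, coeffNorm (Z F) ≤
          γ ^ 2 * (n + 2) * (m + 3 : ℕ) * S := mul_le_mul_of_nonneg_left hZS (by positivity)
      calc _ ≤ h ^ 2 * (‖baryGrad K c‖ * coeffNorm (D (K.erase c)) +
            coeffNorm (T.divSidePoly Z K (baryGrad K c))) :=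
            mul_le_mul_of_nonneg_left e1 (by positivity)
        _ ≤ |γ| * S + γ ^ 2 * (n + 2) * (m + 3 : ℕ) * S := by
            rw [mul_add]; exact add_le_add e6 (e7.trans e8)
        _ = B * S := by rw [hB]; ring
    have h3 := abs_edgeField_le hK (Q := fun a b => onElement K (p a b))
      (B := 2 * ((n + 2) * (B * S))) hx (fun a _ b _ => by
        rw [polyEval_onElement]
        calc _ ≤ h ^ 2 * (2 * ∑ c ∈ K, coeffNorm (w c)) :=
              mul_le_mul_of_nonneg_left ((abs_eval_le habs _).trans (hbd a b)) (by positivity)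
          _ = 2 * ∑ c ∈ K, h ^ 2 * coeffNorm (w c) := by rw [← Finset.mul_sum]; ring
          _ ≤ 2 * ∑ c ∈ K, B * S := mul_le_mul_of_nonneg_left (Finset.sum_le_sum h2) two_pos.le
          _ = _ := by rw [Finset.sum_const, nsmul_eq_mul, hcard]) i j
    calc _ ≤ S + (n + 2) ^ 2 * (2 * ((n + 2) * (B * S))) := add_le_add h1 h3
      _ = _ := by ring

end Triangulation

/-- A polynomial is evaluated with the values of the variables that it contains. -/
theorem eval_eq_of_mem_supported {σ : Type*} {s : Set σ} {p : MvPolynomial σ ℝ}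
    (hp : p ∈ MvPolynomial.supported ℝ s) {l l' : σ → ℝ} (h : ∀ a ∈ s, l a = l' a) :
    MvPolynomial.eval l p = MvPolynomial.eval l' p := by
  refine Algebra.adjoin_induction (p := fun q _ => MvPolynomial.eval l q =
    MvPolynomial.eval l' q) ?_ ?_ ?_ ?_ hp
  · rintro _ ⟨j, hj, rfl⟩
    rw [MvPolynomial.eval_X, MvPolynomial.eval_X, h j hj]
  · intro r
    rw [MvPolynomial.algebraMap_eq, MvPolynomial.eval_C, MvPolynomial.eval_C]
  · intro x y _ _ hx hy
    rw [map_add, map_add, hx, hy]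
  · intro x y _ _ hx hy
    rw [map_mul, map_mul, hx, hy]

/-! ### Combining the two parts of the field on an element -/

section Element

variable {d N : ℕ} {K : Finset (E d)} {t e H : Fin N → Fin N → E d → ℝ}

theorem sum_sum_abs_sq_le (G : Fin N → Fin N → ℝ) :
    (∑ i, ∑ j, |G i j|) ^ 2 ≤ N ^ 2 * ∑ i, ∑ j, G i j ^ 2 := by
  have h := sq_sum_le_card_mul_sum_sq (s := (Finset.univ : Finset (Fin N)) ×ˢ Finset.univ)
    (f := fun y => |G y.1 y.2|)
  rw [Finset.sum_product, Finset.sum_product, Finset.card_product, Finset.card_univ,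
    Fintype.card_fin] at h
  simp only [sq_abs] at h
  push_cast at h
  rw [sq (N : ℝ)]
  exact h

/-- Coercivity: if the integral of `e : H` dominates `‖H‖²`, then `t + A e` tests `H` up to a multiple
of `‖t‖²`, by Young's inequality with `ε`. -/
theorem le_integral_combination (ht : ∀ i j, Continuous (t i j)) (he : ∀ i j, Continuous (e i j))
    (hH : ∀ i j, Continuous (H i j)) {B C ε A : ℝ} (hC : 0 < C) (hε : 0 < ε) (hA : 0 ≤ A)
    (htB : ∀ x ∈ hull K, ∀ i j, |t i j x| ≤ B)
    (heH : ∫ x in hull K, ∑ i, ∑ j, H i j x ^ 2 ≤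
      C * ∫ x in hull K, ∑ i, ∑ j, e i j x * H i j x) :
    (A / C - 1 / (4 * ε)) * (∫ x in hull K, ∑ i, ∑ j, H i j x ^ 2) -
      ε * (N ^ 2 * B ^ 2 * volume.real (hull K)) ≤
      ∫ x in hull K, ∑ i, ∑ j, (t i j x + A * e i j x) * H i j x := by
  have hcH : Continuous fun x => ∑ i, ∑ j, H i j x ^ 2 :=
    continuous_finsetSum _ fun i _ => continuous_finsetSum _ fun j _ => (hH i j).pow 2
  have hceH : Continuous fun x => ∑ i, ∑ j, e i j x * H i j x :=
    continuous_finsetSum _ fun i _ => continuous_finsetSum _ fun j _ => (he i j).mul (hH i j)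
  have hct : Continuous fun x => ∑ i, ∑ j, (t i j x + A * e i j x) * H i j x :=
    continuous_finsetSum _ fun i _ => continuous_finsetSum _ fun j _ =>
      ((ht i j).add (continuous_const.mul (he i j))).mul (hH i j)
  have h1 : ∫ x in hull K, (A * (∑ i, ∑ j, e i j x * H i j x) -
      1 / (4 * ε) * (∑ i, ∑ j, H i j x ^ 2) - ε * (N ^ 2 * B ^ 2)) ≤
      ∫ x in hull K, ∑ i, ∑ j, (t i j x + A * e i j x) * H i j x := by
    refine setIntegral_mono_on (integrableOn_hull (by fun_prop)) (integrableOn_hull hct)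
      (measurableSet_hull K) fun x hx => ?_
    have h2 : ∀ i j, A * (e i j x * H i j x) - 1 / (4 * ε) * H i j x ^ 2 - ε * B ^ 2 ≤
        (t i j x + A * e i j x) * H i j x := by
      intro i j
      have h3 : t i j x ^ 2 ≤ B ^ 2 := by
        rw [← sq_abs]; exact pow_le_pow_left₀ (abs_nonneg _) (htB x hx i j) 2
      have h4 : 0 ≤ ε * (t i j x + 1 / (2 * ε) * H i j x) ^ 2 := by positivity
      have h5 : ε * (t i j x + 1 / (2 * ε) * H i j x) ^ 2 =
          ε * t i j x ^ 2 + t i j x * H i j x + 1 / (4 * ε) * H i j x ^ 2 := by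
        field_simp; ring
      nlinarith [mul_le_mul_of_nonneg_left h3 hε.le]
    calc _ = ∑ i : Fin N, ∑ j : Fin N, (A * (e i j x * H i j x) - 1 / (4 * ε) * H i j x ^ 2 -
          ε * B ^ 2) := by
          simp only [Finset.sum_sub_distrib, ← Finset.mul_sum, Finset.sum_const, Finset.card_univ,
            Fintype.card_fin, nsmul_eq_mul]
          ring
      _ ≤ _ := Finset.sum_le_sum fun i _ => Finset.sum_le_sum fun j _ => h2 i j
  rw [integral_sub, integral_sub, integral_const_mul, integral_const_mul, setIntegral_const] at h1
  · refine le_trans (le_of_sub_nonneg ?_) h1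
    have h6 : A / C * ∫ x in hull K, ∑ i, ∑ j, H i j x ^ 2 ≤
        A * ∫ x in hull K, ∑ i, ∑ j, e i j x * H i j x := by
      calc _ ≤ A / C * (C * ∫ x in hull K, ∑ i, ∑ j, e i j x * H i j x) :=
            mul_le_mul_of_nonneg_left heH (by positivity)
        _ = _ := by field_simp
    rw [smul_eq_mul]
    linarith
  · exact integrableOn_hull (by fun_prop)
  · exact integrableOn_hull (by fun_prop)
  · exact integrableOn_hull (by fun_prop)
  · exact integrableOn_hull (by fun_prop)

theorem integral_combination_sq_le (ht : ∀ i j, Continuous (t i j))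
    (he : ∀ i j, Continuous (e i j)) (hH : ∀ i j, Continuous (H i j)) {B C A : ℝ}
    (htB : ∀ x ∈ hull K, ∀ i j, |t i j x| ≤ B)
    (heH : ∀ x ∈ hull K, ∀ i j, |e i j x| ≤ C * ∑ i, ∑ j, |H i j x|) :
    ∫ x in hull K, ∑ i, ∑ j, (t i j x + A * e i j x) ^ 2 ≤
      2 * N ^ 2 * (B ^ 2 * volume.real (hull K)) +
        2 * N ^ 4 * A ^ 2 * C ^ 2 * ∫ x in hull K, ∑ i, ∑ j, H i j x ^ 2 := by
  have hcH : Continuous fun x => ∑ i, ∑ j, H i j x ^ 2 :=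
    continuous_finsetSum _ fun i _ => continuous_finsetSum _ fun j _ => (hH i j).pow 2
  have hct : Continuous fun x => ∑ i, ∑ j, (t i j x + A * e i j x) ^ 2 :=
    continuous_finsetSum _ fun i _ => continuous_finsetSum _ fun j _ =>
      ((ht i j).add (continuous_const.mul (he i j))).pow 2
  have h1 : ∫ x in hull K, ∑ i, ∑ j, (t i j x + A * e i j x) ^ 2 ≤
      ∫ x in hull K, (2 * N ^ 2 * B ^ 2 +
        2 * N ^ 4 * A ^ 2 * C ^ 2 * ∑ i, ∑ j, H i j x ^ 2) := by
    refine setIntegral_mono_on (integrableOn_hull hct) (integrableOn_hull (by fun_prop))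
      (measurableSet_hull K) fun x hx => ?_
    set S := ∑ i, ∑ j, H i j x ^ 2 with hS
    have h2 : ∀ i j, (t i j x + A * e i j x) ^ 2 ≤
        2 * B ^ 2 + 2 * A ^ 2 * C ^ 2 * (N ^ 2 * S) := by
      intro i j
      have h3 : t i j x ^ 2 ≤ B ^ 2 := by
        rw [← sq_abs]; exact pow_le_pow_left₀ (abs_nonneg _) (htB x hx i j) 2
      have h4 : e i j x ^ 2 ≤ C ^ 2 * (N ^ 2 * S) := by
        rw [← sq_abs]
        refine (pow_le_pow_left₀ (abs_nonneg _) (heH x hx i j) 2).trans ?_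
        rw [mul_pow]
        exact mul_le_mul_of_nonneg_left (sum_sum_abs_sq_le fun i j => H i j x) (sq_nonneg C)
      have h5 := mul_le_mul_of_nonneg_left h4 (sq_nonneg A)
      nlinarith [sq_nonneg (t i j x - A * e i j x)]
    calc _ ≤ ∑ i : Fin N, ∑ j : Fin N, (2 * B ^ 2 + 2 * A ^ 2 * C ^ 2 * (N ^ 2 * S)) :=
          Finset.sum_le_sum fun i _ => Finset.sum_le_sum fun j _ => h2 i j
      _ = _ := by
          simp only [Finset.sum_const, Finset.card_univ, Fintype.card_fin, nsmul_eq_mul]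
          ring
  refine h1.trans (le_of_eq ?_)
  rw [integral_add, setIntegral_const, integral_const_mul, smul_eq_mul]
  · ring
  · exact integrableOn_hull (by fun_prop)
  · exact integrableOn_hull (by fun_prop)

end Element

namespace Triangulation

section Jump

variable {d : ℕ} {Ω : Set (E d)} {T : Triangulation Ω}

/-- The jump of a piecewise polynomial is the restriction of one polynomial to the side. -/
theorem exists_jumpPoly {F : Finset (E d)} (hF : F ∈ T.sides)
    {U : Finset (E d) → MvPolynomial (Fin d) ℝ} {m : ℕ}
    (hU : ∀ K ∈ T.elements, (U K).totalDegree ≤ m) :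
    ∃ q : MvPolynomial (Fin d) ℝ, q.totalDegree ≤ m ∧
      ∀ x, T.jump (fun K => polyEval (U K)) F x = polyEval q x := by
  classical
  refine ⟨U (T.plus F) - ∑ K ∈ T.elements.filter (fun K => F ⊆ K ∧ K ≠ T.plus F), U K, ?_, ?_⟩
  · refine (MvPolynomial.totalDegree_sub _ _).trans (max_le (hU _ (T.plus_spec hF).1) ?_)
    exact MvPolynomial.totalDegree_finsetSum_le fun K hK => hU K (Finset.mem_filter.1 hK).1
  · intro x
    have h : polyEval (U (T.plus F) -
        ∑ K ∈ T.elements.filter (fun K => F ⊆ K ∧ K ≠ T.plus F), U K) x =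
        polyEval (U (T.plus F)) x -
          ∑ K ∈ T.elements.filter (fun K => F ⊆ K ∧ K ≠ T.plus F), polyEval (U K) x := by
      rw [← polyEval_sum]
      exact map_sub _ _ _
    rw [h, jump]

end Jump

end Triangulation

namespace Triangulation

variable {n : ℕ} {Ω : Set (E (n + 1))} {T : Triangulation Ω}

/-! ### The test field -/

theorem localPoly_of_mem_VH {k : ℕ} {v : E (n + 1) → ℝ} (hv : v ∈ T.VH k) {K : Finset (E (n + 1))}
    (hK : K ∈ T.elements) : (localPoly K v).totalDegree ≤ k - 2 := by
  obtain ⟨p, hp, hpv⟩ := hv.2 K hK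
  rwa [localPoly_eq (isSimplex hK).interior_nonempty hpv]

theorem agrees_of_mem_VH {k : ℕ} {v : E (n + 1) → ℝ} (hv : v ∈ T.VH k) :
    T.Agrees v fun K => polyEval (localPoly K v) := agrees_localPoly hv.2

theorem integral_sum_sq_glueMat (hreg : interior (closure Ω) = Ω)
    (P : Finset (E (n + 1)) → Matrix (Fin (n + 1)) (Fin (n + 1)) (MvPolynomial (Fin (n + 1)) ℝ)) :
    ∫ x in Ω, ∑ i, ∑ j, T.glueMat P x i j ^ 2 =
      ∑ K ∈ T.elements, ∫ x in hull K, ∑ i, ∑ j, polyEval (P K i j) x ^ 2 := by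
  have hae : ∀ K ∈ T.elements, (fun x => ∑ i, ∑ j, T.glueMat P x i j ^ 2) =ᵐ[volume.restrict
      (hull K)] fun x => ∑ i, ∑ j, polyEval (P K i j) x ^ 2 := by
    intro K hK
    have h : ∀ᵐ x ∂(volume.restrict (hull K)), ∀ i j, T.glueMat P x i j = polyEval (P K i j) x := by
      rw [ae_all_iff]
      intro i
      rw [ae_all_iff]
      intro j
      exact T.agrees_glue (by omega) _ K hK
    filter_upwards [h] with x hx
    simp only [hx]
  have hcont : ∀ K, Continuous fun x => ∑ i, ∑ j, polyEval (P K i j) x ^ 2 := fun K =>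
    continuous_finsetSum _ fun i _ => continuous_finsetSum _ fun j _ =>
      (continuous_polyEval _).pow 2
  rw [T.integral_eq_sum (by omega) hreg fun K hK => (integrableOn_hull (hcont K)).congr
    (hae K hK).symm]
  exact Finset.sum_congr rfl fun K hK => integral_congr_ae (hae K hK)

open scoped Classical in
/-- The contribution of the side `F` to the square of the mesh-dependent seminorm. -/
noncomputable def sideEnergy (T : Triangulation Ω) (v : E (n + 1) → ℝ) (F : Finset (E (n + 1))) :
    ℝ :=
  (sideDiam F)⁻¹ * sideNormSq F (T.jump (gradNormal v (T.normal F)) F) +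
    if T.IsBoundary F then 0 else
      (sideDiam F ^ 3)⁻¹ * sideNormSq F (T.jump (fun K => polyEval (localPoly K v)) F)

theorem sideNormSq_nonneg {d : ℕ} (F : Finset (E d)) (w : E d → ℝ) : 0 ≤ sideNormSq F w :=
  integral_nonneg fun _ => sq_nonneg _

theorem sideDiam_nonneg {d : ℕ} (F : Finset (E d)) : 0 ≤ sideDiam F := Metric.diam_nonneg

theorem sideEnergy_nonneg (v : E (n + 1) → ℝ) (F : Finset (E (n + 1))) : 0 ≤ T.sideEnergy v F := by
  have h := sideDiam_nonneg F
  unfold sideEnergy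
  refine add_nonneg (mul_nonneg (by positivity) (sideNormSq_nonneg _ _)) ?_
  split_ifs
  · exact le_rfl
  · exact mul_nonneg (by positivity) (sideNormSq_nonneg _ _)

theorem h2SeminormSq_nonneg {d : ℕ} (v : E d → ℝ) (K : Finset (E d)) : 0 ≤ h2SeminormSq v K :=
  integral_nonneg fun _ => Finset.sum_nonneg fun _ _ => Finset.sum_nonneg fun _ _ => sq_nonneg _

theorem seminorm2h_sq (v : E (n + 1) → ℝ) : T.seminorm2h v ^ 2 =
    ∑ K ∈ T.elements, h2SeminormSq v K + ∑ F ∈ T.sides, T.sideEnergy v F := by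
  have h : ∑ K ∈ T.elements, h2SeminormSq v K
    + ∑ F ∈ T.interiorSides, (sideDiam F ^ 3)⁻¹ *
        sideNormSq F (T.jump (fun K => polyEval (localPoly K v)) F)
    + ∑ F ∈ T.sides, (sideDiam F)⁻¹ * sideNormSq F (T.jump (gradNormal v (T.normal F)) F) =
    ∑ K ∈ T.elements, h2SeminormSq v K + ∑ F ∈ T.sides, T.sideEnergy v F := by
    unfold sideEnergy interiorSides
    rw [Finset.sum_add_distrib, Finset.sum_filter]
    simp only [ite_not]
    ring
  rw [seminorm2h, Real.sq_sqrt, h]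
  rw [h]
  exact add_nonneg (Finset.sum_nonneg fun K _ => h2SeminormSq_nonneg v K)
    (Finset.sum_nonneg fun F _ => sideEnergy_nonneg v F)

open scoped Classical in
/-- The polynomials prescribing the degrees of freedom of the test field on the sides: the normal
trace is `-h_F⁻¹ b_F [∂ₙ v] n_F` with the bubble function `b_F` of `F`, and the normal component of
the divergence is `h_F⁻³ [v]`, or zero on the boundary. -/
theorem exists_sideData (n m : ℕ) (hn : 1 ≤ n) (hn2 : n ≤ 2) (γ : ℝ) : ∃ C : ℝ, 0 < C ∧
    ∀ {Ω : Set (E (n + 1))} {T : Triangulation Ω}, T.ShapeRegular γ →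
    ∀ v ∈ T.VH (m + 3), ∃ Z D : Finset (E (n + 1)) → MvPolynomial (E (n + 1)) ℝ,
      (∀ F ∈ T.sides, (Z F).IsHomogeneous (m + 3)) ∧
      (∀ F ∈ T.sides, Z F ∈ MvPolynomial.supported ℝ (F : Set (E (n + 1)))) ∧
      (∀ F ∈ T.sides, ∀ l : E (n + 1) → ℝ, ∀ a ∈ F, l a = 0 → MvPolynomial.eval l (Z F) = 0) ∧
      (∀ F ∈ T.sides, (D F).IsHomogeneous (m + 2)) ∧
      (∀ F ∈ T.sides, D F ∈ MvPolynomial.supported ℝ (F : Set (E (n + 1)))) ∧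
      (∀ F ∈ T.sides, T.IsBoundary F → D F = 0) ∧
      (∀ F ∈ T.sides, ∀ K ∈ T.elements, F ⊆ K → volume.real (hull K) *
        (coeffNorm (Z F) + Metric.diam (hull K) * coeffNorm (D F)) ^ 2 ≤ C * T.sideEnergy v F) ∧
      ∀ F ∈ T.sides, T.sideEnergy v F ≤ C * ∫ x in hull F,
        (MvPolynomial.eval (fun a => bary (T.plus F) a x) (D F) *
          T.jump (fun K => polyEval (localPoly K v)) F x -
        MvPolynomial.eval (fun a => bary (T.plus F) a x) (Z F) *
          T.jump (gradNormal v (T.normal F)) F x) ∂(Measure.euclideanHausdorffMeasure n) := by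
  -- `D` has degree `m + 2`; the factor `[∂ₙ v]` of `Z` is written with degree `m + 2 - n ≥ m`, so
  -- that `Z` has degree `m + 3` after multiplication with the `n + 1` factors of the bubble
  obtain ⟨C0, hC0, hbd0⟩ := exists_sidePoly n (m + 2)
  obtain ⟨C1, hC1, hbd1⟩ := exists_sidePoly n (m + 2 - n)
  refine ⟨1 + C1 + 2 * (C1 * |γ| + C0 * |γ| ^ 3), by positivity, ?_⟩
  intro Ω T hT v hv
  have hV : ∀ K ∈ T.elements, (localPoly K v).totalDegree ≤ m + 1 := fun K hK =>
    localPoly_of_mem_VH hv hK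
  have hq0 : ∀ F ∈ T.sides, ∃ q : MvPolynomial (Fin (n + 1)) ℝ, q.totalDegree ≤ m + 2 ∧
      T.jump (fun K => polyEval (localPoly K v)) F = polyEval q := by
    intro F hF
    obtain ⟨q, hq, hqe⟩ := exists_jumpPoly hF hV
    exact ⟨q, hq.trans (by omega), funext hqe⟩
  have hq1 : ∀ F ∈ T.sides, ∃ q : MvPolynomial (Fin (n + 1)) ℝ, q.totalDegree ≤ m + 2 - n ∧
      T.jump (gradNormal v (T.normal F)) F = polyEval q := by
    intro F hF
    obtain ⟨q, hq, hqe⟩ := exists_jumpPoly (U := fun K => ∑ i,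
      MvPolynomial.C (T.normal F i) * MvPolynomial.pderiv i (localPoly K v)) hF (m := m)
      fun K hK => MvPolynomial.totalDegree_finsetSum_le fun i _ => by
        refine (MvPolynomial.totalDegree_mul _ _).trans ?_
        rw [MvPolynomial.totalDegree_C, zero_add]
        exact totalDegree_pderiv_le (hV K hK) i
    refine ⟨q, hq.trans (by omega), funext fun x => ?_⟩
    rw [← hqe]
    congr 1
    funext K y
    simp only [gradNormal, polyEval_sum, polyEval_C_mul]
    exact Finset.sum_congr rfl fun i _ => mul_comm _ _
  choose! q0 hq0d hq0e using hq0
  choose! q1 hq1d hq1e using hq1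
  have hex0 := fun F (hF : F ∈ T.sides) => hbd0 hF (hq0d F hF)
  have hex1 := fun F (hF : F ∈ T.sides) => hbd1 hF (hq1d F hF)
  choose! W0 hW0h hW0s hW0e hW0n _ using hex0
  choose! W1 hW1h hW1s hW1e hW1n hW1l using hex1
  have hZh : ∀ F ∈ T.sides, (MvPolynomial.C (-(sideDiam F)⁻¹) *
      ((∏ a ∈ F, MvPolynomial.X a) * W1 F)).IsHomogeneous (m + 3) := by
    intro F hF
    have h1 : (∏ a ∈ F, (MvPolynomial.X a : MvPolynomial (E (n + 1)) ℝ)).IsHomogeneous (n + 1) := by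
      have := MvPolynomial.IsHomogeneous.prod F
        (fun a => (MvPolynomial.X a : MvPolynomial (E (n + 1)) ℝ)) (fun _ => 1)
        fun a _ => MvPolynomial.isHomogeneous_X ℝ a
      rwa [Finset.sum_const, smul_eq_mul, mul_one, (T.mem_sides.1 hF).2] at this
    have h2 := (h1.mul (hW1h F hF)).C_mul (-(sideDiam F)⁻¹)
    rwa [show n + 1 + (m + 2 - n) = m + 3 by omega] at h2
  refine ⟨fun F => MvPolynomial.C (-(sideDiam F)⁻¹) * ((∏ a ∈ F, MvPolynomial.X a) * W1 F),
    fun F => if T.IsBoundary F then 0 else MvPolynomial.C (sideDiam F ^ 3)⁻¹ * W0 F,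
    hZh, ?_, ?_, ?_, ?_, ?_, ?_, ?_⟩
  · intro F hF
    exact mul_mem (C_mem_supported _ _) (mul_mem (prod_mem fun a ha =>
      MvPolynomial.X_mem_supported.2 ha) (hW1s F hF))
  · intro F hF l a ha hl
    have h0 : ∏ a ∈ F, l a = 0 := Finset.prod_eq_zero ha hl
    simp [map_prod, h0]
  · intro F hF
    beta_reduce
    split_ifs
    · exact MvPolynomial.isHomogeneous_zero _ _ _
    · exact (hW0h F hF).C_mul _
  · intro F hF
    beta_reduce
    split_ifs
    · exact zero_mem _
    · exact mul_mem (C_mem_supported _ _) (hW0s F hF)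
  · intro F hF hb
    exact if_pos hb
  · intro F hF K hK hFK
    have hγ := hT.pos hK
    have hh := diam_hull_pos hK
    have hhF := sideDiam_pos hn hF
    have hle := hT.diam_le hn hF hK hFK
    have hn0 := hW0n F hF K hK hFK
    have hn1 := hW1n F hF K hK hFK
    rw [abs_of_pos hγ]
    set h := Metric.diam (hull K)
    set hF' := sideDiam F
    set S0 := sideNormSq F (polyEval (q0 F)) with hS0
    set S1 := sideNormSq F (polyEval (q1 F)) with hS1
    have hS00 : 0 ≤ S0 := sideNormSq_nonneg _ _
    have hS10 : 0 ≤ S1 := sideNormSq_nonneg _ _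
    have hvol : 0 ≤ volume.real (hull K) := measureReal_nonneg
    set vol := volume.real (hull K)
    have hE : T.sideEnergy v F = hF'⁻¹ * S1 + if T.IsBoundary F then 0 else (hF' ^ 3)⁻¹ * S0 := by
      rw [sideEnergy, hq0e F hF, hq1e F hF]
    have e1 : vol * coeffNorm (MvPolynomial.C (-hF'⁻¹) *
        ((∏ a ∈ F, MvPolynomial.X a) * W1 F)) ^ 2 ≤ C1 * γ * (hF'⁻¹ * S1) := by
      have f1 : coeffNorm (MvPolynomial.C (-hF'⁻¹) * ((∏ a ∈ F, MvPolynomial.X a) * W1 F)) ≤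
          hF'⁻¹ * coeffNorm (W1 F) := by
        refine (coeffNorm_C_mul_le _ _).trans ?_
        rw [abs_neg, abs_of_pos (by positivity)]
        refine mul_le_mul_of_nonneg_left ?_ (by positivity)
        exact (coeffNorm_mul_le _ _).trans (mul_le_of_le_one_left (coeffNorm_nonneg _)
          (coeffNorm_prod_X_le F))
      calc _ ≤ vol * (hF'⁻¹ * coeffNorm (W1 F)) ^ 2 := mul_le_mul_of_nonneg_left
            (pow_le_pow_left₀ (coeffNorm_nonneg _) f1 2) hvol
        _ = hF'⁻¹ ^ 2 * (vol * coeffNorm (W1 F) ^ 2) := by ring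
        _ ≤ hF'⁻¹ ^ 2 * (C1 * h * S1) := mul_le_mul_of_nonneg_left hn1 (by positivity)
        _ ≤ hF'⁻¹ ^ 2 * (C1 * (γ * hF') * S1) := mul_le_mul_of_nonneg_left
            (mul_le_mul_of_nonneg_right (mul_le_mul_of_nonneg_left hle hC1.le) hS10)
            (by positivity)
        _ = _ := by field_simp
    have e0 : vol * (h * coeffNorm (if T.IsBoundary F then 0 else
        MvPolynomial.C (hF' ^ 3)⁻¹ * W0 F)) ^ 2 ≤
        C0 * γ ^ 3 * if T.IsBoundary F then 0 else (hF' ^ 3)⁻¹ * S0 := by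
      split_ifs
      · simp
      · have f1 : coeffNorm (MvPolynomial.C (hF' ^ 3)⁻¹ * W0 F) ≤
            (hF' ^ 3)⁻¹ * coeffNorm (W0 F) := by
          refine (coeffNorm_C_mul_le _ _).trans ?_
          rw [abs_of_pos (by positivity)]
        calc _ ≤ vol * (h * ((hF' ^ 3)⁻¹ * coeffNorm (W0 F))) ^ 2 := mul_le_mul_of_nonneg_left
              (pow_le_pow_left₀ (mul_nonneg hh.le (coeffNorm_nonneg _))
                (mul_le_mul_of_nonneg_left f1 hh.le) 2) hvol
          _ = ((hF' ^ 3)⁻¹) ^ 2 * h ^ 2 * (vol * coeffNorm (W0 F) ^ 2) := by ring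
          _ ≤ ((hF' ^ 3)⁻¹) ^ 2 * h ^ 2 * (C0 * h * S0) :=
              mul_le_mul_of_nonneg_left hn0 (by positivity)
          _ = ((hF' ^ 3)⁻¹) ^ 2 * C0 * S0 * h ^ 3 := by ring
          _ ≤ ((hF' ^ 3)⁻¹) ^ 2 * C0 * S0 * (γ * hF') ^ 3 :=
              mul_le_mul_of_nonneg_left (pow_le_pow_left₀ hh.le hle 3) (by positivity)
          _ = _ := by field_simp
    have hE1 : 0 ≤ hF'⁻¹ * S1 := by positivity
    have hE0 : 0 ≤ if T.IsBoundary F then 0 else (hF' ^ 3)⁻¹ * S0 := by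
      split_ifs
      · exact le_rfl
      · positivity
    rw [hE]
    beta_reduce
    set x1 := coeffNorm (MvPolynomial.C (-hF'⁻¹) * ((∏ a ∈ F, MvPolynomial.X a) * W1 F))
    set x0 := h * coeffNorm (if T.IsBoundary F then 0 else MvPolynomial.C (hF' ^ 3)⁻¹ * W0 F)
    set E1 := hF'⁻¹ * S1
    set E0 := if T.IsBoundary F then 0 else (hF' ^ 3)⁻¹ * S0
    have g1 : vol * (x1 + x0) ^ 2 ≤ 2 * (vol * x1 ^ 2) + 2 * (vol * x0 ^ 2) := by
      nlinarith [mul_nonneg hvol (sq_nonneg (x1 - x0))]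
    have g2 : 0 ≤ (C1 * γ) * E0 := by positivity
    have g3 : 0 ≤ (C0 * γ ^ 3) * E1 := by positivity
    have g4 : 0 ≤ (1 + C1) * (E1 + E0) := by positivity
    linarith
  · intro F hF
    obtain ⟨hP, hFP⟩ := T.plus_spec hF
    have hhF := sideDiam_pos hn hF
    have hl := hW1l F hF
    set S0 := sideNormSq F (polyEval (q0 F)) with hS0
    set S1 := sideNormSq F (polyEval (q1 F)) with hS1
    have hS00 : 0 ≤ S0 := sideNormSq_nonneg _ _
    have hS10 : 0 ≤ S1 := sideNormSq_nonneg _ _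
    set I := ∫ x in hull F, (∏ a ∈ F, bary (T.plus F) a x) * polyEval (q1 F) x ^ 2
      ∂(Measure.euclideanHausdorffMeasure n) with hI
    have hI0 : 0 ≤ I := nonneg_of_mul_nonneg_right (hS10.trans hl) hC1
    set E0 := if T.IsBoundary F then 0 else (sideDiam F ^ 3)⁻¹ * S0 with hE0
    have hE00 : 0 ≤ E0 := by
      rw [hE0]
      split_ifs
      · exact le_rfl
      · positivity
    have hcq := continuous_polyEval (q0 F)
    have hcq1 := continuous_polyEval (q1 F)
    have hcb : Continuous fun x => ∏ a ∈ F, bary (T.plus F) a x :=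
      continuous_finsetProd _ fun a _ => continuous_bary _ a
    have hint : ∫ x in hull F,
        (MvPolynomial.eval (fun a => bary (T.plus F) a x) (if T.IsBoundary F then 0 else
          MvPolynomial.C (sideDiam F ^ 3)⁻¹ * W0 F) *
          T.jump (fun K => polyEval (localPoly K v)) F x -
        MvPolynomial.eval (fun a => bary (T.plus F) a x) (MvPolynomial.C (-(sideDiam F)⁻¹) *
          ((∏ a ∈ F, MvPolynomial.X a) * W1 F)) *
          T.jump (gradNormal v (T.normal F)) F x) ∂(Measure.euclideanHausdorffMeasure n) =
        E0 + (sideDiam F)⁻¹ * I := by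
      have h1 : ∀ x ∈ hull F,
          MvPolynomial.eval (fun a => bary (T.plus F) a x) (if T.IsBoundary F then 0 else
            MvPolynomial.C (sideDiam F ^ 3)⁻¹ * W0 F) *
            T.jump (fun K => polyEval (localPoly K v)) F x -
          MvPolynomial.eval (fun a => bary (T.plus F) a x) (MvPolynomial.C (-(sideDiam F)⁻¹) *
            ((∏ a ∈ F, MvPolynomial.X a) * W1 F)) *
            T.jump (gradNormal v (T.normal F)) F x =
          (if T.IsBoundary F then 0 else (sideDiam F ^ 3)⁻¹) * polyEval (q0 F) x ^ 2 +
          (sideDiam F)⁻¹ * ((∏ a ∈ F, bary (T.plus F) a x) * polyEval (q1 F) x ^ 2) := by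
        intro x hx
        rw [hq0e F hF, hq1e F hF]
        have h2 := hW0e F hF _ hP hFP x hx
        have h3 := hW1e F hF _ hP hFP x hx
        simp only [map_mul, MvPolynomial.eval_C, map_prod, MvPolynomial.eval_X, h3]
        split_ifs
        · simp only [map_zero]; ring
        · simp only [map_mul, MvPolynomial.eval_C, h2]; ring
      rw [setIntegral_congr_fun (measurableSet_hull F) h1, T.integral_side_add hF
        (f := fun x => (if T.IsBoundary F then 0 else (sideDiam F ^ 3)⁻¹) * polyEval (q0 F) x ^ 2)
        (g := fun x => (sideDiam F)⁻¹ *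
          ((∏ a ∈ F, bary (T.plus F) a x) * polyEval (q1 F) x ^ 2))
        (continuous_const.mul (hcq.pow 2)) (continuous_const.mul (hcb.mul (hcq1.pow 2))),
        integral_const_mul, integral_const_mul]
      congr 1
      rw [hE0, ite_mul, zero_mul]
      rfl
    beta_reduce
    rw [hint, sideEnergy, hq0e F hF, hq1e F hF]
    have hh : 0 < (sideDiam F)⁻¹ := by positivity
    have g1 : (sideDiam F)⁻¹ * S1 ≤ (sideDiam F)⁻¹ * (C1 * I) :=
      mul_le_mul_of_nonneg_left hl hh.le
    have g2 : 0 ≤ (1 + 2 * (C1 * |γ| + C0 * |γ| ^ 3)) * ((sideDiam F)⁻¹ * I) := by positivity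
    have g3 : 0 ≤ (C1 + 2 * (C1 * |γ| + C0 * |γ| ^ 3)) * E0 := by positivity
    change (sideDiam F)⁻¹ * S1 + E0 ≤ _
    linarith

end Triangulation

namespace Triangulation

/-! ### The stability estimate -/

theorem polyEval_edgeField_add_smul {d : ℕ} (K : Finset (E d))
    (Q Q' : E d → E d → MvPolynomial (Fin d) ℝ) (A : ℝ) (i j : Fin d) (x : E d) :
    polyEval (edgeField K (fun a b => Q a b + MvPolynomial.C A * Q' a b) i j) x =
      polyEval (edgeField K Q i j) x + A * polyEval (edgeField K Q' i j) x := by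
  simp only [polyEval_edgeField, Finset.mul_sum, ← Finset.sum_add_distrib]
  refine Finset.sum_congr rfl fun a _ => Finset.sum_congr rfl fun b _ => ?_
  simp only [polyEval, map_add, map_mul, MvPolynomial.eval_C]
  ring

/-- The data of the field `-τ`. -/
theorem IsFieldData.neg {n k : ℕ} {Ω : Set (E (n + 1))} {T : Triangulation Ω}
    {Z D : Finset (E (n + 1)) → MvPolynomial (E (n + 1)) ℝ}
    {Q : Finset (E (n + 1)) → E (n + 1) → E (n + 1) → MvPolynomial (Fin (n + 1)) ℝ}
    (h : T.IsFieldData k Z D Q) :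
    T.IsFieldData k (fun F => -Z F) (fun F => -D F) (fun K a b => -Q K a b) where
  degree_side F hF := by rw [MvPolynomial.totalDegree_neg]; exact h.degree_side F hF
  degree_edge K hK a b := by rw [MvPolynomial.totalDegree_neg]; exact h.degree_edge K hK a b
  symm K hK a b := by rw [h.symm K hK a b]
  vanish F hF l a ha hl := by rw [map_neg, h.vanish F hF l a ha hl, neg_zero]
  side_local F hF l l' hl := by rw [map_neg, map_neg, h.side_local F hF l l' hl]
  div_local F hF l l' hl := by rw [map_neg, map_neg, h.div_local F hF l l' hl]
  div_boundary F hF hb := by rw [h.div_boundary F hF hb, neg_zero]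
  div_eq K hK c hc x hx := by
    have h1 : T.divSidePoly (fun F => -Z F) K (baryGrad K c) =
        -T.divSidePoly Z K (baryGrad K c) := by
      simp only [divSidePoly, map_neg, mul_neg, Finset.sum_neg_distrib]
    have h2 : ∀ b, polyEval (-Q K c b) x = -polyEval (Q K c b) x := fun b => map_neg _ _
    simp only [h1, h2, map_neg, mul_neg, Finset.sum_neg_distrib]
    rw [← h.div_eq K hK c hc x hx]
    ring

theorem glueMat_localField_neg {n : ℕ} {Ω : Set (E (n + 1))} {T : Triangulation Ω}
    (Z : Finset (E (n + 1)) → MvPolynomial (E (n + 1)) ℝ)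
    (Q : Finset (E (n + 1)) → E (n + 1) → E (n + 1) → MvPolynomial (Fin (n + 1)) ℝ) :
    T.glueMat (T.localField (fun F => -Z F) fun K a b => -Q K a b) =
      -T.glueMat (T.localField Z Q) := by
  have h : ∀ K i j, T.localField (fun F => -Z F) (fun K a b => -Q K a b) K i j =
      -T.localField Z Q K i j := by
    intro K i j
    simp only [localField, sideField, edgeField, onElement, map_neg, mul_neg,
      Finset.sum_neg_distrib, neg_add]
  funext x i j
  simp only [glueMat, glue, h, Pi.neg_apply, Matrix.neg_apply, ← Finset.sum_neg_distrib]
  refine Finset.sum_congr rfl fun K _ => ?_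
  by_cases hx : x ∈ openHull K <;> simp [hx, polyEval]

open scoped Classical in
/-- Every `v ∈ V_h` has a test field in `Σ_h` that realizes the seminorm of `v` up to constants
depending only on the shape regularity. -/
theorem exists_test_field (n m : ℕ) (hn : 1 ≤ n) (hn2 : n ≤ 2) (γ : ℝ) :
    ∃ c C : ℝ, 0 < c ∧ 0 < C ∧ ∀ {Ω : Set (E (n + 1))}, IsOpen Ω → interior (closure Ω) = Ω →
    ∀ {T : Triangulation Ω}, T.ShapeRegular γ → ∀ v ∈ T.VH (m + 3),
      ∃ τ ∈ T.SigmaH (m + 3), -τ ∈ T.SigmaH (m + 3) ∧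
        ∃ g : E (n + 1) → ℝ, HasWeakDivDiv Ω τ g ∧
        c * T.seminorm2h v ^ 2 ≤ ∫ x in Ω, g x * v x ∧
        l2Norm Ω τ ^ 2 ≤ C * T.seminorm2h v ^ 2 := by
  obtain ⟨C1, hC1, hside⟩ := exists_sideData n m hn hn2 γ
  obtain ⟨C2, hC2, hcorr⟩ := exists_correction n m γ
  obtain ⟨C3, hC3, hhess⟩ := exists_hess_bounds n m γ
  set N : ℝ := ((n + 1 : ℕ) : ℝ) with hN
  -- `C4` bounds `‖τ_c + τ_b‖²` by the side terms of the seminorm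
  set C4 : ℝ := N ^ 2 * (C2 ^ 2 * ((n + 2) * C1)) with hC4
  have hN0 : 0 < N := by rw [hN]; positivity
  have hC40 : 0 < C4 := by positivity
  -- Young's inequality is applied with `ε`, chosen such that half of the side terms is kept
  set ε : ℝ := 1 / (4 * C1 * C4) with hε
  have hε0 : 0 < ε := by positivity
  -- the weight of the Hessian part is such that the full Hessian terms remain
  set A : ℝ := C3 * (1 + 1 / (4 * ε)) with hA
  have hA0 : 0 < A := by positivity
  refine ⟨min 1 (1 / (2 * C1)), 4 * C4 + 2 * N ^ 4 * A ^ 2 * C3 ^ 2,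
    lt_min one_pos (by positivity), by positivity, ?_⟩
  intro Ω hopen hreg T hT v hv
  obtain ⟨Z, D, hZ, hZs, hZv, hD, hDs, hDb, hZD, hlow⟩ := hside hT v hv
  choose! Qc hsym hdeg hsol hbd using hcorr hT hZ hZs hD hDs
  set V : Finset (E (n + 1)) → MvPolynomial (Fin (n + 1)) ℝ := fun K => localPoly K v with hVdef
  have hV : ∀ K ∈ T.elements, (V K).totalDegree ≤ m + 1 := fun K hK => localPoly_of_mem_VH hv hK
  set Qh : Finset (E (n + 1)) → E (n + 1) → E (n + 1) → MvPolynomial (Fin (n + 1)) ℝ :=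
    fun K => hessEdgePoly K (V K) (Metric.diam (hull K) ^ 4)⁻¹ with hQh
  set Q : Finset (E (n + 1)) → E (n + 1) → E (n + 1) → MvPolynomial (Fin (n + 1)) ℝ :=
    fun K a b => Qc K a b + MvPolynomial.C A * Qh K a b with hQ
  have hdata : T.IsFieldData (m + 3) Z D Q := by
    refine ⟨fun F hF => (hZ F hF).totalDegree_le, fun K hK a b => ?_, fun K hK a b => ?_, hZv,
      fun F hF l l' h => eval_eq_of_mem_supported (hZs F hF) h,
      fun F hF l l' h => eval_eq_of_mem_supported (hDs F hF) h, hDb, fun K hK c hc x hx => ?_⟩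
    · have h1 : (Q K a b).totalDegree ≤ m + 1 := by
        refine (MvPolynomial.totalDegree_add _ _).trans (max_le (hdeg K hK a b) ?_)
        refine (MvPolynomial.totalDegree_mul _ _).trans ?_
        rw [MvPolynomial.totalDegree_C, zero_add]
        exact totalDegree_hessEdgePoly_le (hV K hK) _ a b
      omega
    · simp only [hQ, hQh]
      rw [hsym K hK a b, hessEdgePoly_symm]
    · rw [← hsol K hK c hc x hx]
      congr 2
      refine Finset.sum_congr rfl fun b _ => ?_
      have h1 : polyEval (Q K c b) x = polyEval (Qc K c b) x := by
        simp only [hQ, hQh, hessEdgePoly]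
        have h2 : polyEval (Qc K c b + MvPolynomial.C A * (MvPolynomial.C
            (Metric.diam (hull K) ^ 4)⁻¹ * (baryPoly K c * baryPoly K b * edgeHess (V K) c b))) x =
            polyEval (Qc K c b) x + A * ((Metric.diam (hull K) ^ 4)⁻¹ *
              (bary K c x * bary K b x * polyEval (edgeHess (V K) c b) x)) := by
          simp only [← polyEval_baryPoly, polyEval, map_add, map_mul, MvPolynomial.eval_C]
        rw [h2, hx]
        ring
      rw [h1]
  have hτ := hdata.mem_SigmaH hopen hreg
  -- on each element the field splits into the part fixed by the side data and the Hessian part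
  set t : Finset (E (n + 1)) → Fin (n + 1) → Fin (n + 1) → E (n + 1) → ℝ := fun K i j x =>
    polyEval (T.sideField Z K i j) x + polyEval (edgeField K (Qc K) i j) x with ht
  set e : Finset (E (n + 1)) → Fin (n + 1) → Fin (n + 1) → E (n + 1) → ℝ := fun K i j x =>
    polyEval (edgeField K (Qh K) i j) x with he
  set H : Finset (E (n + 1)) → Fin (n + 1) → Fin (n + 1) → E (n + 1) → ℝ := fun K i j x =>
    polyEval (MvPolynomial.pderiv i (MvPolynomial.pderiv j (V K))) x with hH
  have hP : ∀ K i j x, polyEval (T.localField Z Q K i j) x = t K i j x + A * e K i j x := by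
    intro K i j x
    have h1 : polyEval (T.localField Z Q K i j) x = polyEval (T.sideField Z K i j) x +
      polyEval (edgeField K (Q K) i j) x := map_add _ _ _
    rw [h1, hQ, polyEval_edgeField_add_smul]
    simp only [ht, he]
    ring
  have hct : ∀ K i j, Continuous (t K i j) := fun K i j =>
    (continuous_polyEval _).add (continuous_polyEval _)
  have hce : ∀ K i j, Continuous (e K i j) := fun K i j => continuous_polyEval _
  have hcH : ∀ K i j, Continuous (H K i j) := fun K i j => continuous_polyEval _
  set M : Finset (E (n + 1)) → ℝ := fun K => C2 * ∑ F ∈ T.sides with F ⊆ K,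
    (coeffNorm (Z F) + Metric.diam (hull K) * coeffNorm (D F)) with hM
  have htM : ∀ K ∈ T.elements, ∀ x ∈ hull K, ∀ i j, |t K i j x| ≤ M K := fun K hK x hx i j =>
    (abs_add_le _ _).trans (hbd K hK x hx i j)
  have hX : ∀ K, h2SeminormSq v K = ∫ x in hull K, ∑ i, ∑ j, H K i j x ^ 2 := fun K => rfl
  have hMvol : ∀ K ∈ T.elements, N ^ 2 * M K ^ 2 * volume.real (hull K) ≤
      C4 * ∑ F ∈ T.sides with F ⊆ K, T.sideEnergy v F := by
    intro K hK
    have h1 := sq_sum_le_card_mul_sum_sq (s := T.sides.filter (fun F => F ⊆ K))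
      (f := fun F => coeffNorm (Z F) + Metric.diam (hull K) * coeffNorm (D F))
    have h2 : ((T.sides.filter (fun F => F ⊆ K)).card : ℝ) ≤ n + 2 := by
      exact_mod_cast card_sides_filter_le hK
    have h3 : (∑ F ∈ T.sides with F ⊆ K, (coeffNorm (Z F) +
        Metric.diam (hull K) * coeffNorm (D F)) ^ 2) * volume.real (hull K) ≤
        C1 * ∑ F ∈ T.sides with F ⊆ K, T.sideEnergy v F := by
      rw [Finset.sum_mul, Finset.mul_sum]
      refine Finset.sum_le_sum fun F hF => ?_
      rw [Finset.mem_filter] at hF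
      rw [mul_comm]
      exact hZD F hF.1 K hK hF.2
    have hvol : 0 ≤ volume.real (hull K) := measureReal_nonneg
    have h4 : 0 ≤ ∑ F ∈ T.sides with F ⊆ K, (coeffNorm (Z F) +
        Metric.diam (hull K) * coeffNorm (D F)) ^ 2 := Finset.sum_nonneg fun F _ => sq_nonneg _
    calc _ = N ^ 2 * C2 ^ 2 * ((∑ F ∈ T.sides with F ⊆ K, (coeffNorm (Z F) +
          Metric.diam (hull K) * coeffNorm (D F))) ^ 2 * volume.real (hull K)) := by
          simp only [hM]; ring
      _ ≤ N ^ 2 * C2 ^ 2 * (((n + 2) * ∑ F ∈ T.sides with F ⊆ K, (coeffNorm (Z F) +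
          Metric.diam (hull K) * coeffNorm (D F)) ^ 2) * volume.real (hull K)) :=
          mul_le_mul_of_nonneg_left (mul_le_mul_of_nonneg_right
            (h1.trans (mul_le_mul_of_nonneg_right h2 h4)) hvol) (by positivity)
      _ = N ^ 2 * C2 ^ 2 * (n + 2) * ((∑ F ∈ T.sides with F ⊆ K, (coeffNorm (Z F) +
          Metric.diam (hull K) * coeffNorm (D F)) ^ 2) * volume.real (hull K)) := by ring
      _ ≤ N ^ 2 * C2 ^ 2 * (n + 2) * (C1 * ∑ F ∈ T.sides with F ⊆ K, T.sideEnergy v F) :=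
          mul_le_mul_of_nonneg_left h3 (by positivity)
      _ = _ := by rw [hC4]; ring
  set X := ∑ K ∈ T.elements, h2SeminormSq v K with hXdef
  set Y := ∑ F ∈ T.sides, T.sideEnergy v F with hYdef
  have hX0 : 0 ≤ X := Finset.sum_nonneg fun K _ => h2SeminormSq_nonneg v K
  have hY0 : 0 ≤ Y := Finset.sum_nonneg fun F _ => sideEnergy_nonneg v F
  have hMsum : ∑ K ∈ T.elements, N ^ 2 * M K ^ 2 * volume.real (hull K) ≤ C4 * (2 * Y) := by
    refine (Finset.sum_le_sum hMvol).trans ?_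
    rw [← Finset.mul_sum]
    exact mul_le_mul_of_nonneg_left
      (sum_elements_sum_sides_le fun F _ => sideEnergy_nonneg v F) hC40.le
  have hs : T.seminorm2h v ^ 2 = X + Y := seminorm2h_sq v
  refine ⟨_, hτ, glueMat_localField_neg Z Q ▸ hdata.neg.mem_SigmaH hopen hreg, _,
    exists_hasWeakDivDiv hopen hreg hτ, ?_, ?_⟩
  · have hglue : (T.glue fun K => polyEval (∑ i, MvPolynomial.pderiv i (∑ j,
        MvPolynomial.pderiv j (localMat (T.glueMat (T.localField Z Q)) K i j)))) =
        T.glue fun K => polyEval (∑ i, MvPolynomial.pderiv i (∑ j,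
        MvPolynomial.pderiv j (T.localField Z Q K i j))) := by
      funext x
      refine Finset.sum_congr rfl fun K hK => ?_
      beta_reduce
      rw [localMat_glueMat (by omega) hK]
    rw [hglue, hdata.integral_divDiv hreg (V := V) (agrees_of_mem_VH hv), hs]
    have h1 : ∀ K ∈ T.elements, h2SeminormSq v K - ε * (N ^ 2 * M K ^ 2 * volume.real (hull K)) ≤
        ∫ x in hull K, ∑ i, ∑ j, polyEval (T.localField Z Q K i j) x *
          polyEval (MvPolynomial.pderiv i (MvPolynomial.pderiv j (V K))) x := by
      intro K hK
      have h2 := le_integral_combination (hct K) (hce K) (hcH K) hC3 hε0 hA0.le (htM K hK)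
        (hhess hT hK (hV K hK)).1
      have h3 : A / C3 - 1 / (4 * ε) = 1 := by
        rw [hA, mul_div_cancel_left₀ _ hC3.ne']; ring
      rw [h3, one_mul, ← hX] at h2
      simp only [hP]
      exact h2
    have h4 : ∀ F ∈ T.sides, C1⁻¹ * T.sideEnergy v F ≤ ∫ x in hull F,
        (MvPolynomial.eval (fun a => bary (T.plus F) a x) (D F) *
          T.jump (fun K => polyEval (V K)) F x -
        MvPolynomial.eval (fun a => bary (T.plus F) a x) (Z F) *
          T.jump (fun K x => ∑ i, polyEval (MvPolynomial.pderiv i (V K)) x * T.normal F i) F x)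
          ∂(Measure.euclideanHausdorffMeasure n) := by
      intro F hF
      rw [inv_mul_le_iff₀ hC1]
      exact hlow F hF
    have h5 := Finset.sum_le_sum h1
    have h6 := Finset.sum_le_sum h4
    rw [Finset.sum_sub_distrib, ← Finset.mul_sum, ← hXdef] at h5
    rw [← Finset.mul_sum, ← hYdef] at h6
    have h7 : ε * ∑ K ∈ T.elements, N ^ 2 * M K ^ 2 * volume.real (hull K) ≤
        1 / (2 * C1) * Y := by
      refine (mul_le_mul_of_nonneg_left hMsum hε0.le).trans (le_of_eq ?_)
      rw [hε]
      field_simp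
      ring
    have h8 : min 1 (1 / (2 * C1)) * X ≤ 1 * X := mul_le_mul_of_nonneg_right (min_le_left _ _) hX0
    have h9 : min 1 (1 / (2 * C1)) * Y ≤ 1 / (2 * C1) * Y :=
      mul_le_mul_of_nonneg_right (min_le_right _ _) hY0
    have h10 : C1⁻¹ * Y = 1 / (2 * C1) * Y + 1 / (2 * C1) * Y := by field_simp; ring
    rw [mul_add]
    linarith
  · have h0 : 0 ≤ ∫ x in Ω, ∑ i, ∑ j, T.glueMat (T.localField Z Q) x i j ^ 2 :=
      integral_nonneg fun x => Finset.sum_nonneg fun i _ => Finset.sum_nonneg fun j _ => sq_nonneg _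
    rw [l2Norm, Real.sq_sqrt h0, integral_sum_sq_glueMat hreg, hs]
    have h1 : ∀ K ∈ T.elements, ∫ x in hull K, ∑ i, ∑ j, polyEval (T.localField Z Q K i j) x ^ 2 ≤
        2 * (N ^ 2 * M K ^ 2 * volume.real (hull K)) +
          2 * N ^ 4 * A ^ 2 * C3 ^ 2 * h2SeminormSq v K := by
      intro K hK
      have h2 := integral_combination_sq_le (A := A) (hct K) (hce K) (hcH K) (htM K hK)
        (hhess hT hK (hV K hK)).2
      rw [← hX] at h2
      simp only [hP]
      refine h2.trans (le_of_eq ?_)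
      rw [hN]
      ring
    have h3 := Finset.sum_le_sum h1
    rw [Finset.sum_add_distrib, ← Finset.mul_sum, ← Finset.mul_sum, ← hXdef] at h3
    have h4 : 0 ≤ 4 * C4 * X := by positivity
    have h5 : 0 ≤ 2 * N ^ 4 * A ^ 2 * C3 ^ 2 * Y := by positivity
    linarith

end Triangulation

/-! ### The inf-sup quotients -/

theorem HasWeakDivDiv.neg {d : ℕ} {Ω : Set (E d)} {τ : E d → Matrix (Fin d) (Fin d) ℝ}
    {g : E d → ℝ} (h : HasWeakDivDiv Ω τ g) : HasWeakDivDiv Ω (-τ) (-g) := by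
  refine ⟨MemLp.neg h.1, fun φ hφ => ?_⟩
  have h1 := h.2 φ hφ
  simp only [Pi.neg_apply, Matrix.neg_apply, neg_mul, Finset.sum_neg_distrib, integral_neg, h1]

theorem l2Norm_neg {d : ℕ} (Ω : Set (E d)) (τ : E d → Matrix (Fin d) (Fin d) ℝ) :
    l2Norm Ω (-τ) = l2Norm Ω τ := by
  simp only [l2Norm, Pi.neg_apply, Matrix.neg_apply, neg_sq]

theorem ae_eq_zero_of_l2Norm_eq_zero {d : ℕ} {Ω : Set (E d)}
    {τ : E d → Matrix (Fin d) (Fin d) ℝ} (hτ : ∀ i j, InL2 Ω fun x => τ x i j)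
    (h : l2Norm Ω τ = 0) : ∀ᵐ x ∂(volume.restrict Ω), ∀ i j, τ x i j = 0 := by
  have h0 : ∀ x, 0 ≤ ∑ i, ∑ j, τ x i j ^ 2 := fun x =>
    Finset.sum_nonneg fun i _ => Finset.sum_nonneg fun j _ => sq_nonneg _
  have h1 := (Real.sqrt_eq_zero (integral_nonneg h0)).1 h
  rw [integral_eq_zero_iff_of_nonneg h0 (integrable_finsetSum _ fun i _ =>
    integrable_finsetSum _ fun j _ => (hτ i j).integrable_sq)] at h1
  filter_upwards [h1] with x hx i j
  have h2 := (Finset.sum_eq_zero_iff_of_nonneg fun i _ =>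
    Finset.sum_nonneg fun j _ => sq_nonneg (τ x i j)).1 hx i (Finset.mem_univ i)
  exact pow_eq_zero_iff two_ne_zero |>.1
    ((Finset.sum_eq_zero_iff_of_nonneg fun j _ => sq_nonneg (τ x i j)).1 h2 j (Finset.mem_univ j))

/-- The weak `divDiv` of a field that vanishes almost everywhere is zero. -/
theorem HasWeakDivDiv.integral_mul_eq_zero {d : ℕ} {Ω : Set (E d)} (hopen : IsOpen Ω)
    (hbdd : Bornology.IsBounded Ω) {τ : E d → Matrix (Fin d) (Fin d) ℝ} {g : E d → ℝ}
    (h : HasWeakDivDiv Ω τ g) (hτ : ∀ i j, InL2 Ω fun x => τ x i j) (h0 : l2Norm Ω τ = 0)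
    (v : E d → ℝ) : ∫ x in Ω, g x * v x = 0 := by
  have hae := ae_eq_zero_of_l2Norm_eq_zero hτ h0
  have hfin : IsFiniteMeasure (volume.restrict Ω) :=
    ⟨by rw [Measure.restrict_apply_univ]; exact hbdd.measure_lt_top⟩
  have hgint : IntegrableOn g Ω := MemLp.integrable (by norm_num) h.1
  have key := hopen.ae_eq_zero_of_integral_contDiff_smul_eq_zero (μ := volume) (f := g)
    hgint.locallyIntegrableOn fun φ hφ hcs hsupp => by
      have h1 := h.2 φ ⟨hφ, hcs, hsupp⟩
      have h2 : ∫ x in Ω, ∑ i, ∑ j, τ x i j * partialDeriv i (partialDeriv j φ) x = 0 := by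
        rw [← integral_zero (E d) ℝ (μ := volume.restrict Ω)]
        refine integral_congr_ae ?_
        filter_upwards [hae] with x hx
        simp only [hx, zero_mul, Finset.sum_const_zero]
      rw [← h1.symm.trans h2]
      rw [← setIntegral_eq_integral_of_forall_compl_eq_zero (s := Ω)]
      · simp only [smul_eq_mul, mul_comm]
      · intro x hx
        have : φ x = 0 := by
          by_contra hne; exact hx (hsupp (subset_tsupport φ hne))
        rw [this, zero_smul]
  rw [← integral_zero (E d) ℝ (μ := volume.restrict Ω)]
  refine integral_congr_ae ?_
  rw [Filter.EventuallyEq, ae_restrict_iff' hopen.measurableSet]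
  filter_upwards [key] with x hx hxΩ
  rw [hx hxΩ, zero_mul]

namespace Triangulation

variable {n : ℕ} {Ω : Set (E (n + 1))} {T : Triangulation Ω}

theorem inL2_of_mem_SigmaH {k : ℕ} {τ : E (n + 1) → Matrix (Fin (n + 1)) (Fin (n + 1)) ℝ}
    (hτ : τ ∈ T.SigmaH k) (i j : Fin (n + 1)) : InL2 Ω fun x => τ x i j := hτ.1.1.1.1 i j

theorem elements_nonempty (h : Ω.Nonempty) : T.elements.Nonempty := by
  obtain ⟨x, hx⟩ := h
  have h1 := subset_closure hx
  rw [← T.iUnion_hull, mem_iUnion₂] at h1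
  obtain ⟨K, hK, -⟩ := h1
  exact ⟨K, hK⟩

open scoped Classical in
/-- The seminorm is not identically zero: it is positive at a barycentric coordinate of one
element, extended by zero. -/
theorem exists_seminorm2h_pos (hn : 1 ≤ n) (hΩ : Ω.Nonempty) (m : ℕ) :
    ∃ v ∈ T.VH (m + 3), 0 < T.seminorm2h v := by
  have hd : 1 ≤ n + 1 := by omega
  obtain ⟨K, hK⟩ := T.elements_nonempty hΩ
  have hS := isSimplex hK
  obtain ⟨c, hc⟩ : K.Nonempty := Finset.card_pos.1 (by rw [(T.mem_elements.1 hK).2]; omega)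
  set U : Finset (E (n + 1)) → MvPolynomial (Fin (n + 1)) ℝ := fun K' =>
    if K' = K then baryPoly K c else 0 with hU
  set v := T.glue fun K' => polyEval (U K') with hv
  have hloc : ∀ K' ∈ T.elements, localPoly K' v = U K' := fun K' hK' =>
    localPoly_eq (isSimplex hK').interior_nonempty (T.agrees_glue hd _ K' hK')
  refine ⟨v, ⟨T.inL2_glue fun K' _ => continuous_polyEval _, fun K' hK' =>
    ⟨U K', ?_, T.agrees_glue hd _ K' hK'⟩⟩, ?_⟩
  · simp only [hU]
    split_ifs
    · exact (totalDegree_baryPoly_le K c).trans (by omega)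
    · simp
  have hF := T.erase_mem_sides hd hK hc
  have hg : 0 < ‖baryGrad K c‖ := norm_pos_iff.2 (hS.baryGrad_ne_zero hd hc)
  have hs : T.sideSign K (K.erase c) ^ 2 = 1 := by
    unfold sideSign
    split_ifs <;> norm_num
  have hK0 : ∀ x, gradNormal v (T.normal (K.erase c)) K x ^ 2 = ‖baryGrad K c‖ ^ 2 := by
    intro x
    have h1 : gradNormal v (T.normal (K.erase c)) K x =
        inner ℝ (baryGrad K c) (T.normal (K.erase c)) := by
      rw [gradNormal, hloc K hK, inner_eq_sum]
      simp only [hU, if_true, pderiv_baryPoly]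
      simp [polyEval]
    rw [h1, IsFieldData.normal_eq_smul hK hc, inner_smul_right, real_inner_self_eq_norm_sq,
      mul_pow, neg_sq, mul_pow, hs]
    field_simp
  have hK1 : ∀ K' ∈ T.elements, K' ≠ K → ∀ x,
      gradNormal v (T.normal (K.erase c)) K' x = 0 := by
    intro K' hK' hne x
    rw [gradNormal, hloc K' hK']
    simp [hU, hne, polyEval]
  have hjump : ∀ x, T.jump (gradNormal v (T.normal (K.erase c))) (K.erase c) x ^ 2 =
      ‖baryGrad K c‖ ^ 2 := by
    intro x
    rw [← hK0 x, jump]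
    by_cases hp : T.plus (K.erase c) = K
    · rw [Finset.sum_eq_zero, sub_zero, hp]
      intro K' hK'
      rw [Finset.mem_filter, hp] at hK'
      exact hK1 K' hK'.1 hK'.2.2 x
    · rw [hK1 _ (T.plus_spec hF).1 hp, zero_sub, neg_sq, Finset.sum_eq_single K]
      · intro K' hK' hne
        exact hK1 K' (Finset.mem_filter.1 hK').1 hne x
      · intro hn
        exact absurd (Finset.mem_filter.2 ⟨hK, Finset.erase_subset _ _, Ne.symm hp⟩) hn
  have hnorm : 0 < sideNormSq (K.erase c)
      (T.jump (gradNormal v (T.normal (K.erase c))) (K.erase c)) := by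
    obtain ⟨p, hp, hr⟩ := T.exists_side_enum hF
    have h1 := refInt_side hK hc hp hr (J := fun _ => ‖baryGrad K c‖ ^ 2 * 1)
      (G := fun _ => ‖baryGrad K c‖ ^ 2 * 1) fun _ _ => rfl
    have h2 : refInt n (fun _ => ‖baryGrad K c‖ ^ 2 * 1) =
        ‖baryGrad K c‖ ^ 2 * refInt n fun _ => 1 := integral_const_mul _ _
    simp only [sideNormSq, hjump, Nat.add_sub_cancel]
    rw [mul_one] at h1
    rw [h1, ← mul_one (‖baryGrad K c‖ ^ 2), h2]
    have := refInt_one_pos n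
    have := hS.simplexDensity_pos
    positivity
  have hpos : 0 < T.sideEnergy v (K.erase c) := by
    have h1 := sideDiam_pos hn hF
    unfold sideEnergy
    refine add_pos_of_pos_of_nonneg (by positivity) ?_
    split_ifs
    · exact le_rfl
    · exact mul_nonneg (by positivity) (sideNormSq_nonneg _ _)
  have h2 : 0 < T.seminorm2h v ^ 2 := by
    rw [seminorm2h_sq]
    exact add_pos_of_nonneg_of_pos (Finset.sum_nonneg fun K _ => h2SeminormSq_nonneg v K)
      (hpos.trans_le (Finset.single_le_sum (f := T.sideEnergy v)
        (fun F _ => sideEnergy_nonneg v F) hF))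
  exact lt_of_le_of_ne (Real.sqrt_nonneg _) fun h => by
    rw [← h] at h2
    simp at h2

/-- The inf-sup bound in dimension `n + 1` and degree `m + 3`, with the quotient attained by an explicit
field. -/
theorem inf_sup (n m : ℕ) (hn : 1 ≤ n) (hn2 : n ≤ 2) (γ : ℝ) :
    ∃ β : ℝ, 0 < β ∧ ∀ {Ω : Set (E (n + 1))}, IsOpen Ω → Ω.Nonempty → Bornology.IsBounded Ω →
    interior (closure Ω) = Ω → ∀ {T : Triangulation Ω}, T.ShapeRegular γ → ∀ v ∈ T.VH (m + 3),
      ∃ r ∈ T.infSupQuotients (m + 3) v, β * T.seminorm2h v ≤ r := by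
  obtain ⟨c, C, hc, hC, h⟩ := exists_test_field n m hn hn2 γ
  have hsC := Real.sqrt_pos.2 hC
  refine ⟨c / √C, div_pos hc hsC, ?_⟩
  intro Ω hopen hne hbdd hreg T hT v hv
  -- a test field for a function of positive seminorm does not vanish
  have hpos : ∀ w : E (n + 1) → ℝ, 0 < T.seminorm2h w →
      ∀ τ ∈ T.SigmaH (m + 3), ∀ g, HasWeakDivDiv Ω τ g →
      c * T.seminorm2h w ^ 2 ≤ ∫ x in Ω, g x * w x → 0 < l2Norm Ω τ := by
    intro w hw τ hτ g hg hgw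
    refine lt_of_le_of_ne (Real.sqrt_nonneg _) fun h0 => ?_
    rw [hg.integral_mul_eq_zero hopen hbdd (inL2_of_mem_SigmaH hτ) h0.symm] at hgw
    have : 0 < c * T.seminorm2h w ^ 2 := by positivity
    linarith
  have hs0 : 0 ≤ T.seminorm2h v := Real.sqrt_nonneg _
  rcases hs0.eq_or_lt with hs | hs
  · -- if the seminorm of `v` vanishes, any nonzero field will do, up to its sign
    obtain ⟨w, hw, hw0⟩ := T.exists_seminorm2h_pos hn hne m
    obtain ⟨τ, hτ, hτn, g, hg, hgw, -⟩ := h hopen hreg hT w hw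
    have hτ0 := hpos w hw0 τ hτ g hg hgw
    rw [← hs, mul_zero]
    rcases le_total 0 (∫ x in Ω, g x * v x) with h1 | h1
    · exact ⟨_, ⟨τ, hτ, hτ0.ne', g, hg, rfl⟩, div_nonneg h1 hτ0.le⟩
    · refine ⟨_, ⟨-τ, hτn, by rw [l2Norm_neg]; exact hτ0.ne', -g, hg.neg, rfl⟩, ?_⟩
      rw [l2Norm_neg]
      simp only [Pi.neg_apply, neg_mul, integral_neg]
      exact div_nonneg (neg_nonneg.2 h1) hτ0.le
  · obtain ⟨τ, hτ, -, g, hg, hgv, hτv⟩ := h hopen hreg hT v hv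
    have hτ0 := hpos v hs τ hτ g hg hgv
    refine ⟨_, ⟨τ, hτ, hτ0.ne', g, hg, rfl⟩, ?_⟩
    have hle : l2Norm Ω τ ≤ √C * T.seminorm2h v := by
      refine abs_le_of_sq_le_sq' ?_ (by positivity) |>.2
      rw [mul_pow, Real.sq_sqrt hC.le]
      exact hτv
    rw [le_div_iff₀ hτ0]
    refine le_trans ?_ hgv
    calc _ ≤ c / √C * T.seminorm2h v * (√C * T.seminorm2h v) :=
          mul_le_mul_of_nonneg_left hle (by positivity)
      _ = c * T.seminorm2h v ^ 2 := by field_simp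

end Triangulation

end DivDivFEM

theorem mainTheorem6 (d : ℕ) (hd : d = 2 ∨ d = 3)
    (Ω : Set (DivDivFEM.E d)) (hopen : IsOpen Ω) (hconn : IsConnected Ω)
    (hbdd : Bornology.IsBounded Ω) (hreg : interior (closure Ω) = Ω)
    (k : ℕ) (hk : 3 ≤ k) (γ θ : ℝ) :
    ∃ β : ℝ, 0 < β ∧ ∀ T : DivDivFEM.Triangulation Ω, T.ShapeRegular γ → T.QuasiUniform θ →
      (∀ τ ∈ T.SigmaH k, ∃ g : DivDivFEM.E d → ℝ, DivDivFEM.HasWeakDivDiv Ω τ g) ∧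
      ∀ v ∈ T.VH k,
        ((β * T.seminorm2h v : ℝ) : EReal) ≤ ⨆ r ∈ T.infSupQuotients k v, (r : EReal) := by
  obtain ⟨n, hn, hn2, rfl⟩ : ∃ n, 1 ≤ n ∧ n ≤ 2 ∧ d = n + 1 := ⟨d - 1, by omega, by omega, by omega⟩
  obtain ⟨m, rfl⟩ := Nat.exists_eq_add_of_le' hk
  obtain ⟨β, hβ, h⟩ := DivDivFEM.Triangulation.inf_sup n m hn hn2 γ
  refine ⟨β, hβ, fun T hT _ => ⟨fun τ hτ =>
    ⟨_, DivDivFEM.Triangulation.exists_hasWeakDivDiv hopen hreg hτ⟩, fun v hv => ?_⟩⟩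
  obtain ⟨r, hr, hle⟩ := h hopen hconn.nonempty hbdd hreg hT v hv
  exact (EReal.coe_le_coe_iff.2 hle).trans
    (le_iSup₂ (f := fun (r : ℝ) (_ : r ∈ T.infSupQuotients (m + 3) v) => (r : EReal)) r hr)
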